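/- Consider the Thirring model (cubic Dirac equation) on $\mathbb{R}^{1+1}$, $$(\partial_t+\partial_x)u = iv + i|v|^2u,\qquad (\partial_t-\partial_x)v = iu+i|u|^2v .$$ Let $\langle x\rangle=(1+x^2)^{1/2}$, and for $T\ge 1$ let $$S_T=\{(T,x): \langle x\rangle\ge T\}\cup\{(\langle x\rangle,x):\langle x\rangle\le T\}.$$ For a function $\phi(t,x)$ with values in $\mathbb{C}$ and a weight $f\ge 0$ on $S_T$ put $$E_{ext,T}(\phi,f)=\Big(\int_{S_T} n^\alpha Q_{\alpha 0}[\phi]\,f\,dx\Big)^{1/2}\in[0,\infty],\qquad Q_{\alpha\beta}[\phi]=\Re\Big(\overline{\partial_\alpha\phi}\,\partial_\beta\phi-\tfrac12 m_{\alpha\beta}\big(\overline{\partial^\mu\phi}\,\partial_\mu\phi-|\phi|^2\big)\Big),$$ where $m=\mathrm{diag}(1,-1)$, $\partial_0=\partial_t$, $\partial_1=\partial_x$, and $n^\alpha\partial_\alpha=\partial_t$ on the part of $S_T$ with $t=T\le\langle x\rangle$, $n^\alpha\partial_\alpha=\partial_t+\frac{x}{\langle x\rangle}\partial_x$ on the part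 with $t=\langle x\rangle<T$. (Thus $n^\alpha Q_{\alpha0}[\phi]$ equals $\frac12(|\partial_t\phi|^2+|\partial_x\phi|^2+|\phi|^2)$ on the first part, and the same expression plus $\frac{x}{t}\Re(\overline{\partial_t\phi}\,\partial_x\phi)$ on the second.) Let $Z=t\partial_x+x\partial_t$, for $N\ge1$ and $0\le j\le N$ let $w_j=(t+|x|)^{N-j}(|x|-t+1)^j$, and for $u,v$ of class $C^{N+4}$ define $$\mathcal{E}_{ext}(T)=\sum_{|I|\le N}\ \sum_{k=0}^{3}\Big(E_{ext,T}(\partial^IZ^ku,w_{|I|})+E_{ext,T}(\partial^IZ^kv,w_{|I|})\Big),$$ where $I$ runs over the multi-indices in $(t,x)$. **Theorem.** Let $N\ge1$. There exist constants $\epsilon>0$ and $C>0$, depending only on $N$, such that for every pair $u,v:\mathbb{R}^{1+1}\to\mathbb{C}$ of class $C^{N+4}$ that solves the Thirring model for $t\ge1$ and satisfies $\mathcal{E}_{ext}(1)\le\epsilon$, one has $$\mathcal{E}_{ext}(T)\le C\,\mathcal{E}_{ext}(1)\qquad\text{for every } T\ge1 .$$ -/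

import Mathlib

open scoped ENNReal

noncomputable section

namespace Thirring

/-- The time derivative `∂_t φ`; points of `ℝ × ℝ` are pairs `(t, x)`. -/
def dt (φ : ℝ × ℝ → ℂ) : ℝ × ℝ → ℂ := fun p => fderiv ℝ φ p (1, 0)

/-- The space derivative `∂_x φ`. -/
def dx (φ : ℝ × ℝ → ℂ) : ℝ × ℝ → ℂ := fun p => fderiv ℝ φ p (0, 1)

/-- `∂_0 = ∂_t` and `∂_1 = ∂_x`. -/
def pd (α : Fin 2) (φ : ℝ × ℝ → ℂ) : ℝ × ℝ → ℂ := ![dt φ, dx φ] α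

/-- The vector field `Z = t ∂_x + x ∂_t`. -/
def boost (φ : ℝ × ℝ → ℂ) : ℝ × ℝ → ℂ :=
  fun p => (p.1 : ℂ) * dx φ p + (p.2 : ℂ) * dt φ p

/-- `∂^I Z^k φ` for the multi-index `I = (I.1, I.2)`. -/
def vf (I : ℕ × ℕ) (k : ℕ) (φ : ℝ × ℝ → ℂ) : ℝ × ℝ → ℂ :=
  dt^[I.1] (dx^[I.2] (boost^[k] φ))

/-- `(u, v)` satisfies the Thirring system (cubic Dirac equation) at all points with `t ≥ 1`. -/
def IsSolution (u v : ℝ × ℝ → ℂ) : Prop :=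
  ∀ t x : ℝ, 1 ≤ t →
    dt u (t, x) + dx u (t, x)
        = Complex.I * v (t, x) + Complex.I * (‖v (t, x)‖ : ℂ) ^ 2 * u (t, x) ∧
    dt v (t, x) - dx v (t, x)
        = Complex.I * u (t, x) + Complex.I * (‖u (t, x)‖ : ℂ) ^ 2 * v (t, x)

/-- The metric `m = diag(1, -1)`, which is its own inverse. -/
def metric : Matrix (Fin 2) (Fin 2) ℝ := Matrix.diagonal ![1, -1]

/-- The Klein-Gordon energy momentum tensor
`Q_{αβ} = Re (∂_α φ† ∂_β φ - ½ m_{αβ} (∂^μ φ† ∂_μ φ - |φ|²))`. -/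
def emTensor (φ : ℝ × ℝ → ℂ) (α β : Fin 2) (p : ℝ × ℝ) : ℝ :=
  (star (pd α φ p) * pd β φ p
    - (1 / 2 : ℂ) * (metric α β : ℂ) *
      ((∑ μ, ∑ ν, (metric μ ν : ℂ) * star (pd ν φ p) * pd μ φ p) - (‖φ p‖ : ℂ) ^ 2)).re

/-- The Japanese bracket `⟨x⟩ = (1 + x²)^{1/2}`. -/
def bracket (x : ℝ) : ℝ := Real.sqrt (1 + x ^ 2)

/-- The exterior boundary `S_T`, which is the graph `t = min(T, ⟨x⟩)`, parametrized by `x`. -/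
def surf (T x : ℝ) : ℝ × ℝ := (min T (bracket x), x)

/-- The vector `n` on `S_T`: `∂_t` on the part `t = T ≤ ⟨x⟩`, and `∂_t + (x / ⟨x⟩) ∂_x` on the
part `t = ⟨x⟩ < T`. -/
def normal (T x : ℝ) : Fin 2 → ℝ :=
  if T ≤ bracket x then ![1, 0] else ![1, x / bracket x]

/-- The weighted energy `E_{ext,T}(φ, f) = (∫_{S_T} n^α Q_{α0}[φ] f dx)^{1/2}`, with values in
`[0, ∞]`. The integrand is nonnegative when `f ≥ 0` on `S_T`. -/
def extEnergy (T : ℝ) (φ : ℝ × ℝ → ℂ) (f : ℝ × ℝ → ℝ) : ℝ≥0∞ :=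
  (∫⁻ x : ℝ, ENNReal.ofReal
    ((∑ α, normal T x α * emTensor φ α 0 (surf T x)) * f (surf T x))) ^ (1 / 2 : ℝ)

/-- The weights `w_j = (t + |x|)^{N-j} (|x| - t + 1)^j`, for `0 ≤ j ≤ N`. -/
def weight (N j : ℕ) (p : ℝ × ℝ) : ℝ :=
  (p.1 + |p.2|) ^ (N - j) * (|p.2| - p.1 + 1) ^ j

/-- The total exterior energy: the sum over `|I| = j ≤ N` and `0 ≤ k ≤ 3` of the weighted energies
of `∂^I Z^k u` and `∂^I Z^k v`. -/
def totalExtEnergy (N : ℕ) (u v : ℝ × ℝ → ℂ) (T : ℝ) : ℝ≥0∞ :=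
  ∑ j ∈ Finset.range (N + 1), ∑ I ∈ Finset.HasAntidiagonal.antidiagonal j, ∑ k ∈ Finset.range 4,
    (extEnergy T (vf I k u) (weight N j) + extEnergy T (vf I k v) (weight N j))

end Thirring

end

/-! ### Null coordinates, the exterior region and the divergence theorem on it. -/

noncomputable section
namespace Thirring
open MeasureTheory Set

/-! By the reflection `x ↦ -x`, which exchanges `u` and `v`, it suffices to treat `x ≥ 0`. In the
null coordinates `y = x - t`, `z = x + t` the system reads `∂_z U = (iV + F)/2`, `∂_y V = -(iU +
G)/2`. The derivatives `∂^I (Z + c)^k` preserve this form when the spin `c` is `-1/2` on `u` and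
`1/2` on `v`; the cubic terms then obey a Leibniz rule in which spins add up.

The divergence theorem for `|U|² w`, `|V|² w` with `w = z^(N-j) (1+y)^j` cancels the mass terms
(`NullSystem.energy_le`). The `y`-derivative of `w` yields a positive spacetime integral of `|V|²`,
with factor `j`; the `z`-derivative yields an error in `|U|²`, with factor `N - j`. Since `iU = V_t
- V_x - G` (`NullSystem.I_mul_U_eq`), the error at level `j` is bounded by the spacetime integral
gained at level `j + 1`, for one more derivative, and by cubic terms. A downward induction that
starts at `j = N`, where there is no error, closes the linear estimate (`NullSystem.flux_le`).

The cubic terms are controlled by two quantities: the energy of `U` on incoming rays, uniformly in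
`z`, and the spacetime integral of `|V|²`. Sobolev embedding along an incoming ray turns the first
into a weighted pointwise bound for `U`, and the second into a bound for `V` in `L²` in `z` with
values in `L^∞` in `y`. Every cubic error is then integrable with a bound quadratic in the size `A`
of these quantities (`NullSystem.source_le`, `NullSystem.regionInt_cubicDensity_le`), and a
continuity argument in `z` keeps `A` comparable to the data (`NullSystem.boundedBy_of_small`).
Boosts are only carried along; the decay comes from the weights.

Finally the Klein-Gordon energy on `S_T` is compared with the Dirac fluxes. Its densities of the
derivatives along `∂_t + ∂_x` and `∂_t - ∂_x` carry the factors `1 + τ` and `1 - τ`, with `τ` the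
slope of `S_T`, which are the Jacobians of `z` and `y` along `S_T`. What the flux of `U` does not
give, namely `|u|²` and `(∂_t + ∂_x) u`, is recovered pointwise from the flux density of `V` through
the equations (`exists_energyDensity_le`). -/

/-- In the null coordinates `y = x - t`, `z = x + t`: the value of `y` at which the incoming ray of
constant `z` leaves the region `{y₀ ≤ y, -1 ≤ y z, z - y ≤ 2 T}`. -/
def rayExitIn (T y₀ z : ℝ) : ℝ := max y₀ (max (-(max 1 z)⁻¹) (z - 2 * T))

/-- The value of `z` at which the outgoing ray of constant `y` leaves the region
`{z ≤ z₀, -1 ≤ y z, z - y ≤ 2 T}`. -/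
def rayExitOut (T z₀ y : ℝ) : ℝ := min z₀ (min (y + 2 * T) (if y < 0 then -y⁻¹ else z₀))

/-- The integral of `h` over the region `{z₁ ≤ z ≤ z₀, rayExitIn T y₀ z ≤ y ≤ z - 2}`. -/
def regionInt (T y₀ z₀ : ℝ) (h : ℝ → ℝ → ℝ) : ℝ :=
  ∫ z in (y₀ + 2)..z₀, ∫ y in (rayExitIn T y₀ z)..(z - 2), h y z

/-- The truncation `max 1 z` is inactive on the region, where `1 ≤ z`; it makes the exit function
continuous on the whole line. -/
lemma continuous_rayExitIn (T y₀ : ℝ) : Continuous (rayExitIn T y₀) := by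
  unfold rayExitIn
  have : Continuous fun z : ℝ => (max 1 z)⁻¹ :=
    (continuous_const.max continuous_id).inv₀ fun _ => (lt_of_lt_of_le one_pos (le_max_left _ _)).ne'
  fun_prop

/-- The essential case `-1/z ≤ z - 2` is `(z - 1)² ≥ 0`: the hyperboloid touches the line `t = 1`
from above at `x = 0`. -/
lemma rayExitIn_le {T y₀ z : ℝ} (hT : 1 ≤ T) (hy : -1 ≤ y₀) (hz : y₀ + 2 ≤ z) :
    rayExitIn T y₀ z ≤ z - 2 := by
  have hz1 : 1 ≤ z := by linarith
  unfold rayExitIn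
  refine max_le (by linarith) (max_le ?_ (by linarith))
  rw [max_eq_right hz1, ← inv_neg, ← one_div, div_le_iff_of_neg (by linarith)]
  nlinarith [sq_nonneg (z - 1)]

lemma le_rayExitOut {T z₀ y : ℝ} (hT : 1 ≤ T) (hz : y + 2 ≤ z₀) :
    y + 2 ≤ rayExitOut T z₀ y := by
  unfold rayExitOut
  refine le_min hz (le_min (by linarith) ?_)
  split_ifs with h
  · rw [← inv_neg, ← one_div, le_div_iff₀ (by linarith)]
    nlinarith [sq_nonneg (y + 1)]
  · exact hz

lemma rayExitIn_le_iff {T y₀ y z : ℝ} (hz : 1 ≤ z) :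
    rayExitIn T y₀ z ≤ y ↔ y₀ ≤ y ∧ -1 ≤ y * z ∧ z ≤ y + 2 * T := by
  unfold rayExitIn
  rw [max_le_iff, max_le_iff, max_eq_right hz, ← inv_neg, ← one_div, div_le_iff_of_neg (by linarith)]
  constructor
  · rintro ⟨h1, h2, h3⟩; exact ⟨h1, by linarith, by linarith⟩
  · rintro ⟨h1, h2, h3⟩; exact ⟨h1, by linarith, by linarith⟩

lemma le_rayExitOut_iff {T z₀ y z : ℝ} (hz : 0 < z) :
    z ≤ rayExitOut T z₀ y ↔ z ≤ z₀ ∧ -1 ≤ y * z ∧ z ≤ y + 2 * T := by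
  unfold rayExitOut
  rw [le_min_iff, le_min_iff]
  split_ifs with h
  · rw [← inv_neg, ← one_div, le_div_iff₀ (by linarith)]
    constructor
    · rintro ⟨h1, h2, h3⟩; exact ⟨h1, by linarith, by linarith⟩
    · rintro ⟨h1, h2, h3⟩; exact ⟨h1, by linarith, by linarith⟩
  · have : 0 ≤ y * z := by push Not at h; positivity
    constructor
    · rintro ⟨h1, h2, h3⟩; exact ⟨h1, by linarith, by linarith⟩
    · rintro ⟨h1, h2, h3⟩; exact ⟨h1, by linarith, by linarith⟩

/-- The region can be swept by incoming rays or by outgoing rays; this is what Fubini needs. -/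
lemma region_mem_iff {T y₀ z₀ y z : ℝ} (hy : -1 ≤ y₀) :
    (z ∈ Icc (y₀ + 2) z₀ ∧ y ∈ Icc (rayExitIn T y₀ z) (z - 2)) ↔
      (y ∈ Icc y₀ (z₀ - 2) ∧ z ∈ Icc (y + 2) (rayExitOut T z₀ y)) := by
  simp only [mem_Icc]
  constructor
  · rintro ⟨⟨h1, h2⟩, h3, h4⟩
    have hz : 1 ≤ z := by linarith
    rw [rayExitIn_le_iff hz] at h3
    exact ⟨⟨h3.1, by linarith⟩, by linarith, (le_rayExitOut_iff (by linarith)).2 ⟨h2, h3.2⟩⟩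
  · rintro ⟨⟨h1, h2⟩, h3, h4⟩
    have hz : 1 ≤ z := by linarith
    rw [le_rayExitOut_iff (by linarith)] at h4
    exact ⟨⟨by linarith, h4.1⟩, (rayExitIn_le_iff hz).2 ⟨h1, h4.2⟩, by linarith⟩

/-- The closed region over which `regionInt` integrates. -/
def region (T y₀ z₀ : ℝ) : Set (ℝ × ℝ) :=
  {p | p.2 ∈ Icc (y₀ + 2) z₀ ∧ p.1 ∈ Icc (rayExitIn T y₀ p.2) (p.2 - 2)}

lemma isCompact_region (T y₀ z₀ : ℝ) : IsCompact (region T y₀ z₀) := by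
  have hc : IsClosed (region T y₀ z₀) := by
    have h1 := continuous_rayExitIn T y₀
    have : region T y₀ z₀ = {p : ℝ × ℝ | y₀ + 2 ≤ p.2} ∩ {p | p.2 ≤ z₀} ∩
        ({p | rayExitIn T y₀ p.2 ≤ p.1} ∩ {p | p.1 ≤ p.2 - 2}) := by
      ext p; simp [region]
    rw [this]
    exact ((isClosed_le continuous_const continuous_snd).inter
      (isClosed_le continuous_snd continuous_const)).inter
      ((isClosed_le (h1.comp continuous_snd) continuous_fst).inter
        (isClosed_le continuous_fst (continuous_snd.sub continuous_const)))
  refine (isCompact_Icc.prod isCompact_Icc : IsCompact (Icc y₀ (z₀ - 2) ×ˢ Icc (y₀ + 2) z₀)).of_isClosed_subset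
    hc ?_
  rintro ⟨y, z⟩ ⟨h1, h2⟩
  refine ⟨⟨(le_max_left _ _).trans h2.1, ?_⟩, h1⟩
  have := h2.2; have := h1.2
  simp only at *
  linarith

lemma integrable_region {T y₀ z₀ : ℝ} {h : ℝ → ℝ → ℝ} (hh : Continuous (Function.uncurry h)) :
    Integrable ((region T y₀ z₀).indicator (Function.uncurry h)) (volume.prod volume) := by
  rw [integrable_indicator_iff (isCompact_region T y₀ z₀).measurableSet]
  exact hh.continuousOn.integrableOn_compact (isCompact_region T y₀ z₀)

lemma integral_indicator_eq_of_section {a b : ℝ} (hab : a ≤ b) {s : Set ℝ} (hs : s = Icc a b) (f : ℝ → ℝ) :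
    ∫ x, s.indicator f x = ∫ x in a..b, f x := by
  rw [hs, integral_indicator measurableSet_Icc, integral_Icc_eq_integral_Ioc,
    intervalIntegral.integral_of_le hab]

lemma regionInt_eq {T y₀ z₀ : ℝ} (hT : 1 ≤ T) (hy : -1 ≤ y₀) (hz : y₀ + 2 ≤ z₀) (h : ℝ → ℝ → ℝ) :
    regionInt T y₀ z₀ h = ∫ z, ∫ y, (region T y₀ z₀).indicator (Function.uncurry h) (y, z) := by
  unfold regionInt
  rw [← integral_indicator_eq_of_section hz rfl]
  congr 1; ext z
  by_cases hmem : z ∈ Icc (y₀ + 2) z₀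
  · rw [indicator_of_mem hmem,
      ← integral_indicator_eq_of_section (rayExitIn_le hT hy hmem.1) rfl]
    congr 1; ext y
    by_cases hy' : y ∈ Icc (rayExitIn T y₀ z) (z - 2)
    · rw [indicator_of_mem hy', indicator_of_mem (show (y, z) ∈ region T y₀ z₀ from ⟨hmem, hy'⟩)]
      rfl
    · rw [indicator_of_notMem hy',
        indicator_of_notMem (show (y, z) ∉ region T y₀ z₀ from fun h => hy' h.2)]
  · rw [indicator_of_notMem hmem]
    symm
    apply integral_eq_zero_of_ae
    filter_upwards with y
    rw [indicator_of_notMem (show (y, z) ∉ region T y₀ z₀ from fun h => hmem h.1)]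
    rfl

lemma region_section_out {T y₀ z₀ : ℝ} (hT : 1 ≤ T) (hy : -1 ≤ y₀) (h : ℝ → ℝ → ℝ) (y : ℝ) :
    ∫ z, (region T y₀ z₀).indicator (Function.uncurry h) (y, z) =
      (Icc y₀ (z₀ - 2)).indicator (fun y => ∫ z in (y + 2)..(rayExitOut T z₀ y), h y z) y := by
  by_cases hmem : y ∈ Icc y₀ (z₀ - 2)
  · rw [indicator_of_mem hmem, ← integral_indicator_eq_of_section
      (le_rayExitOut hT (by linarith [hmem.2])) rfl]
    congr 1; ext z
    by_cases hz' : z ∈ Icc (y + 2) (rayExitOut T z₀ y)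
    · rw [indicator_of_mem hz', indicator_of_mem
        (show (y, z) ∈ region T y₀ z₀ from (region_mem_iff hy).2 ⟨hmem, hz'⟩)]
      rfl
    · rw [indicator_of_notMem hz', indicator_of_notMem
        (show (y, z) ∉ region T y₀ z₀ from fun h => hz' ((region_mem_iff hy).1 h).2)]
  · rw [indicator_of_notMem hmem]
    apply integral_eq_zero_of_ae
    filter_upwards with z
    rw [indicator_of_notMem
      (show (y, z) ∉ region T y₀ z₀ from fun h => hmem ((region_mem_iff hy).1 h).1)]
    rfl

lemma regionInt_swap {T y₀ z₀ : ℝ} (hT : 1 ≤ T) (hy : -1 ≤ y₀) (hz : y₀ + 2 ≤ z₀) {h : ℝ → ℝ → ℝ}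
    (hh : Continuous (Function.uncurry h)) :
    regionInt T y₀ z₀ h = ∫ y in y₀..(z₀ - 2), ∫ z in (y + 2)..(rayExitOut T z₀ y), h y z := by
  rw [regionInt_eq hT hy hz, ← integral_indicator_eq_of_section (by linarith) rfl]
  rw [← integral_integral_swap (f := fun y z => (region T y₀ z₀).indicator (Function.uncurry h) (y, z))
    (integrable_region hh)]
  simp only [region_section_out hT hy]

/-- Integrability is read off from Fubini, so that no continuity of `rayExitOut` is required. -/
lemma intervalIntegrable_rayOut {T y₀ z₀ : ℝ} (hT : 1 ≤ T) (hy : -1 ≤ y₀) (hz : y₀ + 2 ≤ z₀)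
    {h : ℝ → ℝ → ℝ} (hh : Continuous (Function.uncurry h)) :
    IntervalIntegrable (fun y => ∫ z in (y + 2)..(rayExitOut T z₀ y), h y z) volume y₀ (z₀ - 2) := by
  have := (integrable_region (T := T) (y₀ := y₀) (z₀ := z₀) hh).integral_prod_left
  simp only [region_section_out hT hy] at this
  rw [integrable_indicator_iff measurableSet_Icc] at this
  rw [intervalIntegrable_iff_integrableOn_Icc_of_le (by linarith)]
  exact this

lemma continuous_ray_integral {h : ℝ → ℝ → ℝ} (hh : Continuous (Function.uncurry h)) {a b : ℝ → ℝ}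
    (ha : Continuous a) (hb : Continuous b) : Continuous fun z => ∫ y in (a z)..(b z), h y z := by
  have hs : Continuous (Function.uncurry fun z y => h y z) := hh.comp continuous_swap
  have : (fun z => ∫ y in (a z)..(b z), h y z) =
      fun z => (∫ y in (0 : ℝ)..(b z), h y z) - ∫ y in (0 : ℝ)..(a z), h y z := by
    ext z
    have hc : Continuous fun y => h y z := by
      exact hh.comp (continuous_id.prodMk continuous_const)
    rw [intervalIntegral.integral_interval_sub_left (hc.intervalIntegrable _ _)
      (hc.intervalIntegrable _ _)]
  rw [this]
  exact (intervalIntegral.continuous_parametric_intervalIntegral_of_continuous hs hb).sub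
    (intervalIntegral.continuous_parametric_intervalIntegral_of_continuous hs ha)

/-- The divergence theorem on the region: the flux of `(f, g)` through the exit boundary. -/
lemma flux_identity {T y₀ z₀ : ℝ} (hT : 1 ≤ T) (hy : -1 ≤ y₀) (hz : y₀ + 2 ≤ z₀)
    {f g fz gy : ℝ → ℝ → ℝ} (hf : Continuous (Function.uncurry f)) (hg : Continuous (Function.uncurry g))
    (hfz : Continuous (Function.uncurry fz)) (hgy : Continuous (Function.uncurry gy))
    (df : ∀ y z, y + 2 < z → HasDerivAt (fun z => f y z) (fz y z) z)
    (dg : ∀ y z, y + 2 < z → HasDerivAt (fun y => g y z) (gy y z) y) :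
    (∫ y in y₀..(z₀ - 2), f y (rayExitOut T z₀ y)) + ∫ z in (y₀ + 2)..z₀, g (rayExitIn T y₀ z) z =
      (∫ y in y₀..(z₀ - 2), f y (y + 2)) + (∫ z in (y₀ + 2)..z₀, g (z - 2) z) +
        regionInt T y₀ z₀ fun y z => fz y z - gy y z := by
  have cf : ∀ y, Continuous fun z => f y z := fun y => hf.comp (continuous_const.prodMk continuous_id)
  have cfz : ∀ y, Continuous fun z => fz y z := fun y => hfz.comp (continuous_const.prodMk continuous_id)
  have cfz' : ∀ z, Continuous fun y => fz y z := fun z => hfz.comp (continuous_id.prodMk continuous_const)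
  have cg : ∀ z, Continuous fun y => g y z := fun z => hg.comp (continuous_id.prodMk continuous_const)
  have cgy : ∀ z, Continuous fun y => gy y z := fun z => hgy.comp (continuous_id.prodMk continuous_const)
  -- Fundamental theorem of calculus on each outgoing ray, then Fubini. The derivative is only known
  -- for `y + 2 < z`, that is `t > 1`, hence the version that needs it in the open interval only.
  have e1 : ∫ y in y₀..(z₀ - 2), f y (rayExitOut T z₀ y) =
      (∫ y in y₀..(z₀ - 2), f y (y + 2)) + regionInt T y₀ z₀ fz := by
    rw [regionInt_swap hT hy hz hfz, ← intervalIntegral.integral_add]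
    · apply intervalIntegral.integral_congr
      intro y hmem
      rw [uIcc_of_le (by linarith)] at hmem
      simp only
      rw [intervalIntegral.integral_eq_sub_of_hasDerivAt_of_le
        (le_rayExitOut hT (by linarith [hmem.2])) (cf y).continuousOn
        (fun z hz' => df y z hz'.1) ((cfz y).intervalIntegrable _ _)]
      ring
    · apply Continuous.intervalIntegrable
      exact hf.comp (continuous_id.prodMk (continuous_id.add continuous_const))
    · exact intervalIntegrable_rayOut hT hy hz hfz
  have e2 : ∫ z in (y₀ + 2)..z₀, g (rayExitIn T y₀ z) z =
      (∫ z in (y₀ + 2)..z₀, g (z - 2) z) - regionInt T y₀ z₀ gy := by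
    unfold regionInt
    rw [← intervalIntegral.integral_sub]
    · apply intervalIntegral.integral_congr
      intro z hmem
      rw [uIcc_of_le hz] at hmem
      simp only
      rw [intervalIntegral.integral_eq_sub_of_hasDerivAt_of_le
        (rayExitIn_le hT hy hmem.1) (cg z).continuousOn
        (fun y hy' => dg y z (by linarith [hy'.2])) ((cgy z).intervalIntegrable _ _)]
      ring
    · apply Continuous.intervalIntegrable
      exact hg.comp ((continuous_id.sub continuous_const).prodMk continuous_id)
    · apply Continuous.intervalIntegrable
      exact continuous_ray_integral hgy (continuous_rayExitIn T y₀) (continuous_id.sub continuous_const)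
  have e3 : (regionInt T y₀ z₀ fun y z => fz y z - gy y z) =
      regionInt T y₀ z₀ fz - regionInt T y₀ z₀ gy := by
    unfold regionInt
    rw [← intervalIntegral.integral_sub]
    · apply intervalIntegral.integral_congr
      intro z _
      simp only
      rw [intervalIntegral.integral_sub ((cfz' z).intervalIntegrable _ _) ((cgy z).intervalIntegrable _ _)]
    · apply Continuous.intervalIntegrable
      exact continuous_ray_integral hfz (continuous_rayExitIn T y₀) (continuous_id.sub continuous_const)
    · apply Continuous.intervalIntegrable
      exact continuous_ray_integral hgy (continuous_rayExitIn T y₀) (continuous_id.sub continuous_const)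
  rw [e1, e2, e3]; ring

lemma continuous_slice_left {h : ℝ → ℝ → ℝ} (hh : Continuous (Function.uncurry h)) (z : ℝ) :
    Continuous fun y => h y z :=
  hh.comp (continuous_id.prodMk continuous_const)

lemma continuous_slice_right {h : ℝ → ℝ → ℝ} (hh : Continuous (Function.uncurry h)) (y : ℝ) :
    Continuous fun z => h y z :=
  hh.comp (continuous_const.prodMk continuous_id)

lemma continuous_ray_regionInt {T y₀ : ℝ} {h : ℝ → ℝ → ℝ} (hh : Continuous (Function.uncurry h)) :
    Continuous fun z => ∫ y in (rayExitIn T y₀ z)..(z - 2), h y z :=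
  continuous_ray_integral hh (continuous_rayExitIn T y₀) (continuous_id.sub continuous_const)

lemma regionInt_mono {T y₀ z₀ : ℝ} (hT : 1 ≤ T) (hy : -1 ≤ y₀) (hz : y₀ + 2 ≤ z₀) {h k : ℝ → ℝ → ℝ}
    (hh : Continuous (Function.uncurry h)) (hk : Continuous (Function.uncurry k))
    (hle : ∀ y z, y₀ + 2 ≤ z → z ≤ z₀ → rayExitIn T y₀ z < y → y < z - 2 → h y z ≤ k y z) :
    regionInt T y₀ z₀ h ≤ regionInt T y₀ z₀ k := by
  unfold regionInt
  refine intervalIntegral.integral_mono_on hz ((continuous_ray_regionInt hh).intervalIntegrable _ _)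
    ((continuous_ray_regionInt hk).intervalIntegrable _ _) fun z hmem => ?_
  refine intervalIntegral.integral_mono_on_of_le_Ioo (rayExitIn_le hT hy hmem.1)
    ((continuous_slice_left hh z).intervalIntegrable _ _)
    ((continuous_slice_left hk z).intervalIntegrable _ _) fun y hy' => ?_
  exact hle y z hmem.1 hmem.2 hy'.1 hy'.2

lemma regionInt_add {T y₀ z₀ : ℝ} {h k : ℝ → ℝ → ℝ}
    (hh : Continuous (Function.uncurry h)) (hk : Continuous (Function.uncurry k)) :
    (regionInt T y₀ z₀ fun y z => h y z + k y z) = regionInt T y₀ z₀ h + regionInt T y₀ z₀ k := by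
  unfold regionInt
  rw [← intervalIntegral.integral_add ((continuous_ray_regionInt hh).intervalIntegrable _ _)
    ((continuous_ray_regionInt hk).intervalIntegrable _ _)]
  congr 1; ext z
  rw [intervalIntegral.integral_add ((continuous_slice_left hh z).intervalIntegrable _ _)
    ((continuous_slice_left hk z).intervalIntegrable _ _)]

lemma regionInt_const_mul {T y₀ z₀ : ℝ} (c : ℝ) (h : ℝ → ℝ → ℝ) :
    (regionInt T y₀ z₀ fun y z => c * h y z) = c * regionInt T y₀ z₀ h := by
  simp [regionInt, intervalIntegral.integral_const_mul]

/-- The integral of `h` over the whole region `{z ≤ z₀, -1 ≤ y z}`. -/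
def fullInt (z₀ : ℝ) (h : ℝ → ℝ → ℝ) : ℝ :=
  ∫ z in (1 : ℝ)..z₀, ∫ y in (-(max 1 z)⁻¹)..(z - 2), h y z

/-- For `T = z₀` and `y₀ = -1` the cut-offs in time and in `y` are vacuous, since `z - 2 z₀ ≤ -1 ≤
-1/z`. The whole region is thus a special case of the truncated ones. -/
lemma rayExitIn_full {z₀ z : ℝ} (hz : 1 ≤ z) (hz₀ : z ≤ z₀) :
    rayExitIn z₀ (-1) z = -(max 1 z)⁻¹ := by
  have h1 : (max 1 z)⁻¹ ≤ 1 := inv_le_one_of_one_le₀ (le_max_left _ _)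
  unfold rayExitIn
  rw [max_eq_left (a := -(max 1 z)⁻¹) (by linarith), max_eq_right (by linarith)]

lemma fullInt_eq {z₀ : ℝ} (hz : 1 ≤ z₀) (h : ℝ → ℝ → ℝ) : fullInt z₀ h = regionInt z₀ (-1) z₀ h := by
  unfold fullInt regionInt
  have : (-1 : ℝ) + 2 = 1 := by norm_num
  rw [this]
  apply intervalIntegral.integral_congr
  intro z hmem
  rw [uIcc_of_le hz] at hmem
  simp only [rayExitIn_full hmem.1 hmem.2]

lemma neg_inv_le {z : ℝ} (hz : 1 ≤ z) : -(max 1 z)⁻¹ ≤ z - 2 := by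
  rw [← rayExitIn_full hz le_rfl]
  exact rayExitIn_le hz le_rfl (by linarith)

lemma continuous_neg_inv : Continuous fun z : ℝ => -(max 1 z)⁻¹ :=
  ((continuous_const.max continuous_id).inv₀
    fun _ => (lt_of_lt_of_le one_pos (le_max_left _ _)).ne').neg

lemma continuous_full_ray {h : ℝ → ℝ → ℝ} (hh : Continuous (Function.uncurry h)) :
    Continuous fun z => ∫ y in (-(max 1 z)⁻¹)..(z - 2), h y z :=
  continuous_ray_integral hh continuous_neg_inv (continuous_id.sub continuous_const)

/-- `(y, z)` lies in the exterior region: the future of the line `t = 1`, outside the hyperboloid,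
with `x ≥ 0`. -/
structure InExt (y z : ℝ) : Prop where
  one_le : 1 ≤ z
  neg_one_le : -1 ≤ y * z
  le_sub : y ≤ z - 2

lemma inExt_of_rayExitIn_le {T y₀ y z : ℝ} (hz : 1 ≤ z) (h1 : rayExitIn T y₀ z ≤ y) (h2 : y ≤ z - 2) :
    InExt y z :=
  ⟨hz, ((rayExitIn_le_iff hz).1 h1).2.1, h2⟩

lemma inExt_of_neg_inv_le {y z : ℝ} (hz : 1 ≤ z) (h1 : -(max 1 z)⁻¹ ≤ y) (h2 : y ≤ z - 2) :
    InExt y z := by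
  rw [← rayExitIn_full hz le_rfl] at h1
  exact inExt_of_rayExitIn_le hz h1 h2

lemma InExt.neg_inv_le {y z : ℝ} (h : InExt y z) : -(max 1 z)⁻¹ ≤ y := by
  rw [max_eq_right h.one_le, ← inv_neg, ← one_div, div_le_iff_of_neg (by linarith [h.one_le])]
  linarith [h.neg_one_le]

lemma InExt.nonneg {y z : ℝ} (h : InExt y z) : 0 ≤ 1 + y := by
  have := h.neg_inv_le
  have h1 : (max 1 z)⁻¹ ≤ 1 := inv_le_one_of_one_le₀ (le_max_left _ _)
  linarith

lemma InExt.pos {y z : ℝ} (h : InExt y z) : 0 < z := by linarith [h.one_le]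

/-- A larger region gives a larger integral of a nonnegative function. -/
lemma regionInt_le_fullInt {T y₀ z₀ : ℝ} (hT : 1 ≤ T) (hy : -1 ≤ y₀) (hz : y₀ + 2 ≤ z₀)
    {h : ℝ → ℝ → ℝ} (hh : Continuous (Function.uncurry h)) (h0 : ∀ y z, InExt y z → 0 ≤ h y z) :
    regionInt T y₀ z₀ h ≤ fullInt z₀ h := by
  have inner0 : ∀ z, 1 ≤ z → 0 ≤ ∫ y in (-(max 1 z)⁻¹)..(z - 2), h y z := fun z hz' =>
    intervalIntegral.integral_nonneg (Thirring.neg_inv_le hz')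
      fun y hy' => h0 y z (inExt_of_neg_inv_le hz' hy'.1 hy'.2)
  have h1 : regionInt T y₀ z₀ h ≤ ∫ z in (y₀ + 2)..z₀, ∫ y in (-(max 1 z)⁻¹)..(z - 2), h y z := by
    unfold regionInt
    refine intervalIntegral.integral_mono_on hz ((continuous_ray_regionInt hh).intervalIntegrable _ _)
      ((continuous_full_ray hh).intervalIntegrable _ _) fun z hmem => ?_
    have hz1 : 1 ≤ z := by linarith [hmem.1]
    refine intervalIntegral.integral_mono_interval ?_ (rayExitIn_le hT hy hmem.1) le_rfl ?_
      ((continuous_slice_left hh z).intervalIntegrable _ _)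
    · exact (le_max_left _ _).trans (le_max_right _ _)
    · filter_upwards [ae_restrict_mem measurableSet_Ioc] with y hy'
      exact h0 y z (inExt_of_neg_inv_le hz1 hy'.1.le hy'.2)
  refine h1.trans ?_
  unfold fullInt
  refine intervalIntegral.integral_mono_interval (by linarith) hz le_rfl ?_
    ((continuous_full_ray hh).intervalIntegrable _ _)
  filter_upwards [ae_restrict_mem measurableSet_Ioc] with z hz'
  exact inner0 z hz'.1.le

end Thirring
end

/-! ### The abstract hierarchy and its weighted energy inequality. -/

noncomputable section
namespace Thirring
open MeasureTheory Set

/-- The weight `w_j` in null coordinates. -/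
def nullWeight (N j : ℕ) (y z : ℝ) : ℝ := z ^ (N - j) * (1 + y) ^ j

lemma continuous_nullWeight (N j : ℕ) : Continuous (Function.uncurry (nullWeight N j)) := by
  unfold nullWeight Function.uncurry; fun_prop

lemma InExt.nullWeight_nonneg {y z : ℝ} (h : InExt y z) (N j : ℕ) : 0 ≤ nullWeight N j y z :=
  mul_nonneg (pow_nonneg h.pos.le _) (pow_nonneg h.nonneg _)

/-- Both derivatives of the weight are nonnegative in the exterior region. In the energy identity
this one is an error for `U`, absent when `j = N`, and that of `hasDerivAt_nullWeight_left` is a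
gain for `V`. -/
lemma hasDerivAt_nullWeight_right (N j : ℕ) (y z : ℝ) :
    HasDerivAt (fun z => nullWeight N j y z) ((N - j : ℕ) * nullWeight (N - 1) j y z) z := by
  unfold nullWeight
  refine ((hasDerivAt_pow (N - j) z).mul_const ((1 + y) ^ j)).congr_deriv ?_
  rw [show N - 1 - j = N - j - 1 by omega]; ring

lemma hasDerivAt_nullWeight_left (N j : ℕ) (hj : j ≤ N) (y z : ℝ) :
    HasDerivAt (fun y => nullWeight N j y z) (j * nullWeight (N - 1) (j - 1) y z) y := by
  unfold nullWeight
  refine ((((hasDerivAt_id y).const_add 1).pow j).const_mul (z ^ (N - j))).congr_deriv ?_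
  rcases Nat.eq_zero_or_pos j with rfl | h
  · simp
  · rw [show N - 1 - (j - 1) = N - j by omega]; simp; ring

/-- A hierarchy of functions `U i`, `V i` in null coordinates `y = x - t`, `z = x + t`, where `U i` has
order `ord i ≤ N + 1`, whose derivatives along the two families of rays are given by the Dirac
system with cubic nonlinearities `F`, `G`, and whose weighted norms on the initial line `z - y = 2`
are bounded by `δ`. The maps `p` and `q` stand for `∂_t` and `∂_x`. -/
structure NullSystem {ι : Type*} (N : ℕ) (ord : ι → ℕ) (p q : ι → ι) (l : ι → List (ι × ι × ι))
    (δ : ℝ) (U V F G : ι → ℝ → ℝ → ℂ) : Prop where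
  ord_le : ∀ i, ord i ≤ N + 1
  ord_p : ∀ i, ord i ≤ N → ord (p i) = ord i + 1
  ord_q : ∀ i, ord i ≤ N → ord (q i) = ord i + 1
  ord_l : ∀ i, ∀ e ∈ l i, ord e.1 + ord e.2.1 + ord e.2.2 = ord i
  contU : ∀ i, Continuous (Function.uncurry (U i))
  contV : ∀ i, Continuous (Function.uncurry (V i))
  contF : ∀ i, Continuous (Function.uncurry (F i))
  contG : ∀ i, Continuous (Function.uncurry (G i))
  -- The equation is differentiated on the open set `t > 1`, so it is only asked for there, up to
  -- the top order.
  dirac_U : ∀ i y z, y + 2 < z →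
    HasDerivAt (fun z => U i y z) ((Complex.I * V i y z + F i y z) / 2) z
  dirac_V : ∀ i y z, y + 2 < z →
    HasDerivAt (fun y => V i y z) (-(Complex.I * U i y z + G i y z) / 2) y
  deriv_U : ∀ i, ord i ≤ N → ∀ y z, HasDerivAt (fun y => U i y z) (-(U (p i) y z - U (q i) y z) / 2) y
  deriv_V : ∀ i, ord i ≤ N → ∀ y z, HasDerivAt (fun y => V i y z) (-(V (p i) y z - V (q i) y z) / 2) y
  deriv_V_out : ∀ i, ord i ≤ N → ∀ y z,
    HasDerivAt (fun z => V i y z) ((V (p i) y z + V (q i) y z) / 2) z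
  data_U : ∀ i, ord i ≤ N → ∀ z, HasDerivAt (fun z => U i (z - 2) z) (U (q i) (z - 2) z) z
  data_V : ∀ i, ord i ≤ N → ∀ z, HasDerivAt (fun z => V i (z - 2) z) (V (q i) (z - 2) z) z
  norm_F : ∀ i y z, ‖F i y z‖ ≤
    ((l i).map fun e => ‖V e.1 y z‖ * ‖V e.2.1 y z‖ * ‖U e.2.2 y z‖).sum
  norm_G : ∀ i y z, ‖G i y z‖ ≤
    ((l i).map fun e => ‖U e.1 y z‖ * ‖U e.2.1 y z‖ * ‖V e.2.2 y z‖).sum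
  -- Order `j + 1` is allowed with weight `j`, because a Klein-Gordon energy contains one further
  -- derivative.
  data_le : ∀ i j, j ≤ N → ord i ≤ j + 1 → ∀ X, 1 ≤ X →
    ∫ z in (1 : ℝ)..X, (‖U i (z - 2) z‖ ^ 2 + ‖V i (z - 2) z‖ ^ 2) * nullWeight N j (z - 2) z ≤ δ

namespace NullSystem

variable {ι : Type*} {N : ℕ} {ord : ι → ℕ} {p q : ι → ι} {l : ι → List (ι × ι × ι)} {δ : ℝ}
  {U V F G : ι → ℝ → ℝ → ℂ}

lemma inExt_data {z : ℝ} (hz : 1 ≤ z) : InExt (z - 2) z :=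
  ⟨hz, by nlinarith [sq_nonneg (z - 1)], le_rfl⟩

lemma continuous_normSq_mul {f : ℝ → ℝ → ℂ} {w : ℝ → ℝ → ℝ} (hf : Continuous (Function.uncurry f))
    (hw : Continuous (Function.uncurry w)) :
    Continuous (Function.uncurry fun y z => ‖f y z‖ ^ 2 * w y z) :=
  (hf.norm.pow 2).mul hw

/-- The divergence theorem for `|U|² w` and `|V|² w`. The mass terms cancel because multiplication
by `i` is skew for the real inner product. The derivative of `w` in `y` appears on the left as a
gain, that in `z` on the right as a loss. -/
lemma energy_le (S : NullSystem N ord p q l δ U V F G) {T y₀ z₀ : ℝ} (hT : 1 ≤ T) (hy : -1 ≤ y₀)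
    (hz : y₀ + 2 ≤ z₀) (i : ι) (j : ℕ) (hj : j ≤ N) (hi : ord i ≤ j + 1) :
    (∫ y in y₀..(z₀ - 2), ‖U i y (rayExitOut T z₀ y)‖ ^ 2 * nullWeight N j y (rayExitOut T z₀ y)) +
      (∫ z in (y₀ + 2)..z₀, ‖V i (rayExitIn T y₀ z) z‖ ^ 2 * nullWeight N j (rayExitIn T y₀ z) z) +
      j * regionInt T y₀ z₀ (fun y z => ‖V i y z‖ ^ 2 * nullWeight (N - 1) (j - 1) y z) ≤
    δ + (N - j : ℕ) * regionInt T y₀ z₀ (fun y z => ‖U i y z‖ ^ 2 * nullWeight (N - 1) j y z) +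
      regionInt T y₀ z₀ (fun y z => (‖U i y z‖ * ‖F i y z‖ + ‖V i y z‖ * ‖G i y z‖) *
        nullWeight N j y z) := by
  have cU := S.contU i
  have cV := S.contV i
  have cF := S.contF i
  have cG := S.contG i
  have cw := continuous_nullWeight N j
  have cI : ∀ {f g : ℝ → ℝ → ℂ}, Continuous (Function.uncurry f) → Continuous (Function.uncurry g) →
      Continuous (Function.uncurry fun y z => inner ℝ (f y z) (g y z)) :=
    fun hf hg => hf.inner hg
  have cIV : Continuous (Function.uncurry fun y z => Complex.I * V i y z) := continuous_const.mul cV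
  have cIU : Continuous (Function.uncurry fun y z => Complex.I * U i y z) := continuous_const.mul cU
  set a : ℝ → ℝ → ℝ := fun y z => inner ℝ (U i y z) (Complex.I * V i y z) * nullWeight N j y z with ha
  set b : ℝ → ℝ → ℝ := fun y z => inner ℝ (U i y z) (F i y z) * nullWeight N j y z with hb
  set c : ℝ → ℝ → ℝ := fun y z => inner ℝ (V i y z) (G i y z) * nullWeight N j y z with hc
  set f1 : ℝ → ℝ → ℝ := fun y z => ‖U i y z‖ ^ 2 * nullWeight (N - 1) j y z with hf1
  set g1 : ℝ → ℝ → ℝ := fun y z => ‖V i y z‖ ^ 2 * nullWeight (N - 1) (j - 1) y z with hg1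
  have ca : Continuous (Function.uncurry a) := (cI cU cIV).mul cw
  have cb : Continuous (Function.uncurry b) := (cI cU cF).mul cw
  have cc : Continuous (Function.uncurry c) := (cI cV cG).mul cw
  have cf1 : Continuous (Function.uncurry f1) := continuous_normSq_mul cU (continuous_nullWeight _ _)
  have cg1 : Continuous (Function.uncurry g1) := continuous_normSq_mul cV (continuous_nullWeight _ _)
  have hcancel : ∀ y z, inner ℝ (V i y z) (Complex.I * U i y z) =
      -inner ℝ (U i y z) (Complex.I * V i y z) := by
    intro y z
    simp only [Complex.inner, Complex.mul_re, Complex.conj_re, Complex.conj_im, Complex.I_re,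
      Complex.I_im, Complex.mul_im]
    ring
  have key := flux_identity hT hy hz
    (f := fun y z => ‖U i y z‖ ^ 2 * nullWeight N j y z)
    (g := fun y z => ‖V i y z‖ ^ 2 * nullWeight N j y z)
    (fz := fun y z => a y z + b y z + (N - j : ℕ) * f1 y z)
    (gy := fun y z => a y z - c y z + j * g1 y z)
    (continuous_normSq_mul cU cw) (continuous_normSq_mul cV cw)
    ((ca.add cb).add (continuous_const.mul cf1)) ((ca.sub cc).add (continuous_const.mul cg1))
    (fun y z hyz => by
      refine (((S.dirac_U i y z hyz).norm_sq).mul (hasDerivAt_nullWeight_right N j y z)).congr_deriv ?_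
      simp only [ha, hb, hf1]
      rw [show (Complex.I * V i y z + F i y z) / 2 =
        ((1 / 2 : ℝ) : ℂ) * (Complex.I * V i y z + F i y z) by push_cast; ring,
        ← Complex.real_smul, inner_smul_right, inner_add_right]
      ring)
    (fun y z hyz => by
      refine (((S.dirac_V i y z hyz).norm_sq).mul (hasDerivAt_nullWeight_left N j hj y z)).congr_deriv ?_
      simp only [ha, hc, hg1]
      rw [show -(Complex.I * U i y z + G i y z) / 2 =
        ((-1 / 2 : ℝ) : ℂ) * (Complex.I * U i y z + G i y z) by push_cast; ring,
        ← Complex.real_smul, inner_smul_right, inner_add_right, hcancel]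
      ring)
  have e1 : (regionInt T y₀ z₀ fun y z => a y z + b y z + (N - j : ℕ) * f1 y z -
      (a y z - c y z + j * g1 y z)) = (regionInt T y₀ z₀ fun y z => b y z + c y z) +
      (N - j : ℕ) * regionInt T y₀ z₀ f1 + (-j) * regionInt T y₀ z₀ g1 := by
    have cbc : Continuous (Function.uncurry fun y z => b y z + c y z) := cb.add cc
    have cf2 : Continuous (Function.uncurry fun y z => ((N - j : ℕ) : ℝ) * f1 y z) :=
      continuous_const.mul cf1
    have cg2 : Continuous (Function.uncurry fun y z => (-j : ℝ) * g1 y z) := continuous_const.mul cg1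
    have cs : Continuous (Function.uncurry fun y z => b y z + c y z + (N - j : ℕ) * f1 y z) :=
      cbc.add cf2
    rw [← regionInt_const_mul, ← regionInt_const_mul, ← regionInt_add cbc cf2, ← regionInt_add cs cg2]
    congr 1; ext y z; ring
  have e2 : (regionInt T y₀ z₀ fun y z => b y z + c y z) ≤
      regionInt T y₀ z₀ (fun y z => (‖U i y z‖ * ‖F i y z‖ + ‖V i y z‖ * ‖G i y z‖) *
        nullWeight N j y z) := by
    refine regionInt_mono hT hy hz (cb.add cc)
      ((((cU.norm.mul cF.norm).add (cV.norm.mul cG.norm))).mul cw) fun y z h1 _ h2 h3 => ?_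
    have hext := inExt_of_rayExitIn_le (by linarith) h2.le h3.le
    simp only [hb, hc, ← add_mul]
    exact mul_le_mul_of_nonneg_right (add_le_add (real_inner_le_norm _ _) (real_inner_le_norm _ _))
      (hext.nullWeight_nonneg N j)
  have cd : ∀ {f : ℝ → ℝ → ℝ}, Continuous (Function.uncurry f) → Continuous fun z => f (z - 2) z :=
    fun hf => hf.comp ((continuous_id.sub continuous_const).prodMk continuous_id)
  have e3 : (∫ y in y₀..(z₀ - 2), ‖U i y (y + 2)‖ ^ 2 * nullWeight N j y (y + 2)) +
      (∫ z in (y₀ + 2)..z₀, ‖V i (z - 2) z‖ ^ 2 * nullWeight N j (z - 2) z) ≤ δ := by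
    have : ∫ y in y₀..(z₀ - 2), ‖U i y (y + 2)‖ ^ 2 * nullWeight N j y (y + 2) =
        ∫ z in (y₀ + 2)..z₀, ‖U i (z - 2) z‖ ^ 2 * nullWeight N j (z - 2) z := by
      have h := intervalIntegral.integral_comp_add_right
        (fun z => ‖U i (z - 2) z‖ ^ 2 * nullWeight N j (z - 2) z) 2 (a := y₀) (b := z₀ - 2)
      simpa only [add_sub_cancel_right, sub_add_cancel] using h
    rw [this, ← intervalIntegral.integral_add
      ((cd (continuous_normSq_mul cU cw)).intervalIntegrable _ _)
      ((cd (continuous_normSq_mul cV cw)).intervalIntegrable _ _)]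
    refine le_trans ?_ (S.data_le i j hj hi z₀ (by linarith))
    simp only [← add_mul]
    have ccd : Continuous fun z => (‖U i (z - 2) z‖ ^ 2 + ‖V i (z - 2) z‖ ^ 2) *
        nullWeight N j (z - 2) z := cd (f := fun y z => (‖U i y z‖ ^ 2 + ‖V i y z‖ ^ 2) * nullWeight N j y z)
        (((cU.norm.pow 2).add (cV.norm.pow 2)).mul cw)
    refine intervalIntegral.integral_mono_interval (by linarith) hz le_rfl ?_
      (ccd.intervalIntegrable _ _)
    filter_upwards [ae_restrict_mem measurableSet_Ioc] with z hz'
    exact mul_nonneg (by positivity) ((inExt_data hz'.1.le).nullWeight_nonneg N j)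
  linarith [key, e1, e2, e3]

end NullSystem
end Thirring
end

/-! ### Sobolev bounds along rays and along the initial line. -/

noncomputable section
namespace Thirring
open MeasureTheory Set

/-- One-sided weighted bound along an interval, for a nondecreasing weight. -/
lemma weighted_sq_le_add_integral {a b : ℝ} (hab : a ≤ b) {f f' : ℝ → ℂ} {w w' : ℝ → ℝ}
    (hf : ∀ x, HasDerivAt f (f' x) x) (hw : ∀ x, HasDerivAt w (w' x) x) (cf' : Continuous f')
    (cw' : Continuous w') (h0 : ∀ x ∈ Icc a b, 0 ≤ w x) (h1 : ∀ x ∈ Icc a b, 0 ≤ w' x) :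
    ‖f a‖ ^ 2 * w a ≤ ‖f b‖ ^ 2 * w b + ∫ x in a..b, 2 * ‖f x‖ * ‖f' x‖ * w x := by
  have cf : Continuous f := continuous_iff_continuousAt.2 fun x => (hf x).continuousAt
  have cw : Continuous w := continuous_iff_continuousAt.2 fun x => (hw x).continuousAt
  have hd : ∀ x, HasDerivAt (fun x => ‖f x‖ ^ 2 * w x)
      (2 * inner ℝ (f x) (f' x) * w x + ‖f x‖ ^ 2 * w' x) x := fun x => ((hf x).norm_sq).mul (hw x)
  have cd : Continuous fun x => 2 * inner ℝ (f x) (f' x) * w x + ‖f x‖ ^ 2 * w' x := by fun_prop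
  have hint := intervalIntegral.integral_eq_sub_of_hasDerivAt (a := a) (b := b) (fun x _ => hd x)
    (cd.intervalIntegrable _ _)
  have hle : ∫ x in a..b, -(2 * ‖f x‖ * ‖f' x‖ * w x) ≤
      ∫ x in a..b, (2 * inner ℝ (f x) (f' x) * w x + ‖f x‖ ^ 2 * w' x) := by
    refine intervalIntegral.integral_mono_on hab ?_ (cd.intervalIntegrable _ _) fun x hx => ?_
    · apply Continuous.intervalIntegrable; fun_prop
    · have h2 := neg_le_of_abs_le (abs_real_inner_le_norm (f x) (f' x))
      have h3 := mul_le_mul_of_nonneg_right h2 (h0 x hx)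
      have h4 := mul_nonneg (sq_nonneg ‖f x‖) (h1 x hx)
      nlinarith
  rw [intervalIntegral.integral_neg] at hle
  linarith

lemma nullWeight_mono_left {N j : ℕ} {y z : ℝ} (h : InExt y z) :
    nullWeight (N - 1) j y z ≤ nullWeight N j y z := by
  unfold nullWeight
  exact mul_le_mul_of_nonneg_right (pow_le_pow_right₀ h.one_le (by omega)) (pow_nonneg h.nonneg _)

namespace NullSystem

variable {ι : Type*} {N : ℕ} {ord : ι → ℕ} {p q : ι → ι} {l : ι → List (ι × ι × ι)} {δ : ℝ}
  {U V F G : ι → ℝ → ℝ → ℂ}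

/-- A function bounded in weighted `L²` together with its derivative is bounded. -/
lemma weighted_sq_le_of_integral_le {f g : ℝ → ℂ} {w w' : ℝ → ℝ} {δ : ℝ}
    (cg : Continuous g) (cw' : Continuous w')
    (hd : ∀ z, HasDerivAt f (g z) z) (hw : ∀ z, HasDerivAt w (w' z) z)
    (w0 : ∀ z, 1 ≤ z → 0 ≤ w z) (w1 : ∀ z, 1 ≤ z → 0 ≤ w' z)
    (hf2 : ∀ X, 1 ≤ X → ∫ z in (1 : ℝ)..X, ‖f z‖ ^ 2 * w z ≤ δ)
    (hg2 : ∀ X, 1 ≤ X → ∫ z in (1 : ℝ)..X, ‖g z‖ ^ 2 * w z ≤ δ)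
    {z : ℝ} (hz : 1 ≤ z) : ‖f z‖ ^ 2 * w z ≤ 3 * δ := by
  have cf : Continuous f := continuous_iff_continuousAt.2 fun x => (hd x).continuousAt
  have cw : Continuous w := continuous_iff_continuousAt.2 fun x => (hw x).continuousAt
  have sub : ∀ (k : ℝ → ℝ), Continuous k → (∀ x, 0 ≤ k x) → ∀ a b, 1 ≤ a → a ≤ b →
      ∫ x in a..b, k x * w x ≤ ∫ x in (1 : ℝ)..b, k x * w x := by
    intro k ck k0 a b ha hab
    refine intervalIntegral.integral_mono_interval ha hab le_rfl ?_ ((ck.mul cw).intervalIntegrable _ _)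
    filter_upwards [ae_restrict_mem measurableSet_Ioc] with x hx
    exact mul_nonneg (k0 x) (w0 x hx.1.le)
  -- The value at `z` is compared with the values on `[z, z + 1]` and averaged: the average
  -- contributes `δ` and the oscillation `D ≤ 2δ`, whence `3δ`.
  set D := ∫ x in z..(z + 1), (‖f x‖ ^ 2 + ‖g x‖ ^ 2) * w x with hD
  have hsplit : D = (∫ x in z..(z + 1), ‖f x‖ ^ 2 * w x) + ∫ x in z..(z + 1), ‖g x‖ ^ 2 * w x := by
    rw [hD, ← intervalIntegral.integral_add]
    · simp only [add_mul]
    · apply Continuous.intervalIntegrable; fun_prop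
    · apply Continuous.intervalIntegrable; fun_prop
  have b1 := (sub _ (cf.norm.pow 2) (fun x => sq_nonneg _) z (z + 1) hz (by linarith)).trans
    (hf2 (z + 1) (by linarith))
  have b2 := (sub _ (cg.norm.pow 2) (fun x => sq_nonneg _) z (z + 1) hz (by linarith)).trans
    (hg2 (z + 1) (by linarith))
  simp only [Pi.pow_apply] at b1 b2
  have key : ∀ x ∈ Icc z (z + 1), ‖f z‖ ^ 2 * w z ≤ ‖f x‖ ^ 2 * w x + D := by
    intro x hx
    refine (weighted_sq_le_add_integral hx.1 hd hw cg cw' (fun x' hx' => w0 x' (hz.trans hx'.1))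
      (fun x' hx' => w1 x' (hz.trans hx'.1))).trans ?_
    gcongr
    refine (intervalIntegral.integral_mono_on hx.1 ?_ ?_ fun x' hx' => ?_).trans
      (intervalIntegral.integral_mono_interval le_rfl hx.1 hx.2 ?_ ?_)
    · apply Continuous.intervalIntegrable; fun_prop
    · apply Continuous.intervalIntegrable; fun_prop
    · refine mul_le_mul_of_nonneg_right ?_ (w0 x' (hz.trans hx'.1))
      nlinarith [sq_nonneg (‖f x'‖ - ‖g x'‖)]
    · filter_upwards [ae_restrict_mem measurableSet_Ioc] with x' hx'
      exact mul_nonneg (by positivity) (w0 x' (hz.trans hx'.1.le))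
    · apply Continuous.intervalIntegrable; fun_prop
  have hint := intervalIntegral.integral_mono_on (a := z) (b := z + 1) (by linarith)
    (μ := volume) (continuous_const.intervalIntegrable _ _)
    (Continuous.intervalIntegrable (by fun_prop) _ _) key
  rw [intervalIntegral.integral_const, intervalIntegral.integral_add
    (Continuous.intervalIntegrable (by fun_prop) _ _) (continuous_const.intervalIntegrable _ _),
    intervalIntegral.integral_const] at hint
  simp only [add_sub_cancel_left, one_smul] at hint
  linarith

lemma hasDerivAt_nullWeight_data (N m : ℕ) (z : ℝ) : HasDerivAt (fun z => nullWeight N m (z - 2) z)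
    ((N - m : ℕ) * z ^ (N - m - 1) * (1 + (z - 2)) ^ m +
      z ^ (N - m) * (m * (1 + (z - 2)) ^ (m - 1))) z := by
  have h2 : HasDerivAt (fun z : ℝ => (1 + (z - 2)) ^ m) (m * (1 + (z - 2)) ^ (m - 1) * 1) z :=
    (((hasDerivAt_id z).sub_const 2).const_add 1).pow m
  exact ((hasDerivAt_pow (N - m) z).mul h2).congr_deriv (by ring)

lemma data_sup_aux {δ : ℝ} {N m : ℕ} {f g : ℝ → ℝ → ℂ} (cg : Continuous (Function.uncurry g))
    (hd : ∀ z, HasDerivAt (fun z => f (z - 2) z) (g (z - 2) z) z)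
    (hf2 : ∀ X, 1 ≤ X → ∫ z in (1 : ℝ)..X, ‖f (z - 2) z‖ ^ 2 * nullWeight N m (z - 2) z ≤ δ)
    (hg2 : ∀ X, 1 ≤ X → ∫ z in (1 : ℝ)..X, ‖g (z - 2) z‖ ^ 2 * nullWeight N m (z - 2) z ≤ δ)
    {z : ℝ} (hz : 1 ≤ z) : ‖f (z - 2) z‖ ^ 2 * nullWeight N m (z - 2) z ≤ 3 * δ := by
  refine weighted_sq_le_of_integral_le
    (cg.comp ((continuous_id.sub continuous_const).prodMk continuous_id)) (by fun_prop) hd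
    (hasDerivAt_nullWeight_data N m) (fun z hz => (inExt_data hz).nullWeight_nonneg _ _)
    (fun z hz => ?_) hf2 hg2 hz
  have h1 : 0 ≤ z := by linarith
  have h2 : 0 ≤ 1 + (z - 2) := by linarith
  positivity

variable (S : NullSystem N ord p q l δ U V F G)
include S

lemma data_le_U {i : ι} {j : ℕ} (hj : j ≤ N) (hi : ord i ≤ j + 1) (X : ℝ) (hX : 1 ≤ X) :
    ∫ z in (1 : ℝ)..X, ‖U i (z - 2) z‖ ^ 2 * nullWeight N j (z - 2) z ≤ δ := by
  have cd : ∀ {f : ℝ → ℝ → ℝ}, Continuous (Function.uncurry f) → Continuous fun z => f (z - 2) z :=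
    fun hf => hf.comp ((continuous_id.sub continuous_const).prodMk continuous_id)
  refine le_trans ?_ (S.data_le i j hj hi X hX)
  have c1 : Continuous (Function.uncurry fun y z => (‖U i y z‖ ^ 2 + ‖V i y z‖ ^ 2) * nullWeight N j y z) :=
    (((S.contU i).norm.pow 2).add ((S.contV i).norm.pow 2)).mul (continuous_nullWeight N j)
  refine intervalIntegral.integral_mono_on hX
    ((cd (continuous_normSq_mul (S.contU i) (continuous_nullWeight N j))).intervalIntegrable _ _)
    ((cd c1).intervalIntegrable _ _) fun z hz => ?_
  exact mul_le_mul_of_nonneg_right (by linarith [sq_nonneg ‖V i (z - 2) z‖])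
    ((inExt_data hz.1).nullWeight_nonneg N j)

lemma data_le_V {i : ι} {j : ℕ} (hj : j ≤ N) (hi : ord i ≤ j + 1) (X : ℝ) (hX : 1 ≤ X) :
    ∫ z in (1 : ℝ)..X, ‖V i (z - 2) z‖ ^ 2 * nullWeight N j (z - 2) z ≤ δ := by
  have cd : ∀ {f : ℝ → ℝ → ℝ}, Continuous (Function.uncurry f) → Continuous fun z => f (z - 2) z :=
    fun hf => hf.comp ((continuous_id.sub continuous_const).prodMk continuous_id)
  refine le_trans ?_ (S.data_le i j hj hi X hX)
  have c1 : Continuous (Function.uncurry fun y z => (‖U i y z‖ ^ 2 + ‖V i y z‖ ^ 2) * nullWeight N j y z) :=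
    (((S.contU i).norm.pow 2).add ((S.contV i).norm.pow 2)).mul (continuous_nullWeight N j)
  refine intervalIntegral.integral_mono_on hX
    ((cd (continuous_normSq_mul (S.contV i) (continuous_nullWeight N j))).intervalIntegrable _ _)
    ((cd c1).intervalIntegrable _ _) fun z hz => ?_
  exact mul_le_mul_of_nonneg_right (by linarith [sq_nonneg ‖U i (z - 2) z‖])
    ((inExt_data hz.1).nullWeight_nonneg N j)

/-- Along the line `t = 1` the derivative is `U (q i)`, of order `ord i + 1`, which is still
admissible for the weight of index `ord i`. -/
lemma data_sup_U {i : ι} (hi : ord i ≤ N) {z : ℝ} (hz : 1 ≤ z) :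
    ‖U i (z - 2) z‖ ^ 2 * nullWeight N (ord i) (z - 2) z ≤ 3 * δ :=
  data_sup_aux (S.contU (q i)) (S.data_U i hi) (S.data_le_U hi (by omega))
    (S.data_le_U hi (by rw [S.ord_q i hi])) hz

lemma data_sup_V {i : ι} (hi : ord i ≤ N) {z : ℝ} (hz : 1 ≤ z) :
    ‖V i (z - 2) z‖ ^ 2 * nullWeight N (ord i) (z - 2) z ≤ 3 * δ :=
  data_sup_aux (S.contV (q i)) (S.data_V i hi) (S.data_le_V hi (by omega))
    (S.data_le_V hi (by rw [S.ord_q i hi])) hz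

omit S

section densities
variable [Fintype ι] (N ord)

/-- The sum of the weighted densities of `U` that flow through the incoming rays. -/
def outDensity (U : ι → ℝ → ℝ → ℂ) (y z : ℝ) : ℝ :=
  ∑ i, ∑ j ∈ (Finset.range (N + 1)).filter (fun j => ord i ≤ j + 1), ‖U i y z‖ ^ 2 * nullWeight N j y z

/-- The sum of the spacetime densities of `V`. -/
def bulkDensity (V : ι → ℝ → ℝ → ℂ) (y z : ℝ) : ℝ :=
  ∑ i, ∑ j ∈ (Finset.range N).filter (fun j => ord i ≤ j + 2), ‖V i y z‖ ^ 2 * nullWeight (N - 1) j y z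

/-- The total of `outDensity` on an incoming ray. -/
def rayEnergy (U : ι → ℝ → ℝ → ℂ) (z : ℝ) : ℝ :=
  ∫ y in (-(max 1 z)⁻¹)..(z - 2), outDensity N ord U y z

/-- The total of `bulkDensity` up to the incoming ray `z₀`. -/
def bulkEnergy (V : ι → ℝ → ℝ → ℂ) (z₀ : ℝ) : ℝ := fullInt z₀ (bulkDensity N ord V)

/-- A majorant for `|V i|²` on the incoming ray `z`. -/
def raySup (p q : ι → ι) (V : ι → ℝ → ℝ → ℂ) (i : ι) (z : ℝ) : ℝ :=
  ‖V i (z - 2) z‖ ^ 2 * nullWeight (N - 1) (ord i - 1) (z - 2) z +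
    ∫ y in (-(max 1 z)⁻¹)..(z - 2),
      ‖V i y z‖ * (‖V (p i) y z‖ + ‖V (q i) y z‖) * nullWeight (N - 1) (ord i - 1) y z

/-- The sum of the majorants `raySup` over the orders at most `N`. -/
def raySupSum (p q : ι → ι) (V : ι → ℝ → ℝ → ℂ) (z : ℝ) : ℝ :=
  ∑ i ∈ Finset.univ.filter (fun i => ord i ≤ N), raySup N ord p q V i z

variable {N ord}

lemma le_outDensity {y z : ℝ} (h : InExt y z) {i : ι} {j : ℕ} (hj : j ≤ N) (hi : ord i ≤ j + 1) :
    ‖U i y z‖ ^ 2 * nullWeight N j y z ≤ outDensity N ord U y z := by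
  unfold outDensity
  have h0 : ∀ i j, 0 ≤ ‖U i y z‖ ^ 2 * nullWeight N j y z :=
    fun i j => mul_nonneg (sq_nonneg _) (h.nullWeight_nonneg _ _)
  refine le_trans ?_ (Finset.single_le_sum (fun i _ => Finset.sum_nonneg fun j _ => h0 i j)
    (Finset.mem_univ i))
  exact Finset.single_le_sum (fun j _ => h0 i j) (Finset.mem_filter.2 ⟨Finset.mem_range.2 (by omega), hi⟩)

lemma le_bulkDensity {y z : ℝ} (h : InExt y z) {i : ι} {j : ℕ} (hj : j < N) (hi : ord i ≤ j + 2) :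
    ‖V i y z‖ ^ 2 * nullWeight (N - 1) j y z ≤ bulkDensity N ord V y z := by
  unfold bulkDensity
  have h0 : ∀ i j, 0 ≤ ‖V i y z‖ ^ 2 * nullWeight (N - 1) j y z :=
    fun i j => mul_nonneg (sq_nonneg _) (h.nullWeight_nonneg _ _)
  refine le_trans ?_ (Finset.single_le_sum (fun i _ => Finset.sum_nonneg fun j _ => h0 i j)
    (Finset.mem_univ i))
  exact Finset.single_le_sum (fun j _ => h0 i j) (Finset.mem_filter.2 ⟨Finset.mem_range.2 hj, hi⟩)

lemma outDensity_nonneg {y z : ℝ} (h : InExt y z) : 0 ≤ outDensity N ord U y z :=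
  Finset.sum_nonneg fun _ _ => Finset.sum_nonneg fun _ _ =>
    mul_nonneg (sq_nonneg _) (h.nullWeight_nonneg _ _)

lemma bulkDensity_nonneg {y z : ℝ} (h : InExt y z) : 0 ≤ bulkDensity N ord V y z :=
  Finset.sum_nonneg fun _ _ => Finset.sum_nonneg fun _ _ =>
    mul_nonneg (sq_nonneg _) (h.nullWeight_nonneg _ _)

include S

lemma continuous_outDensity : Continuous (Function.uncurry (outDensity N ord U)) := by
  unfold outDensity Function.uncurry
  exact continuous_finsetSum _ fun i _ => continuous_finsetSum _ fun j _ =>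
    continuous_normSq_mul (S.contU i) (continuous_nullWeight _ _)

lemma continuous_bulkDensity : Continuous (Function.uncurry (bulkDensity N ord V)) := by
  unfold bulkDensity Function.uncurry
  exact continuous_finsetSum _ fun i _ => continuous_finsetSum _ fun j _ =>
    continuous_normSq_mul (S.contV i) (continuous_nullWeight _ _)

lemma continuous_rayEnergy : Continuous (rayEnergy N ord U) :=
  continuous_full_ray S.continuous_outDensity

lemma continuous_bulkEnergy : Continuous (bulkEnergy N ord V) :=
  intervalIntegral.continuous_primitive
    (fun _ _ => (continuous_full_ray S.continuous_bulkDensity).intervalIntegrable _ _) _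

omit [Fintype ι] in
lemma continuous_raySup_integrand (i : ι) : Continuous (Function.uncurry fun y z =>
    ‖V i y z‖ * (‖V (p i) y z‖ + ‖V (q i) y z‖) * nullWeight (N - 1) (ord i - 1) y z) :=
  ((S.contV i).norm.mul ((S.contV (p i)).norm.add (S.contV (q i)).norm)).mul (continuous_nullWeight _ _)

omit [Fintype ι] in
lemma continuous_raySup (i : ι) : Continuous (raySup N ord p q V i) :=
  ((continuous_normSq_mul (S.contV i) (continuous_nullWeight (N - 1) (ord i - 1))).comp
      ((continuous_id.sub continuous_const).prodMk continuous_id)).add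
    (continuous_full_ray (S.continuous_raySup_integrand i))

lemma continuous_raySupSum : Continuous (raySupSum N ord p q V) :=
  continuous_finsetSum _ fun i _ => S.continuous_raySup i

/-- Integrate `∂_y (|V|² w)` from `y` up to the initial line. The weight is nondecreasing in `y`, so
its derivative has the favourable sign and is dropped. The majorant does not depend on `y`: it
bounds the supremum over the ray. -/
lemma le_raySupSum {y z : ℝ} (h : InExt y z) (hN : 1 ≤ N) {i : ι} (hi : ord i ≤ N) :
    ‖V i y z‖ ^ 2 * nullWeight (N - 1) (ord i - 1) y z ≤ raySupSum N ord p q V z := by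
  have hin : ∀ y' ∈ Icc y (z - 2), InExt y' z := fun y' hy' =>
    inExt_of_neg_inv_le h.one_le (h.neg_inv_le.trans hy'.1) hy'.2
  have nonneg_int : ∀ i, ∀ y', InExt y' z → 0 ≤ ‖V i y' z‖ * (‖V (p i) y' z‖ + ‖V (q i) y' z‖) *
      nullWeight (N - 1) (ord i - 1) y' z := fun i y' h' =>
    mul_nonneg (by positivity) (h'.nullWeight_nonneg _ _)
  have nonneg : ∀ i, 0 ≤ raySup N ord p q V i z := fun i =>
    add_nonneg (mul_nonneg (sq_nonneg _) ((inExt_data h.one_le).nullWeight_nonneg _ _))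
      (intervalIntegral.integral_nonneg (neg_inv_le h.one_le) fun y' hy' =>
        nonneg_int i y' (inExt_of_neg_inv_le h.one_le hy'.1 hy'.2))
  refine le_trans ?_ (Finset.single_le_sum (fun i _ => nonneg i)
    (Finset.mem_filter.2 ⟨Finset.mem_univ i, hi⟩))
  have cV : Continuous fun y => -(V (p i) y z - V (q i) y z) / 2 :=
    (((S.contV (p i)).comp (continuous_id.prodMk continuous_const)).sub
      ((S.contV (q i)).comp (continuous_id.prodMk continuous_const))).neg.div_const 2
  have cint := continuous_slice_left (S.continuous_raySup_integrand i) z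
  refine (weighted_sq_le_add_integral h.le_sub (S.deriv_V i hi · z)
    (hasDerivAt_nullWeight_left (N - 1) (ord i - 1) (by omega) · z) cV
    ((continuous_slice_left (continuous_nullWeight _ _) z).const_mul _)
    (fun y' hy' => (hin y' hy').nullWeight_nonneg _ _)
    (fun y' hy' => mul_nonneg (Nat.cast_nonneg _) ((hin y' hy').nullWeight_nonneg _ _))).trans ?_
  unfold raySup
  gcongr
  refine (intervalIntegral.integral_mono_on h.le_sub (Continuous.intervalIntegrable ?_ _ _)
    (cint.intervalIntegrable _ _) fun y' hy' => ?_).trans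
    (intervalIntegral.integral_mono_interval h.neg_inv_le h.le_sub le_rfl ?_ (cint.intervalIntegrable _ _))
  · have c1 : Continuous fun y => V i y z := (S.contV i).comp (continuous_id.prodMk continuous_const)
    have c2 := continuous_slice_left (continuous_nullWeight (N - 1) (ord i - 1)) z
    fun_prop
  · refine mul_le_mul_of_nonneg_right ?_ ((hin y' hy').nullWeight_nonneg _ _)
    rw [norm_div, norm_neg, RCLike.norm_ofNat, mul_assoc, mul_left_comm]
    refine mul_le_mul_of_nonneg_left ?_ (norm_nonneg _)
    linarith [norm_sub_le (V (p i) y' z) (V (q i) y' z)]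
  · filter_upwards [ae_restrict_mem measurableSet_Ioc] with y' hy'
    exact nonneg_int i y' (inExt_of_neg_inv_le h.one_le hy'.1.le hy'.2)

/-- The supremum of `|V|²` over incoming rays is integrable in `z`. The products `|V_i| |∂V_i|` in
the majorant have orders at most `ord i + 1 ≤ (ord i - 1) + 2`, which is the range covered by
`bulkDensity`. -/
lemma integral_raySupSum_le (hN : 1 ≤ N) {z₀ : ℝ} (hz : 1 ≤ z₀) :
    ∫ z in (1 : ℝ)..z₀, raySupSum N ord p q V z ≤
      Fintype.card ι * (δ + 2 * bulkEnergy N ord V z₀) := by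
  -- The sign of `δ` follows from `data_le` on an empty interval, once there is an index; without
  -- indices both sides vanish.
  have hδ : 0 ≤ δ + 2 * bulkEnergy N ord V z₀ ∨ ∀ i : ι, False := by
    by_cases hι : Nonempty ι
    · left
      obtain ⟨i⟩ := hι
      have h1 := S.data_le i N le_rfl (S.ord_le i) 1 le_rfl
      rw [intervalIntegral.integral_same] at h1
      have h2 : 0 ≤ bulkEnergy N ord V z₀ :=
        intervalIntegral.integral_nonneg hz fun z hz' =>
          intervalIntegral.integral_nonneg (neg_inv_le hz'.1) fun y' hy' =>
            bulkDensity_nonneg (inExt_of_neg_inv_le hz'.1 hy'.1 hy'.2)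
      linarith
    · exact Or.inr fun i => hι ⟨i⟩
  have hi : ∀ i, ord i ≤ N → ∫ z in (1 : ℝ)..z₀, raySup N ord p q V i z ≤
      δ + 2 * bulkEnergy N ord V z₀ := by
    intro i hi
    have cdat : Continuous fun z => ‖V i (z - 2) z‖ ^ 2 * nullWeight (N - 1) (ord i - 1) (z - 2) z :=
      (continuous_normSq_mul (S.contV i) (continuous_nullWeight (N - 1) (ord i - 1))).comp
        ((continuous_id.sub continuous_const).prodMk continuous_id)
    have cdat' : Continuous fun z => ‖V i (z - 2) z‖ ^ 2 * nullWeight N (ord i - 1) (z - 2) z :=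
      (continuous_normSq_mul (S.contV i) (continuous_nullWeight N (ord i - 1))).comp
        ((continuous_id.sub continuous_const).prodMk continuous_id)
    have cint := continuous_full_ray (S.continuous_raySup_integrand i)
    unfold raySup
    rw [intervalIntegral.integral_add (cdat.intervalIntegrable _ _) (cint.intervalIntegrable _ _)]
    refine add_le_add ?_ ?_
    · refine le_trans ?_ (S.data_le_V (i := i) (j := ord i - 1) (by omega) (by omega) z₀ hz)
      refine intervalIntegral.integral_mono_on hz (cdat.intervalIntegrable _ _)
        (cdat'.intervalIntegrable _ _) fun z hz' => ?_
      exact mul_le_mul_of_nonneg_left (nullWeight_mono_left (inExt_data hz'.1)) (sq_nonneg _)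
    · have : 2 * bulkEnergy N ord V z₀ =
          ∫ z in (1 : ℝ)..z₀, ∫ y in (-(max 1 z)⁻¹)..(z - 2), 2 * bulkDensity N ord V y z := by
        simp [bulkEnergy, fullInt, intervalIntegral.integral_const_mul]
      rw [this]
      have cb2 : Continuous (Function.uncurry fun y z => 2 * bulkDensity N ord V y z) :=
        continuous_const.mul S.continuous_bulkDensity
      refine intervalIntegral.integral_mono_on hz (cint.intervalIntegrable _ _)
        ((continuous_full_ray cb2).intervalIntegrable _ _) fun z hz' => ?_
      refine intervalIntegral.integral_mono_on (neg_inv_le hz'.1)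
        ((continuous_slice_left (S.continuous_raySup_integrand i) z).intervalIntegrable _ _)
        ((continuous_slice_left cb2 z).intervalIntegrable _ _) fun y hy => ?_
      have hext := inExt_of_neg_inv_le hz'.1 hy.1 hy.2
      have w0 := hext.nullWeight_nonneg (N - 1) (ord i - 1)
      have b0 := le_bulkDensity (N := N) (ord := ord) (V := V) hext (i := i) (j := ord i - 1) (by omega) (by omega)
      have b1 := le_bulkDensity (N := N) (V := V) (ord := ord) hext (i := p i) (j := ord i - 1) (by omega)
        (by rw [S.ord_p i hi]; omega)
      have b2 := le_bulkDensity (N := N) (V := V) (ord := ord) hext (i := q i) (j := ord i - 1) (by omega)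
        (by rw [S.ord_q i hi]; omega)
      have : ‖V i y z‖ * (‖V (p i) y z‖ + ‖V (q i) y z‖) ≤
          ‖V i y z‖ ^ 2 + ‖V (p i) y z‖ ^ 2 / 2 + ‖V (q i) y z‖ ^ 2 / 2 := by
        nlinarith [sq_nonneg (‖V i y z‖ - ‖V (p i) y z‖), sq_nonneg (‖V i y z‖ - ‖V (q i) y z‖)]
      have := mul_le_mul_of_nonneg_right this w0
      linarith
  unfold raySupSum
  rw [intervalIntegral.integral_finsetSum
    fun i _ => (S.continuous_raySup i).intervalIntegrable _ _]
  refine (Finset.sum_le_card_nsmul _ _ _ fun i hi' => hi i (Finset.mem_filter.1 hi').2).trans ?_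
  rw [nsmul_eq_mul]
  rcases hδ with h | h
  · exact mul_le_mul_of_nonneg_right (Nat.cast_le.2 (Finset.card_le_univ _)) h
  · have : IsEmpty ι := ⟨h⟩
    simp

/-- The same integration along an incoming ray as for `V`. Here the products of `U` with its
derivatives are part of the energy on that single ray, so the bound is pointwise in `z` as well. -/
lemma norm_U_le {y z : ℝ} (h : InExt y z) {i : ι} (hi : ord i ≤ N) :
    ‖U i y z‖ ^ 2 * nullWeight N (ord i) y z ≤ 3 * δ + 2 * rayEnergy N ord U z := by
  have hin : ∀ y' ∈ Icc y (z - 2), InExt y' z := fun y' hy' =>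
    inExt_of_neg_inv_le h.one_le (h.neg_inv_le.trans hy'.1) hy'.2
  have cU : Continuous fun y => -(U (p i) y z - U (q i) y z) / 2 :=
    (((S.contU (p i)).comp (continuous_id.prodMk continuous_const)).sub
      ((S.contU (q i)).comp (continuous_id.prodMk continuous_const))).neg.div_const 2
  have cint : Continuous fun y => 2 * outDensity N ord U y z :=
    (continuous_slice_left S.continuous_outDensity z).const_mul _
  refine (weighted_sq_le_add_integral h.le_sub (S.deriv_U i hi · z)
    (hasDerivAt_nullWeight_left N (ord i) hi · z) cU
    ((continuous_slice_left (continuous_nullWeight _ _) z).const_mul _)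
    (fun y' hy' => (hin y' hy').nullWeight_nonneg _ _)
    (fun y' hy' => mul_nonneg (Nat.cast_nonneg _) ((hin y' hy').nullWeight_nonneg _ _))).trans ?_
  refine add_le_add (S.data_sup_U hi h.one_le) ?_
  unfold rayEnergy
  rw [← intervalIntegral.integral_const_mul]
  refine (intervalIntegral.integral_mono_on h.le_sub (Continuous.intervalIntegrable ?_ _ _)
    (cint.intervalIntegrable _ _) fun y' hy' => ?_).trans
    (intervalIntegral.integral_mono_interval h.neg_inv_le h.le_sub le_rfl ?_ (cint.intervalIntegrable _ _))
  · have c1 : Continuous fun y => U i y z := (S.contU i).comp (continuous_id.prodMk continuous_const)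
    have c2 := continuous_slice_left (continuous_nullWeight N (ord i)) z
    fun_prop
  · have w0 := (hin y' hy').nullWeight_nonneg N (ord i)
    have b0 := le_outDensity (ord := ord) (U := U) (hin y' hy') (i := i) (j := ord i) hi (by omega)
    have b1 := le_outDensity (U := U) (ord := ord) (hin y' hy') (i := p i) (j := ord i) hi
      (by rw [S.ord_p i hi])
    have b2 := le_outDensity (U := U) (ord := ord) (hin y' hy') (i := q i) (j := ord i) hi
      (by rw [S.ord_q i hi])
    rw [norm_div, norm_neg, RCLike.norm_ofNat]
    have h1 : 2 * ‖U i y' z‖ * (‖U (p i) y' z - U (q i) y' z‖ / 2) ≤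
        ‖U i y' z‖ * (‖U (p i) y' z‖ + ‖U (q i) y' z‖) := by
      have := mul_le_mul_of_nonneg_left (norm_sub_le (U (p i) y' z) (U (q i) y' z)) (norm_nonneg (U i y' z))
      linarith
    have : ‖U i y' z‖ * (‖U (p i) y' z‖ + ‖U (q i) y' z‖) ≤
        ‖U i y' z‖ ^ 2 + ‖U (p i) y' z‖ ^ 2 / 2 + ‖U (q i) y' z‖ ^ 2 / 2 := by
      nlinarith [sq_nonneg (‖U i y' z‖ - ‖U (p i) y' z‖), sq_nonneg (‖U i y' z‖ - ‖U (q i) y' z‖)]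
    have := mul_le_mul_of_nonneg_right (h1.trans this) w0
    linarith
  · filter_upwards [ae_restrict_mem measurableSet_Ioc] with y' hy'
    exact mul_nonneg zero_le_two (outDensity_nonneg (inExt_of_neg_inv_le h.one_le hy'.1.le hy'.2))

end densities

end NullSystem
end Thirring
end

/-! ### Weighted estimates of the cubic terms. -/

noncomputable section
namespace Thirring
open MeasureTheory Set

/-- Since `z ≥ 1` and `0 ≤ (1 + y)/z ≤ 1` in the exterior region, this form reduces the comparison
of weights to the comparison of exponents. -/
lemma nullWeight_eq {N j : ℕ} (hj : j ≤ N) {y z : ℝ} (hz : 0 < z) :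
    nullWeight N j y z = z ^ N * ((1 + y) / z) ^ j := by
  unfold nullWeight
  rw [div_pow, ← mul_div_assoc, mul_comm (z ^ N), mul_div_assoc, pow_sub₀ _ hz.ne' hj, div_eq_mul_inv]
  ring

lemma InExt.ratio_nonneg {y z : ℝ} (h : InExt y z) : 0 ≤ (1 + y) / z := div_nonneg h.nonneg h.pos.le

lemma InExt.ratio_le_one {y z : ℝ} (h : InExt y z) : (1 + y) / z ≤ 1 := by
  rw [div_le_one h.pos]; linarith [h.le_sub]

/-- The product of the four bounds dominates the square of the left side, and `(E R)(D B) ≤ (E R + D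
B)²`. This pairing puts the two factors of `U` and the two factors of `V` into one energy and one
supremum each. -/
lemma weighted_four {s r : ℝ} (hs : 1 ≤ s) (hr0 : 0 ≤ r) (hr1 : r ≤ 1) {N j a b c : ℕ}
    (habc : a + b + c ≤ j) {x₁ x₂ x₃ x₄ E R B D : ℝ}
    (h₁ : x₁ ^ 2 * (s ^ N * r ^ j) ≤ E) (h₂ : x₂ ^ 2 * (s ^ (N - 1) * r ^ a) ≤ R)
    (h₃ : x₃ ^ 2 * (s ^ (N - 1) * r ^ b) ≤ B) (h₄ : x₄ ^ 2 * (s ^ N * r ^ c) ≤ D) :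
    s ^ N * r ^ j * (x₁ * (x₂ * x₃ * x₄)) ≤ E * R + D * B := by
  have s0 : 0 ≤ s := by linarith
  have q₁ : 0 ≤ x₁ ^ 2 * (s ^ N * r ^ j) := by positivity
  have q₂ : 0 ≤ x₂ ^ 2 * (s ^ (N - 1) * r ^ a) := by positivity
  have q₃ : 0 ≤ x₃ ^ 2 * (s ^ (N - 1) * r ^ b) := by positivity
  have q₄ : 0 ≤ x₄ ^ 2 * (s ^ N * r ^ c) := by positivity
  have hE := q₁.trans h₁
  have hR := q₂.trans h₂
  have hB := q₃.trans h₃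
  have hD := q₄.trans h₄
  have hprod : (x₁ ^ 2 * (s ^ N * r ^ j)) * (x₂ ^ 2 * (s ^ (N - 1) * r ^ a)) *
      ((x₃ ^ 2 * (s ^ (N - 1) * r ^ b)) * (x₄ ^ 2 * (s ^ N * r ^ c))) ≤ E * R * (B * D) :=
    mul_le_mul (mul_le_mul h₁ h₂ q₂ hE) (mul_le_mul h₃ h₄ q₄ hB) (mul_nonneg q₃ q₄) (mul_nonneg hE hR)
  have hsq : (s ^ N * r ^ j * (x₁ * (x₂ * x₃ * x₄))) ^ 2 ≤
      (x₁ ^ 2 * (s ^ N * r ^ j)) * (x₂ ^ 2 * (s ^ (N - 1) * r ^ a)) *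
      ((x₃ ^ 2 * (s ^ (N - 1) * r ^ b)) * (x₄ ^ 2 * (s ^ N * r ^ c))) := by
    have e1 : (s ^ N * r ^ j * (x₁ * (x₂ * x₃ * x₄))) ^ 2 =
        (s ^ (N + N) * r ^ (j + j)) * (x₁ * (x₂ * x₃ * x₄)) ^ 2 := by ring
    have e2 : (x₁ ^ 2 * (s ^ N * r ^ j)) * (x₂ ^ 2 * (s ^ (N - 1) * r ^ a)) *
      ((x₃ ^ 2 * (s ^ (N - 1) * r ^ b)) * (x₄ ^ 2 * (s ^ N * r ^ c))) =
        (s ^ (N + N + (N - 1) + (N - 1)) * r ^ (j + (a + b + c))) * (x₁ * (x₂ * x₃ * x₄)) ^ 2 := by ring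
    rw [e1, e2]
    refine mul_le_mul_of_nonneg_right (mul_le_mul (pow_le_pow_right₀ hs (by omega))
      (pow_le_pow_of_le_one hr0 hr1 (by omega)) (by positivity) (by positivity)) (sq_nonneg _)
  refine abs_le_of_sq_le_sq' (hsq.trans (hprod.trans ?_)) (by positivity) |>.2
  nlinarith [mul_nonneg hE hR, mul_nonneg hB hD, sq_nonneg (E * R - D * B)]

lemma weighted_three {s r : ℝ} (hs : 1 ≤ s) (hr0 : 0 ≤ r) (hr1 : r ≤ 1) {n j n₁ n₂ n₃ a b c : ℕ}
    (hn : n ≤ n₁ + n₂ + n₃) (habc : a + b + c ≤ j) {x₁ x₂ x₃ P Q R : ℝ}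
    (h₁ : x₁ ^ 2 * (s ^ n₁ * r ^ a) ≤ P) (h₂ : x₂ ^ 2 * (s ^ n₂ * r ^ b) ≤ Q)
    (h₃ : x₃ ^ 2 * (s ^ n₃ * r ^ c) ≤ R) :
    s ^ n * r ^ j * (x₁ * x₂ * x₃) ^ 2 ≤ P * Q * R := by
  have s0 : 0 ≤ s := by linarith
  have q₁ : 0 ≤ x₁ ^ 2 * (s ^ n₁ * r ^ a) := by positivity
  have q₂ : 0 ≤ x₂ ^ 2 * (s ^ n₂ * r ^ b) := by positivity
  have q₃ : 0 ≤ x₃ ^ 2 * (s ^ n₃ * r ^ c) := by positivity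
  refine le_trans ?_ (mul_le_mul (mul_le_mul h₁ h₂ q₂ (q₁.trans h₁)) h₃ q₃
    (mul_nonneg (q₁.trans h₁) (q₂.trans h₂)))
  have e2 : x₁ ^ 2 * (s ^ n₁ * r ^ a) * (x₂ ^ 2 * (s ^ n₂ * r ^ b)) * (x₃ ^ 2 * (s ^ n₃ * r ^ c)) =
      (s ^ (n₁ + n₂ + n₃) * r ^ (a + b + c)) * (x₁ * x₂ * x₃) ^ 2 := by ring
  rw [e2]
  exact mul_le_mul_of_nonneg_right (mul_le_mul (pow_le_pow_right₀ hs hn)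
      (pow_le_pow_of_le_one hr0 hr1 habc) (by positivity) (by positivity)) (sq_nonneg _)

lemma list_sum_le_of_forall {α : Type*} (L : List α) (f : α → ℝ) {w Q : ℝ} {K : ℕ} (hK : L.length ≤ K)
    (hQ : 0 ≤ Q) (h : ∀ e ∈ L, w * f e ≤ Q) : w * (L.map f).sum ≤ K * Q := by
  have : w * (L.map f).sum ≤ L.length * Q := by
    clear hK
    induction L with
    | nil => simp
    | cons a L ih =>
      simp only [List.map_cons, List.sum_cons, List.length_cons, Nat.cast_add, Nat.cast_one]
      have h1 := h a (by simp)
      have h2 := ih fun e he => h e (by simp [he])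
      linarith
  exact this.trans (mul_le_mul_of_nonneg_right (Nat.cast_le.2 hK) hQ)

lemma list_sum_sq_le_of_forall {α : Type*} (L : List α) (f : α → ℝ) {w Q : ℝ} {K : ℕ}
    (hK : L.length ≤ K) (hw : 0 ≤ w) (hQ : 0 ≤ Q) (hf : ∀ e, 0 ≤ f e) (h : ∀ e ∈ L, w * f e ^ 2 ≤ Q) :
    w * (L.map f).sum ^ 2 ≤ K ^ 2 * Q := by
  have h1 : ∀ e ∈ L, √w * f e ≤ √Q := fun e he => by
    apply Real.le_sqrt_of_sq_le
    rw [mul_pow, Real.sq_sqrt hw]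
    exact h e he
  have h2 := list_sum_le_of_forall L f hK (Real.sqrt_nonneg Q) h1
  have h3 : 0 ≤ (L.map f).sum := List.sum_nonneg fun x hx => by
    obtain ⟨e, _, rfl⟩ := List.mem_map.1 hx
    exact hf e
  have h4 := pow_le_pow_left₀ (by positivity) h2 2
  rwa [mul_pow, mul_pow, Real.sq_sqrt hw, Real.sq_sqrt hQ] at h4

namespace NullSystem

variable {ι : Type*} {N : ℕ} {ord : ι → ℕ} {p q : ι → ι} {l : ι → List (ι × ι × ι)} {δ : ℝ}
  {U V F G : ι → ℝ → ℝ → ℂ} [Fintype ι]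

variable (S : NullSystem N ord p q l δ U V F G)
include S

variable (N ord p q V) in
omit S in
lemma raySupSum_nonneg {z : ℝ} (hz : 1 ≤ z) : 0 ≤ raySupSum N ord p q V z := by
  refine Finset.sum_nonneg fun i _ => add_nonneg (mul_nonneg (sq_nonneg _)
    ((inExt_data hz).nullWeight_nonneg _ _)) (intervalIntegral.integral_nonneg (neg_inv_le hz)
      fun y' hy' => mul_nonneg (by positivity) ((inExt_of_neg_inv_le hz hy'.1 hy'.2).nullWeight_nonneg _ _))

/-- Of the two factors `V`, the one of lower order is taken in the supremum over the ray (cost `ord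
- 1` in the exponent) and the other in the spacetime density (cost `ord - 2`). The savings absorb
the excess in `ord i ≤ j + 1`. -/
lemma F_term_le (hN : 1 ≤ N) {y z D : ℝ} (h : InExt y z)
    (hD : ∀ i, ord i ≤ N → ‖U i y z‖ ^ 2 * nullWeight N (ord i) y z ≤ D)
    {i : ι} {j : ℕ} (hj : j ≤ N) (hi : ord i ≤ j + 1) {e : ι × ι × ι} (he : e ∈ l i) :
    nullWeight N j y z * (‖U i y z‖ * (‖V e.1 y z‖ * ‖V e.2.1 y z‖ * ‖U e.2.2 y z‖)) ≤
      outDensity N ord U y z * raySupSum N ord p q V z + D * bulkDensity N ord V y z := by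
  obtain ⟨e₁, e₂, e₃⟩ := e
  have ho := S.ord_l i _ he
  simp only at ho ⊢
  have hz := h.pos
  have hr0 := h.ratio_nonneg
  have hr1 := h.ratio_le_one
  have o1 := S.ord_le i
  have v_ray : ∀ i, ord i ≤ N → ‖V i y z‖ ^ 2 * (z ^ (N - 1) * ((1 + y) / z) ^ (ord i - 1)) ≤
      raySupSum N ord p q V z := fun i hi => by
    rw [← nullWeight_eq (by omega) hz]; exact S.le_raySupSum h hN hi
  have v_bulk : ∀ i, ‖V i y z‖ ^ 2 * (z ^ (N - 1) * ((1 + y) / z) ^ (ord i - 2)) ≤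
      bulkDensity N ord V y z := fun i => by
    have := S.ord_le i
    rw [← nullWeight_eq (by omega) hz]
    exact le_bulkDensity h (by omega) (by omega)
  have u_out := le_outDensity (ord := ord) (U := U) h hj hi
  rw [nullWeight_eq hj hz] at u_out ⊢
  have hD' : ∀ i, ord i ≤ N → ‖U i y z‖ ^ 2 * (z ^ N * ((1 + y) / z) ^ ord i) ≤ D := fun i hi => by
    rw [← nullWeight_eq hi hz]; exact hD i hi
  -- If neither `V` is differentiated, `U e₃` may have the top order `N + 1`, where no pointwise
  -- bound exists. Then both factors `U` go into the ray energy and both factors `V` into the ray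
  -- supremum.
  rcases Nat.eq_zero_or_pos (ord e₁ + ord e₂) with h0 | h0
  · have z1 : ord e₁ = 0 := by omega
    have z2 : ord e₂ = 0 := by omega
    have u3 := le_outDensity (ord := ord) (U := U) (i := e₃) h hj (by omega)
    rw [nullWeight_eq hj hz] at u3
    have a1 := v_ray e₁ (by omega)
    have a2 := v_ray e₂ (by omega)
    rw [z1] at a1
    rw [z2] at a2
    simp only [zero_tsub, pow_zero, mul_one] at a1 a2
    have hs : 1 ≤ z ^ (N - 1) := one_le_pow₀ h.one_le
    have b1 : ‖V e₁ y z‖ ^ 2 ≤ raySupSum N ord p q V z :=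
      (le_mul_of_one_le_right (sq_nonneg _) hs).trans a1
    have b2 : ‖V e₂ y z‖ ^ 2 ≤ raySupSum N ord p q V z :=
      (le_mul_of_one_le_right (sq_nonneg _) hs).trans a2
    have c1 : ‖V e₁ y z‖ * ‖V e₂ y z‖ ≤ raySupSum N ord p q V z := by
      nlinarith [sq_nonneg (‖V e₁ y z‖ - ‖V e₂ y z‖)]
    have w0 : 0 ≤ z ^ N * ((1 + y) / z) ^ j := by positivity
    have c2 : z ^ N * ((1 + y) / z) ^ j * (‖U i y z‖ * ‖U e₃ y z‖) ≤ outDensity N ord U y z := by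
      have : ‖U i y z‖ * ‖U e₃ y z‖ ≤ ‖U i y z‖ ^ 2 / 2 + ‖U e₃ y z‖ ^ 2 / 2 := by
        nlinarith [sq_nonneg (‖U i y z‖ - ‖U e₃ y z‖)]
      have := mul_le_mul_of_nonneg_left this w0
      linarith
    have c3 := mul_le_mul c2 c1 (by positivity) (outDensity_nonneg h)
    have hD0 : 0 ≤ D := by
      refine le_trans ?_ (hD' e₁ (by omega)); positivity
    have := mul_nonneg hD0 (bulkDensity_nonneg (N := N) (ord := ord) (V := V) h)
    calc _ = z ^ N * ((1 + y) / z) ^ j * (‖U i y z‖ * ‖U e₃ y z‖) * (‖V e₁ y z‖ * ‖V e₂ y z‖) := by ring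
      _ ≤ _ := by linarith
  · rcases le_total (ord e₁) (ord e₂) with h12 | h12
    · refine weighted_four h.one_le hr0 hr1 (a := ord e₁ - 1) (b := ord e₂ - 2) (c := ord e₃)
        (by omega) u_out
        (v_ray e₁ (by omega)) (v_bulk e₂) (hD' e₃ (by omega))
    · rw [mul_comm ‖V e₁ y z‖]
      refine weighted_four h.one_le hr0 hr1 (a := ord e₂ - 1) (b := ord e₁ - 2) (c := ord e₃)
        (by omega) u_out
        (v_ray e₂ (by omega)) (v_bulk e₁) (hD' e₃ (by omega))

/-- The exponent `N + 1` is chosen because `N` is the mean of `N + 1` and of the exponent `N - 1`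
available for `|V|²`. Two factors `U` and one factor `V` supply `z^(3N-1)`, which suffices as `N ≥
1`. -/
lemma G_term_le (hN : 1 ≤ N) {y z D : ℝ} (h : InExt y z)
    (hD : ∀ i, ord i ≤ N → ‖U i y z‖ ^ 2 * nullWeight N (ord i) y z ≤ D)
    {i : ι} {j : ℕ} (hi : ord i ≤ j + 1) {e : ι × ι × ι} (he : e ∈ l i) :
    z ^ (N + 1) * ((1 + y) / z) ^ j * (‖U e.1 y z‖ * ‖U e.2.1 y z‖ * ‖V e.2.2 y z‖) ^ 2 ≤
      D ^ 2 * bulkDensity N ord V y z +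
        D * (outDensity N ord U y z * raySupSum N ord p q V z) := by
  obtain ⟨e₁, e₂, e₃⟩ := e
  have ho := S.ord_l i _ he
  simp only at ho ⊢
  have hz := h.pos
  have hr0 := h.ratio_nonneg
  have hr1 := h.ratio_le_one
  have o1 := S.ord_le i
  have v_ray : ∀ i, ord i ≤ N → ‖V i y z‖ ^ 2 * (z ^ (N - 1) * ((1 + y) / z) ^ (ord i - 1)) ≤
      raySupSum N ord p q V z := fun i hi => by
    rw [← nullWeight_eq (by omega) hz]; exact S.le_raySupSum h hN hi
  have v_bulk : ∀ i, ‖V i y z‖ ^ 2 * (z ^ (N - 1) * ((1 + y) / z) ^ (ord i - 2)) ≤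
      bulkDensity N ord V y z := fun i => by
    have := S.ord_le i
    rw [← nullWeight_eq (by omega) hz]
    exact le_bulkDensity h (by omega) (by omega)
  have u_out : ∀ i, ‖U i y z‖ ^ 2 * (z ^ N * ((1 + y) / z) ^ (ord i - 1)) ≤ outDensity N ord U y z :=
    fun i => by
    have := S.ord_le i
    rw [← nullWeight_eq (by omega) hz]
    exact le_outDensity h (by omega) (by omega)
  have hD' : ∀ i, ord i ≤ N → ‖U i y z‖ ^ 2 * (z ^ N * ((1 + y) / z) ^ ord i) ≤ D := fun i hi => by
    rw [← nullWeight_eq hi hz]; exact hD i hi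
  have hB0 := bulkDensity_nonneg (N := N) (ord := ord) (V := V) h
  have hE0 := outDensity_nonneg (N := N) (ord := ord) (U := U) h
  have hR0 := raySupSum_nonneg N ord p q V h.one_le
  have fin : ∀ {i}, ord i ≤ N → 0 ≤ D := fun {i} hi => by
    refine le_trans ?_ (hD' i hi); positivity
  -- If all derivatives may fall on `V e₃`, it goes into the spacetime density and both `U` are
  -- bounded pointwise. Otherwise `V e₃` has order at most `N` and admits the ray supremum, and the
  -- `U` of higher order goes into the ray energy.
  rcases Nat.eq_zero_or_pos (ord e₁ + ord e₂) with h0 | h0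
  · have hD0 := fin (i := e₁) (by omega)
    refine (weighted_three h.one_le hr0 hr1 (n₁ := N) (n₂ := N) (n₃ := N - 1) (by omega) (by omega)
      (hD' e₁ (by omega)) (hD' e₂ (by omega)) (v_bulk e₃)).trans ?_
    have : 0 ≤ D * (outDensity N ord U y z * raySupSum N ord p q V z) := by positivity
    nlinarith
  · rcases le_total (ord e₁) (ord e₂) with h12 | h12
    · have hD0 := fin (i := e₁) (by omega)
      refine (weighted_three h.one_le hr0 hr1 (n₁ := N) (n₂ := N) (n₃ := N - 1) (by omega) (by omega)
        (hD' e₁ (by omega)) (u_out e₂) (v_ray e₃ (by omega))).trans ?_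
      have : 0 ≤ D ^ 2 * bulkDensity N ord V y z := by positivity
      nlinarith
    · have hD0 := fin (i := e₂) (by omega)
      rw [mul_comm ‖U e₁ y z‖]
      refine (weighted_three h.one_le hr0 hr1 (n₁ := N) (n₂ := N) (n₃ := N - 1) (by omega) (by omega)
        (hD' e₂ (by omega)) (u_out e₁) (v_ray e₃ (by omega))).trans ?_
      have : 0 ≤ D ^ 2 * bulkDensity N ord V y z := by positivity
      nlinarith

/-- The density that controls all cubic errors. -/
lemma normSq_G_le (hN : 1 ≤ N) {K : ℕ} (hK : ∀ i, (l i).length ≤ K) {y z A : ℝ} (h : InExt y z)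
    (hA : 0 < A)
    (hD : ∀ i, ord i ≤ N → ‖U i y z‖ ^ 2 * nullWeight N (ord i) y z ≤ 5 * A)
    {i : ι} {j : ℕ} (hi : ord i ≤ j + 1) :
    z ^ (N + 1) * ((1 + y) / z) ^ j * ‖G i y z‖ ^ 2 ≤
      25 * K ^ 2 * A *
        (outDensity N ord U y z * raySupSum N ord p q V z + A * bulkDensity N ord V y z) := by
  have hz := h.pos
  have hr0 := h.ratio_nonneg
  have hB0 := bulkDensity_nonneg (N := N) (ord := ord) (V := V) h
  have hE0 := mul_nonneg (outDensity_nonneg (N := N) (ord := ord) (U := U) h) (raySupSum_nonneg N ord p q V h.one_le)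
  have w0 : 0 ≤ z ^ (N + 1) * ((1 + y) / z) ^ j := by positivity
  have h1 := list_sum_sq_le_of_forall (l i)
    (fun e => ‖U e.1 y z‖ * ‖U e.2.1 y z‖ * ‖V e.2.2 y z‖) (hK i) w0
    (Q := (5 * A) ^ 2 * bulkDensity N ord V y z +
        (5 * A) * (outDensity N ord U y z * raySupSum N ord p q V z)) (by positivity)
    (fun e => by positivity) (fun e he => S.G_term_le hN h hD hi he)
  refine (mul_le_mul_of_nonneg_left (pow_le_pow_left₀ (norm_nonneg _) (S.norm_G i y z) 2) w0).trans
    (h1.trans ?_)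
  have : (5 * A) ^ 2 * bulkDensity N ord V y z +
        (5 * A) * (outDensity N ord U y z * raySupSum N ord p q V z) ≤ 25 * A *
        (outDensity N ord U y z * raySupSum N ord p q V z + A * bulkDensity N ord V y z) := by
    nlinarith [mul_nonneg hA.le hE0]
  calc _ ≤ (K : ℝ) ^ 2 * (25 * A *
        (outDensity N ord U y z * raySupSum N ord p q V z + A * bulkDensity N ord V y z)) :=
      mul_le_mul_of_nonneg_left this (by positivity)
    _ = _ := by ring

/-- The part with `F` is a sum of the terms in `F_term_le`. The part with `G` is split by Young's
inequality into `A |V|² z^(N-1)` and `A⁻¹ |G|² z^(N+1)`; the factor `A` gained in `normSq_G_le` pays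
for `A⁻¹`. -/
lemma source_le (hN : 1 ≤ N) {K : ℕ} (hK : ∀ i, (l i).length ≤ K) {y z A : ℝ} (h : InExt y z)
    (hA : 0 < A)
    (hD : ∀ i, ord i ≤ N → ‖U i y z‖ ^ 2 * nullWeight N (ord i) y z ≤ 5 * A)
    {i : ι} {j : ℕ} (hj : j ≤ N) (hi : ord i ≤ j + 1) :
    (‖U i y z‖ * ‖F i y z‖ + ‖V i y z‖ * ‖G i y z‖) * nullWeight N j y z ≤
      (5 * K + 1 + 25 * K ^ 2) *
        (outDensity N ord U y z * raySupSum N ord p q V z + A * bulkDensity N ord V y z) := by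
  have hz := h.pos
  have hr0 := h.ratio_nonneg
  have hr1 := h.ratio_le_one
  set X := outDensity N ord U y z * raySupSum N ord p q V z + A * bulkDensity N ord V y z with hX
  have hB0 := bulkDensity_nonneg (N := N) (ord := ord) (V := V) h
  have hE0 := mul_nonneg (outDensity_nonneg (N := N) (ord := ord) (U := U) h) (raySupSum_nonneg N ord p q V h.one_le)
  have w0 := h.nullWeight_nonneg N j
  have hU : nullWeight N j y z * (‖U i y z‖ * ‖F i y z‖) ≤ K * (5 * X) := by
    have h1 := list_sum_le_of_forall (l i)
      (fun e => ‖V e.1 y z‖ * ‖V e.2.1 y z‖ * ‖U e.2.2 y z‖) (hK i)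
      (w := nullWeight N j y z * ‖U i y z‖)
      (Q := outDensity N ord U y z * raySupSum N ord p q V z + 5 * A * bulkDensity N ord V y z)
      (by positivity) (fun e he => by
        have := S.F_term_le hN h hD hj hi he
        rwa [← mul_assoc] at this)
    rw [← mul_assoc]
    refine (mul_le_mul_of_nonneg_left (S.norm_F i y z) (mul_nonneg w0 (norm_nonneg _))).trans
      (h1.trans (mul_le_mul_of_nonneg_left ?_ (Nat.cast_nonneg _)))
    nlinarith
  have hV : nullWeight N j y z * (‖V i y z‖ * ‖G i y z‖) ≤ X + 25 * K ^ 2 * X := by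
    have b1 := S.normSq_G_le hN hK h hA hD hi
    -- The spacetime density only contains weights of index below `N`, so `j` is lowered to `j - 1`;
    -- this is harmless as `(1 + y)/z ≤ 1`, and `ord i ≤ j + 1` still fits.
    have b2 : ‖V i y z‖ ^ 2 * (z ^ (N - 1) * ((1 + y) / z) ^ j) ≤ bulkDensity N ord V y z := by
      refine le_trans ?_ (le_bulkDensity (i := i) (j := j - 1) h (by omega) (by omega))
      rw [nullWeight_eq (by omega) hz]
      exact mul_le_mul_of_nonneg_left (mul_le_mul_of_nonneg_left
        (pow_le_pow_of_le_one hr0 hr1 (by omega)) (by positivity)) (sq_nonneg _)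
    rw [nullWeight_eq hj hz]
    set a := ‖V i y z‖ ^ 2 * (z ^ (N - 1) * ((1 + y) / z) ^ j) with ha
    set b := z ^ (N + 1) * ((1 + y) / z) ^ j * ‖G i y z‖ ^ 2 with hb
    have a0 : 0 ≤ a := by positivity
    have b0 : 0 ≤ b := by positivity
    have hsq : (z ^ N * ((1 + y) / z) ^ j * (‖V i y z‖ * ‖G i y z‖)) ^ 2 = (A * a) * (A⁻¹ * b) := by
      rw [show A * a * (A⁻¹ * b) = (A * A⁻¹) * (a * b) by ring, mul_inv_cancel₀ hA.ne', one_mul, ha, hb]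
      obtain ⟨M, rfl⟩ : ∃ M, N = M + 1 := ⟨N - 1, by omega⟩
      simp only [Nat.add_sub_cancel]
      ring
    have c1 : A * a ≤ X := by nlinarith
    have c2 : A⁻¹ * b ≤ 25 * K ^ 2 * X := by
      rw [inv_mul_le_iff₀ hA]; linarith
    have c3 : 0 ≤ A * a := by positivity
    have c4 : 0 ≤ A⁻¹ * b := by positivity
    have : z ^ N * ((1 + y) / z) ^ j * (‖V i y z‖ * ‖G i y z‖) ≤ A * a + A⁻¹ * b := by
      refine (abs_le_of_sq_le_sq' ?_ (by positivity)).2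
      rw [hsq]; nlinarith
    linarith
  linarith

end NullSystem
end Thirring
end

/-! ### Integrated errors and the downward induction over the weights. -/

noncomputable section
namespace Thirring
open MeasureTheory Set

namespace NullSystem

variable {ι : Type*} {N : ℕ} {ord : ι → ℕ} {p q : ι → ι} {l : ι → List (ι × ι × ι)} {δ : ℝ}
  {U V F G : ι → ℝ → ℝ → ℂ} [Fintype ι]

section
variable (N ord)

/-- The density of the cubic errors. -/
def cubicDensity (p q : ι → ι) (A : ℝ) (U V : ι → ℝ → ℝ → ℂ) (y z : ℝ) : ℝ :=
  outDensity N ord U y z * raySupSum N ord p q V z + A * bulkDensity N ord V y z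

/-- The norms of the solution up to the incoming ray `z₀` are bounded by `A`. -/
structure BoundedBy (δ : ℝ) (U V : ι → ℝ → ℝ → ℂ) (A z₀ : ℝ) : Prop where
  pos : 0 < A
  le_one : A ≤ 1
  data : δ ≤ A
  one_le : 1 ≤ z₀
  ray : ∀ z, 1 ≤ z → z ≤ z₀ → rayEnergy N ord U z ≤ A
  bulk : bulkEnergy N ord V z₀ ≤ A

end

variable (S : NullSystem N ord p q l δ U V F G)
include S

lemma continuous_cubicDensity (A : ℝ) : Continuous (Function.uncurry (cubicDensity N ord p q A U V)) := by
  unfold cubicDensity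
  exact ((S.continuous_outDensity).mul (S.continuous_raySupSum.comp continuous_snd)).add
    (continuous_const.mul S.continuous_bulkDensity)

omit [Fintype ι] in
lemma delta_nonneg (i : ι) : 0 ≤ δ := by
  have h1 := S.data_le i N le_rfl (S.ord_le i) 1 le_rfl
  rwa [intervalIntegral.integral_same] at h1

omit S in
lemma cubicDensity_nonneg {A y z : ℝ} (hA : 0 ≤ A) (h : InExt y z) :
    0 ≤ cubicDensity N ord p q A U V y z :=
  add_nonneg (mul_nonneg (outDensity_nonneg h) (raySupSum_nonneg N ord p q V h.one_le))
    (mul_nonneg hA (bulkDensity_nonneg h))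

/-- The factor is `5 = 3 + 2`: the data contribute `3δ ≤ 3A`, the ray energy `2A`. -/
lemma norm_U_le_of_bounded {A z₀ : ℝ} (B : BoundedBy N ord δ U V A z₀) {y z : ℝ} (h : InExt y z)
    (hz : z ≤ z₀) (i : ι) (hi : ord i ≤ N) : ‖U i y z‖ ^ 2 * nullWeight N (ord i) y z ≤ 5 * A := by
  have := S.norm_U_le h hi
  have := B.ray z h.one_le hz
  have := B.data
  linarith

/-- On each incoming ray `raySupSum` is constant and factors out, leaving the ray energy, which is
at most `A`; the remaining integral in `z` of `raySupSum` is of size `A` by `integral_raySupSum_le`.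
-/
lemma regionInt_cubicDensity_le (hN : 1 ≤ N) {A T y₀ z₀ : ℝ} (B : BoundedBy N ord δ U V A z₀)
    (hT : 1 ≤ T) (hy : -1 ≤ y₀) (hz : y₀ + 2 ≤ z₀) :
    regionInt T y₀ z₀ (cubicDensity N ord p q A U V) ≤ (3 * Fintype.card ι + 1) * A ^ 2 := by
  refine (regionInt_le_fullInt hT hy hz (S.continuous_cubicDensity A)
    fun y z h => cubicDensity_nonneg B.pos.le h).trans ?_
  have e1 : fullInt z₀ (cubicDensity N ord p q A U V) =
      (∫ z in (1 : ℝ)..z₀, raySupSum N ord p q V z * rayEnergy N ord U z) +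
        A * bulkEnergy N ord V z₀ := by
    unfold fullInt bulkEnergy fullInt
    have cr : Continuous fun z => raySupSum N ord p q V z * rayEnergy N ord U z :=
      S.continuous_raySupSum.mul S.continuous_rayEnergy
    rw [← intervalIntegral.integral_const_mul, ← intervalIntegral.integral_add
      (cr.intervalIntegrable _ _)
      (((continuous_full_ray S.continuous_bulkDensity).const_mul A).intervalIntegrable _ _)]
    congr 1; ext z
    unfold cubicDensity rayEnergy
    have co : Continuous fun y => outDensity N ord U y z * raySupSum N ord p q V z :=
      (continuous_slice_left S.continuous_outDensity z).mul continuous_const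
    rw [intervalIntegral.integral_add (co.intervalIntegrable _ _)
      (((continuous_slice_left S.continuous_bulkDensity z).const_mul A).intervalIntegrable _ _),
      intervalIntegral.integral_mul_const, intervalIntegral.integral_const_mul]
    ring
  have e2 : ∫ z in (1 : ℝ)..z₀, raySupSum N ord p q V z * rayEnergy N ord U z ≤
      ∫ z in (1 : ℝ)..z₀, raySupSum N ord p q V z * A := by
    refine intervalIntegral.integral_mono_on B.one_le
      ((S.continuous_raySupSum.mul S.continuous_rayEnergy).intervalIntegrable _ _)
      ((S.continuous_raySupSum.mul continuous_const).intervalIntegrable _ _) fun z hz' => ?_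
    exact mul_le_mul_of_nonneg_left (B.ray z hz'.1 hz'.2) (raySupSum_nonneg N ord p q V hz'.1)
  rw [intervalIntegral.integral_mul_const] at e2
  have e3 := S.integral_raySupSum_le hN B.one_le
  have e4 : (Fintype.card ι : ℝ) * (δ + 2 * bulkEnergy N ord V z₀) ≤ Fintype.card ι * (3 * A) :=
    mul_le_mul_of_nonneg_left (by linarith [B.data, B.bulk]) (Nat.cast_nonneg _)
  have e5 := mul_le_mul_of_nonneg_right (e3.trans e4) B.pos.le
  have e6 := mul_le_mul_of_nonneg_left B.bulk B.pos.le
  rw [e1]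
  nlinarith

omit [Fintype ι] in
-- Both sides come from computing `∂_y V` twice, by the equation and by the chain rule. It is here
-- that the mass is used: `U` itself is a derivative of `V`, up to a cubic term.
lemma I_mul_U_eq {i : ι} (hi : ord i ≤ N) {y z : ℝ} (hyz : y + 2 < z) :
    Complex.I * U i y z = V (p i) y z - V (q i) y z - G i y z := by
  have := (S.dirac_V i y z hyz).unique (S.deriv_V i hi y z)
  have h2 := congrArg (fun x => -2 * x) this
  have h3 : Complex.I * U i y z + G i y z = V (p i) y z - V (q i) y z := by
    calc _ = -2 * (-(Complex.I * U i y z + G i y z) / 2) := by ring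
      _ = -2 * (-(V (p i) y z - V (q i) y z) / 2) := h2
      _ = _ := by ring
  rw [← h3]; ring

omit [Fintype ι] in
lemma normSq_U_le {i : ι} (hi : ord i ≤ N) {y z : ℝ} (hyz : y + 2 < z) :
    ‖U i y z‖ ^ 2 ≤ 3 * (‖V (p i) y z‖ ^ 2 + ‖V (q i) y z‖ ^ 2 + ‖G i y z‖ ^ 2) := by
  have h1 : ‖U i y z‖ ≤ ‖V (p i) y z‖ + ‖V (q i) y z‖ + ‖G i y z‖ := by
    have : ‖U i y z‖ = ‖Complex.I * U i y z‖ := by simp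
    rw [this, S.I_mul_U_eq hi hyz]
    exact (norm_sub_le _ _).trans (add_le_add_left (norm_sub_le _ _) _)
  have h2 := pow_le_pow_left₀ (norm_nonneg _) h1 2
  nlinarith [sq_nonneg (‖V (p i) y z‖ - ‖V (q i) y z‖), sq_nonneg (‖V (p i) y z‖ - ‖G i y z‖),
    sq_nonneg (‖V (q i) y z‖ - ‖G i y z‖)]

omit S in
/-- Constants for the downward induction over the weights. -/
def closingConst (N K n : ℕ) : ℕ → ℝ
  | 0 => 1 + (5 * K + 1 + 25 * K ^ 2) * (3 * n + 1)
  -- The `6 = 2 · 3` comes from the two derivatives of `V` in `normSq_U_le`, the `75 = 3 · 25` from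
  -- its term in `G`, and `N` bounds the factor `N - j` of the error.
  | d + 1 => 1 + (5 * K + 1 + 25 * K ^ 2) * (3 * n + 1) +
      N * (6 * closingConst N K n d + 75 * K ^ 2 * (3 * n + 1))

omit S in
lemma one_le_closingConst (N K n d : ℕ) : 1 ≤ closingConst N K n d := by
  induction d with
  | zero => unfold closingConst; linarith [show (0 : ℝ) ≤ (5 * K + 1 + 25 * K ^ 2) * (3 * n + 1) by positivity]
  | succ d ih =>
    unfold closingConst
    have h1 : (0 : ℝ) ≤ (5 * K + 1 + 25 * K ^ 2) * (3 * n + 1) := by positivity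
    have h2 : (0 : ℝ) ≤ N * (6 * closingConst N K n d + 75 * K ^ 2 * (3 * n + 1)) := by positivity
    linarith

omit S [Fintype ι] in
lemma flux_nonneg {T y₀ z₀ : ℝ} (hT : 1 ≤ T) (hy : -1 ≤ y₀) (hz : y₀ + 2 ≤ z₀) (i : ι) (j : ℕ) :
    0 ≤ (∫ y in y₀..(z₀ - 2), ‖U i y (rayExitOut T z₀ y)‖ ^ 2 * nullWeight N j y (rayExitOut T z₀ y)) ∧
    0 ≤ (∫ z in (y₀ + 2)..z₀, ‖V i (rayExitIn T y₀ z) z‖ ^ 2 * nullWeight N j (rayExitIn T y₀ z) z) ∧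
    0 ≤ regionInt T y₀ z₀ (fun y z => ‖V i y z‖ ^ 2 * nullWeight N j y z) := by
  refine ⟨intervalIntegral.integral_nonneg (by linarith) fun y hy' => ?_,
    intervalIntegral.integral_nonneg hz fun z hz' => ?_,
    intervalIntegral.integral_nonneg hz fun z hz' =>
      intervalIntegral.integral_nonneg (rayExitIn_le hT hy hz'.1) fun y hy' => ?_⟩
  · have h1 := le_rayExitOut hT (show y + 2 ≤ z₀ by linarith [hy'.2])
    have h2 := (le_rayExitOut_iff (T := T) (z₀ := z₀) (y := y) (by linarith [hy'.1])).1 le_rfl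
    refine mul_nonneg (sq_nonneg _) (InExt.nullWeight_nonneg ⟨by linarith [hy'.1], h2.2.1, by linarith⟩ _ _)
  · exact mul_nonneg (sq_nonneg _) ((inExt_of_rayExitIn_le (by linarith [hz'.1]) le_rfl
      (rayExitIn_le hT hy hz'.1)).nullWeight_nonneg _ _)
  · exact mul_nonneg (sq_nonneg _) ((inExt_of_rayExitIn_le (by linarith [hz'.1]) hy'.1
      hy'.2).nullWeight_nonneg _ _)

/-- Induction on `d = N - j`. The error in `|U|²` at level `j` is rewritten through `I_mul_U_eq` as
spacetime integrals of derivatives of `V`, which are on the left side of the estimate at level `j +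
1`. -/
lemma flux_le (hN : 1 ≤ N) {K : ℕ} (hK : ∀ i, (l i).length ≤ K) {A T y₀ z₀ : ℝ}
    (B : BoundedBy N ord δ U V A z₀) (hT : 1 ≤ T) (hy : -1 ≤ y₀) (hz : y₀ + 2 ≤ z₀) :
    ∀ d j, j + d = N → ∀ i, ord i ≤ j + 1 →
    (∫ y in y₀..(z₀ - 2), ‖U i y (rayExitOut T z₀ y)‖ ^ 2 * nullWeight N j y (rayExitOut T z₀ y)) +
      (∫ z in (y₀ + 2)..z₀, ‖V i (rayExitIn T y₀ z) z‖ ^ 2 * nullWeight N j (rayExitIn T y₀ z) z) +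
      j * regionInt T y₀ z₀ (fun y z => ‖V i y z‖ ^ 2 * nullWeight (N - 1) (j - 1) y z) ≤
    closingConst N K (Fintype.card ι) d * (δ + A ^ 2) := by
  have hA2 := sq_nonneg A
  set X := cubicDensity N ord p q A U V with hX
  have cX := S.continuous_cubicDensity A
  have hXint := S.regionInt_cubicDensity_le hN B hT hy hz
  have hsrc : ∀ i j, j ≤ N → ord i ≤ j + 1 →
      regionInt T y₀ z₀ (fun y z => (‖U i y z‖ * ‖F i y z‖ + ‖V i y z‖ * ‖G i y z‖) *
        nullWeight N j y z) ≤
      (5 * K + 1 + 25 * K ^ 2) * (3 * Fintype.card ι + 1) * A ^ 2 := by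
    intro i j hj hi
    have c1 : Continuous (Function.uncurry fun y z =>
        (‖U i y z‖ * ‖F i y z‖ + ‖V i y z‖ * ‖G i y z‖) * nullWeight N j y z) :=
      (((S.contU i).norm.mul (S.contF i).norm).add ((S.contV i).norm.mul (S.contG i).norm)).mul
        (continuous_nullWeight _ _)
    have c2 : Continuous (Function.uncurry fun y z => (5 * K + 1 + 25 * (K : ℝ) ^ 2) * X y z) :=
      continuous_const.mul cX
    refine (regionInt_mono hT hy hz c1 c2 fun y z h1 h2 h3 h4 => ?_).trans ?_
    · have h := inExt_of_rayExitIn_le (by linarith) h3.le h4.le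
      exact S.source_le hN hK h B.pos (S.norm_U_le_of_bounded B h h2) hj hi
    · rw [regionInt_const_mul, mul_assoc]
      exact mul_le_mul_of_nonneg_left hXint (by positivity)
  intro d
  induction d with
  | zero =>
    intro j hj i hi
    refine (S.energy_le hT hy hz i j (by omega) hi).trans ?_
    have h1 := hsrc i j (by omega) hi
    have hδ := S.delta_nonneg i
    -- At `j = N` the weight is independent of `z`, so the error in `|U|²` is absent.
    rw [show N - j = 0 by omega]
    unfold closingConst
    have : (0 : ℝ) ≤ (5 * K + 1 + 25 * K ^ 2) * (3 * Fintype.card ι + 1) * δ := by positivity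
    push_cast
    linarith
  | succ d ih =>
    intro j hj i hi
    refine (S.energy_le hT hy hz i j (by omega) hi).trans ?_
    have h1 := hsrc i j (by omega) hi
    have hδ := S.delta_nonneg i
    have hiN : ord i ≤ N := by omega
    -- Level `j + 1` controls orders up to `j + 2` with the weight of index `j`; its factor `j + 1`
    -- is at least one.
    have hb : ∀ i', ord i' ≤ j + 2 → regionInt T y₀ z₀
        (fun y z => ‖V i' y z‖ ^ 2 * nullWeight (N - 1) j y z) ≤
        closingConst N K (Fintype.card ι) d * (δ + A ^ 2) := by
      intro i' hi'
      have h2 := ih (j + 1) (by omega) i' (by omega)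
      obtain ⟨f1, f2, -⟩ := flux_nonneg (N := N) (U := U) (V := V) hT hy hz i' (j + 1)
      obtain ⟨-, -, f3⟩ := flux_nonneg (N := N - 1) (U := U) (V := V) hT hy hz i' j
      simp only [Nat.add_sub_cancel] at h2
      push_cast at h2
      nlinarith [mul_nonneg (Nat.cast_nonneg (α := ℝ) j) f3]
    have cw := continuous_nullWeight (N - 1) j
    have cp : Continuous (Function.uncurry fun y z =>
        3 * (‖V (p i) y z‖ ^ 2 * nullWeight (N - 1) j y z)) :=
      continuous_const.mul (continuous_normSq_mul (S.contV (p i)) cw)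
    have cq : Continuous (Function.uncurry fun y z =>
        3 * (‖V (q i) y z‖ ^ 2 * nullWeight (N - 1) j y z)) :=
      continuous_const.mul (continuous_normSq_mul (S.contV (q i)) cw)
    have cx : Continuous (Function.uncurry fun y z => 75 * (K : ℝ) ^ 2 * X y z) :=
      continuous_const.mul cX
    have hbad : regionInt T y₀ z₀ (fun y z => ‖U i y z‖ ^ 2 * nullWeight (N - 1) j y z) ≤
        6 * (closingConst N K (Fintype.card ι) d * (δ + A ^ 2)) +
          75 * K ^ 2 * (3 * Fintype.card ι + 1) * A ^ 2 := by
      have call : Continuous (Function.uncurry fun y z =>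
          3 * (‖V (p i) y z‖ ^ 2 * nullWeight (N - 1) j y z) +
          3 * (‖V (q i) y z‖ ^ 2 * nullWeight (N - 1) j y z) + 75 * (K : ℝ) ^ 2 * X y z) :=
        (cp.add cq).add cx
      refine (regionInt_mono hT hy hz (continuous_normSq_mul (S.contU i) cw) call fun y z h1 h2 h3 h4 => ?_).trans ?_
      · have h := inExt_of_rayExitIn_le (by linarith) h3.le h4.le
        have w0 := h.nullWeight_nonneg (N - 1) j
        have g1 := mul_le_mul_of_nonneg_right (S.normSq_U_le hiN (y := y) (z := z) (by linarith)) w0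
        have g2 := S.normSq_G_le hN hK h B.pos (S.norm_U_le_of_bounded B h h2) hi
        have g3 : ‖G i y z‖ ^ 2 * nullWeight (N - 1) j y z ≤
            z ^ (N + 1) * ((1 + y) / z) ^ j * ‖G i y z‖ ^ 2 := by
          rw [nullWeight_eq (by omega) h.pos, mul_comm]
          refine mul_le_mul_of_nonneg_right (mul_le_mul_of_nonneg_right
            (pow_le_pow_right₀ h.one_le (by omega)) (pow_nonneg h.ratio_nonneg _)) (sq_nonneg _)
        have g4 : 25 * (K : ℝ) ^ 2 * A * X y z ≤ 25 * K ^ 2 * X y z := by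
          have : 0 ≤ X y z := cubicDensity_nonneg B.pos.le h
          have hA1 := B.le_one
          refine mul_le_mul_of_nonneg_right ?_ this
          nlinarith [sq_nonneg (K : ℝ)]
        have g5 : 25 * (K : ℝ) ^ 2 * A * (outDensity N ord U y z * raySupSum N ord p q V z +
          A * bulkDensity N ord V y z) = 25 * (K : ℝ) ^ 2 * A * X y z := rfl
        linarith
      · have cpq : Continuous (Function.uncurry fun y z =>
            3 * (‖V (p i) y z‖ ^ 2 * nullWeight (N - 1) j y z) +
            3 * (‖V (q i) y z‖ ^ 2 * nullWeight (N - 1) j y z)) := cp.add cq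
        rw [regionInt_add cpq cx, regionInt_add cp cq, regionInt_const_mul, regionInt_const_mul,
          regionInt_const_mul]
        have k1 := hb (p i) (by rw [S.ord_p i hiN]; omega)
        have k2 := hb (q i) (by rw [S.ord_q i hiN]; omega)
        have k3 := mul_le_mul_of_nonneg_left hXint (show (0 : ℝ) ≤ 75 * K ^ 2 by positivity)
        linarith
    have hcc := one_le_closingConst N K (Fintype.card ι) d
    have hNj : ((N - j : ℕ) : ℝ) ≤ N := Nat.cast_le.2 (Nat.sub_le _ _)
    have r0 : 0 ≤ 6 * (closingConst N K (Fintype.card ι) d * (δ + A ^ 2)) +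
          75 * K ^ 2 * (3 * Fintype.card ι + 1) * A ^ 2 := by positivity
    have hbad2 := (mul_le_mul_of_nonneg_left hbad (Nat.cast_nonneg (α := ℝ) (N - j))).trans
      (mul_le_mul_of_nonneg_right hNj r0)
    have x1 : (0 : ℝ) ≤ (5 * K + 1 + 25 * K ^ 2) * (3 * Fintype.card ι + 1) * δ := by positivity
    have x2 : (0 : ℝ) ≤ N * (75 * K ^ 2 * (3 * Fintype.card ι + 1) * δ) := by positivity
    rw [closingConst]
    linarith

end NullSystem
end Thirring
end

/-! ### The continuity argument in the incoming coordinate. -/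

noncomputable section
namespace Thirring
open MeasureTheory Set

/-- The continuity method on a half line. -/
lemma le_of_bootstrap {g : ℝ → ℝ} (cg : Continuous g) {a b : ℝ} (h1 : g 1 ≤ a) (hab : a < b)
    (h : ∀ z, 1 ≤ z → (∀ w ∈ Icc 1 z, g w ≤ b) → g z ≤ a) : ∀ z, 1 ≤ z → g z ≤ a := by
  by_contra! hcon
  obtain ⟨z', hz', hgz⟩ := hcon
  -- Were the claim false, the level `c > a` would be reached a first time, at `z₁`. Up to `z₁` the
  -- function stays below `c ≤ b`, so the hypothesis forces `g z₁ ≤ a < c`.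
  set c := min b (g z') with hc
  have hac : a < c := lt_min hab hgz
  have hcomp : IsCompact (Icc 1 z' ∩ {z | c ≤ g z}) :=
    isCompact_Icc.inter_right (isClosed_le continuous_const cg)
  obtain ⟨z₁, ⟨hm, hmin⟩⟩ := hcomp.exists_isLeast
    ⟨z', ⟨hz', le_rfl⟩, show c ≤ g z' from min_le_right _ _⟩
  have hlt : ∀ w ∈ Ico 1 z₁, g w < c := by
    intro w hw
    by_contra! hge
    exact absurd (hmin ⟨⟨hw.1, hw.2.le.trans hm.1.2⟩, hge⟩) (not_le.2 hw.2)
  have hz1 : g z₁ ≤ c := by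
    obtain ⟨w, hw, hgw⟩ := intermediate_value_Icc hm.1.1 cg.continuousOn ⟨h1.trans hac.le, hm.2⟩
    rcases hw.2.lt_or_eq with hlt' | heq
    · exact absurd hgw (hlt w ⟨hw.1, hlt'⟩).ne
    · rw [← heq, hgw]
  have := h z₁ hm.1.1 fun w hw => by
    rcases hw.2.lt_or_eq with hlt' | heq
    · exact ((hlt w ⟨hw.1, hlt'⟩).le).trans (min_le_left _ _)
    · rw [heq]; exact hz1.trans (min_le_left _ _)
  exact absurd (hm.2.trans this) (not_le.2 hac)

lemma measurable_rayExitOut (T z₀ : ℝ) : Measurable (rayExitOut T z₀) := by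
  unfold rayExitOut
  refine measurable_const.min ((measurable_id.add_const _).min ?_)
  exact Measurable.ite measurableSet_Iio measurable_inv.neg measurable_const

lemma intervalIntegrable_rayExitOut {T y₀ z₀ : ℝ} (hT : 1 ≤ T) (hz : y₀ + 2 ≤ z₀)
    {f : ℝ → ℝ → ℝ} (hf : Continuous (Function.uncurry f)) :
    IntervalIntegrable (fun y => f y (rayExitOut T z₀ y)) volume y₀ (z₀ - 2) := by
  rw [intervalIntegrable_iff_integrableOn_Icc_of_le (by linarith)]
  obtain ⟨C, hC⟩ := (isCompact_Icc.prod isCompact_Icc :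
    IsCompact (Icc y₀ (z₀ - 2) ×ˢ Icc (y₀ + 2) z₀)).exists_bound_of_continuousOn hf.continuousOn
  refine Measure.integrableOn_of_bounded (M := C) (by simp) ?_ ?_
  · exact (hf.measurable.comp (measurable_id.prodMk (measurable_rayExitOut T z₀))).aestronglyMeasurable
  · filter_upwards [ae_restrict_mem measurableSet_Icc] with y hy
    refine hC (y, rayExitOut T z₀ y) ⟨hy, ?_, min_le_left _ _⟩
    linarith [le_rayExitOut (T := T) (y := y) hT (by linarith [hy.2] : y + 2 ≤ z₀), hy.1]

lemma rayExitOut_full {y z : ℝ} (h : InExt y z) : rayExitOut z z y = z :=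
  le_antisymm (min_le_left _ _)
    ((le_rayExitOut_iff h.pos).2 ⟨le_rfl, h.neg_one_le, by linarith [h.nonneg, h.one_le]⟩)

namespace NullSystem

variable {ι : Type*} {N : ℕ} {ord : ι → ℕ} {p q : ι → ι} {l : ι → List (ι × ι × ι)} {δ : ℝ}
  {U V F G : ι → ℝ → ℝ → ℂ} [Fintype ι]

lemma closingConst_mono (N K n : ℕ) : Monotone (closingConst N K n) := by
  refine monotone_nat_of_le_succ fun d => ?_
  induction d with
  | zero =>
    have := one_le_closingConst N K n 0
    have h2 : (0 : ℝ) ≤ N * (6 * closingConst N K n 0 + 75 * K ^ 2 * (3 * n + 1)) := by positivity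
    rw [closingConst, closingConst]
    linarith
  | succ d ih =>
    rw [closingConst, closingConst]
    gcongr

lemma closingConst_pos (N K n d : ℕ) : 0 < closingConst N K n d :=
  lt_of_lt_of_le one_pos (one_le_closingConst N K n d)

variable (S : NullSystem N ord p q l δ U V F G)
include S

/-- The three conclusions of the closed energy estimate. -/
lemma flux_bounds (hN : 1 ≤ N) {K : ℕ} (hK : ∀ i, (l i).length ≤ K) {A T y₀ z₀ : ℝ}
    (B : BoundedBy N ord δ U V A z₀) (hT : 1 ≤ T) (hy : -1 ≤ y₀) (hz : y₀ + 2 ≤ z₀)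
    {i : ι} {j : ℕ} (hj : j ≤ N) (hi : ord i ≤ j + 1) :
    (∫ y in y₀..(z₀ - 2), ‖U i y (rayExitOut T z₀ y)‖ ^ 2 * nullWeight N j y (rayExitOut T z₀ y)) ≤
      closingConst N K (Fintype.card ι) N * (δ + A ^ 2) ∧
    (∫ z in (y₀ + 2)..z₀, ‖V i (rayExitIn T y₀ z) z‖ ^ 2 * nullWeight N j (rayExitIn T y₀ z) z) ≤
      closingConst N K (Fintype.card ι) N * (δ + A ^ 2) ∧
    (1 ≤ j → regionInt T y₀ z₀ (fun y z => ‖V i y z‖ ^ 2 * nullWeight (N - 1) (j - 1) y z) ≤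
      closingConst N K (Fintype.card ι) N * (δ + A ^ 2)) := by
  have h := S.flux_le hN hK B hT hy hz (N - j) j (by omega) i hi
  have h2 : closingConst N K (Fintype.card ι) (N - j) * (δ + A ^ 2) ≤
      closingConst N K (Fintype.card ι) N * (δ + A ^ 2) :=
    mul_le_mul_of_nonneg_right (closingConst_mono _ _ _ (by omega))
      (by have := S.delta_nonneg i; positivity)
  obtain ⟨f1, f2, -⟩ := flux_nonneg (N := N) (U := U) (V := V) hT hy hz i j
  obtain ⟨-, -, f3⟩ := flux_nonneg (N := N - 1) (U := U) (V := V) hT hy hz i (j - 1)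
  have f4 := mul_nonneg (Nat.cast_nonneg (α := ℝ) j) f3
  refine ⟨by linarith, by linarith, fun hj1 => ?_⟩
  have : (1 : ℝ) ≤ j := Nat.one_le_cast.2 hj1
  nlinarith

omit S in
/-- The constant of the closed estimate for the total norms. -/
def totalConst (N K n : ℕ) : ℝ := 1 + 2 * (n * ((N + 1) * closingConst N K n N))

omit S in
lemma one_le_totalConst (N K n : ℕ) : 1 ≤ totalConst N K n := by
  unfold totalConst
  have := closingConst_pos N K n N
  have : 0 ≤ 2 * (n * ((N + 1) * closingConst N K n N)) := by positivity
  linarith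

/-- For `T = z₀` and `y₀ = -1` the exit boundary of the outgoing rays contains the incoming ray `z =
z₀`; the rest of it, for `y < -1/z₀`, carries a nonnegative flux and is discarded. -/
lemma rayEnergy_le (hN : 1 ≤ N) {K : ℕ} (hK : ∀ i, (l i).length ≤ K) {A z₀ : ℝ}
    (B : BoundedBy N ord δ U V A z₀) : rayEnergy N ord U z₀ ≤
      Fintype.card ι * ((N + 1) * (closingConst N K (Fintype.card ι) N * (δ + A ^ 2))) := by
  have hz := B.one_le
  unfold rayEnergy outDensity
  have ci : ∀ i j, Continuous fun y => ‖U i y z₀‖ ^ 2 * nullWeight N j y z₀ := fun i j =>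
    continuous_slice_left (continuous_normSq_mul (S.contU i) (continuous_nullWeight N j)) z₀
  rw [intervalIntegral.integral_finsetSum fun i _ =>
    (continuous_finsetSum _ fun j _ => ci i j).intervalIntegrable _ _]
  refine (Finset.sum_le_card_nsmul _ _
    ((N + 1) * (closingConst N K (Fintype.card ι) N * (δ + A ^ 2))) fun i _ => ?_).trans (by
      rw [nsmul_eq_mul, Finset.card_univ])
  rw [intervalIntegral.integral_finsetSum fun j _ => (ci i j).intervalIntegrable _ _]
  have hδ := S.delta_nonneg i
  have hc := closingConst_pos N K (Fintype.card ι) N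
  refine (Finset.sum_le_card_nsmul _ _ (closingConst N K (Fintype.card ι) N * (δ + A ^ 2))
    fun j hj => ?_).trans ?_
  · rw [Finset.mem_filter, Finset.mem_range] at hj
    have hb := (S.flux_bounds hN hK B hz le_rfl (by linarith) (i := i) (j := j) (by omega) hj.2).1
    refine le_trans ?_ hb
    have cf := intervalIntegrable_rayExitOut (T := z₀) (y₀ := -1) (z₀ := z₀) hz (by linarith)
      (continuous_normSq_mul (S.contU i) (continuous_nullWeight N j))
    have hm1 : -1 ≤ -(max 1 z₀)⁻¹ := neg_le_neg (inv_le_one_of_one_le₀ (le_max_left _ _))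
    have : ∫ y in (-(max 1 z₀)⁻¹)..(z₀ - 2), ‖U i y z₀‖ ^ 2 * nullWeight N j y z₀ =
        ∫ y in (-(max 1 z₀)⁻¹)..(z₀ - 2), ‖U i y (rayExitOut z₀ z₀ y)‖ ^ 2 *
          nullWeight N j y (rayExitOut z₀ z₀ y) := by
      apply intervalIntegral.integral_congr
      intro y hy
      rw [uIcc_of_le (neg_inv_le hz)] at hy
      simp only [rayExitOut_full (inExt_of_neg_inv_le hz hy.1 hy.2)]
    rw [this]
    refine intervalIntegral.integral_mono_interval hm1 (neg_inv_le hz) le_rfl ?_ cf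
    filter_upwards [ae_restrict_mem measurableSet_Ioc] with y hy
    have h1 := le_rayExitOut (T := z₀) (y := y) hz (by linarith [hy.2] : y + 2 ≤ z₀)
    have h2 := (le_rayExitOut_iff (T := z₀) (z₀ := z₀) (y := y) (by linarith [hy.1])).1 le_rfl
    exact mul_nonneg (sq_nonneg _)
      (InExt.nullWeight_nonneg ⟨by linarith [hy.1], h2.2.1, by linarith⟩ _ _)
  · rw [nsmul_eq_mul]
    refine mul_le_mul_of_nonneg_right ?_ (by positivity)
    have := Finset.card_filter_le (Finset.range (N + 1)) (fun j => ord i ≤ j + 1)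
    rw [Finset.card_range] at this
    exact_mod_cast this

/-- The term of index `j < N` is the gain in the energy estimate with weight index `j + 1`. -/
lemma bulkEnergy_le (hN : 1 ≤ N) {K : ℕ} (hK : ∀ i, (l i).length ≤ K) {A z₀ : ℝ}
    (B : BoundedBy N ord δ U V A z₀) : bulkEnergy N ord V z₀ ≤
      Fintype.card ι * ((N + 1) * (closingConst N K (Fintype.card ι) N * (δ + A ^ 2))) := by
  have hz := B.one_le
  have ci : ∀ i j, Continuous (Function.uncurry fun y z => ‖V i y z‖ ^ 2 * nullWeight (N - 1) j y z) :=
    fun i j => continuous_normSq_mul (S.contV i) (continuous_nullWeight _ j)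
  have e1 : bulkEnergy N ord V z₀ = ∑ i, ∑ j ∈ (Finset.range N).filter (fun j => ord i ≤ j + 2),
      fullInt z₀ (fun y z => ‖V i y z‖ ^ 2 * nullWeight (N - 1) j y z) := by
    unfold bulkEnergy fullInt bulkDensity
    simp_rw [← intervalIntegral.integral_finsetSum (fun j _ =>
      (continuous_full_ray (ci _ j)).intervalIntegrable _ _)]
    rw [← intervalIntegral.integral_finsetSum (fun i _ =>
      (continuous_finsetSum _ fun j _ => continuous_full_ray (ci i j)).intervalIntegrable _ _)]
    congr 1; ext z
    rw [intervalIntegral.integral_finsetSum (fun i _ =>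
      (continuous_finsetSum _ fun j _ => continuous_slice_left (ci i j) z).intervalIntegrable _ _)]
    refine Finset.sum_congr rfl fun i _ => ?_
    rw [intervalIntegral.integral_finsetSum (fun j _ =>
      (continuous_slice_left (ci i j) z).intervalIntegrable _ _)]
  rw [e1]
  refine (Finset.sum_le_card_nsmul _ _
    ((N + 1) * (closingConst N K (Fintype.card ι) N * (δ + A ^ 2))) fun i _ => ?_).trans (by
      rw [nsmul_eq_mul, Finset.card_univ])
  have hδ := S.delta_nonneg i
  have hc := closingConst_pos N K (Fintype.card ι) N
  refine (Finset.sum_le_card_nsmul _ _ (closingConst N K (Fintype.card ι) N * (δ + A ^ 2))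
    fun j hj => ?_).trans ?_
  · rw [Finset.mem_filter, Finset.mem_range] at hj
    have hb := (S.flux_bounds hN hK B hz le_rfl (by linarith) (i := i) (j := j + 1)
      (by omega) (by omega)).2.2 (by omega)
    rwa [fullInt_eq hz]
  · rw [nsmul_eq_mul]
    refine mul_le_mul_of_nonneg_right ?_ (by positivity)
    have := Finset.card_filter_le (Finset.range N) (fun j => ord i ≤ j + 2)
    rw [Finset.card_range] at this
    have : (((Finset.range N).filter (fun j => ord i ≤ j + 2)).card : ℝ) ≤ N := by exact_mod_cast this
    linarith

omit S in
lemma rayEnergy_nonneg {z : ℝ} (hz : 1 ≤ z) : 0 ≤ rayEnergy N ord U z :=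
  intervalIntegral.integral_nonneg (neg_inv_le hz) fun _ hy =>
    outDensity_nonneg (inExt_of_neg_inv_le hz hy.1 hy.2)

omit S in
lemma bulkEnergy_nonneg {z : ℝ} (hz : 1 ≤ z) : 0 ≤ bulkEnergy N ord V z :=
  intervalIntegral.integral_nonneg hz fun _ hz' =>
    intervalIntegral.integral_nonneg (neg_inv_le hz'.1) fun _ hy =>
      bulkDensity_nonneg (inExt_of_neg_inv_le hz'.1 hy.1 hy.2)

/-- The norms of a small solution remain small. -/
lemma boundedBy_of_small (hN : 1 ≤ N) {K : ℕ} (hK : ∀ i, (l i).length ≤ K) (hδ : 0 < δ)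
    (hsmall : 9 * totalConst N K (Fintype.card ι) ^ 2 * δ ≤ 1) {z₀ : ℝ} (hz₀ : 1 ≤ z₀) :
    BoundedBy N ord δ U V (2 * totalConst N K (Fintype.card ι) * δ) z₀ := by
  set M := totalConst N K (Fintype.card ι) with hM
  have hM1 : 1 ≤ M := one_le_totalConst _ _ _
  have hMδ : 3 * M * δ ≤ 1 := by nlinarith
  have key : ∀ z, 1 ≤ z → rayEnergy N ord U z + bulkEnergy N ord V z ≤ 2 * M * δ := by
    -- Assuming the bound `A = 3Mδ`, the closed estimate returns `M (δ + A²)`; smallness of `δ`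
    -- gives `A² ≤ δ`, hence the better bound `2Mδ`. At `z = 1` both norms are integrals over empty
    -- sets.
    refine le_of_bootstrap (S.continuous_rayEnergy.add S.continuous_bulkEnergy) (b := 3 * M * δ)
      ?_ (by nlinarith) fun z hz hle => ?_
    · have e1 : rayEnergy N ord U 1 = 0 := by
        unfold rayEnergy
        rw [show -(max (1 : ℝ) 1)⁻¹ = 1 - 2 by norm_num, intervalIntegral.integral_same]
      have e2 : bulkEnergy N ord V 1 = 0 := by
        unfold bulkEnergy fullInt
        rw [intervalIntegral.integral_same]
      simp only [Pi.add_apply, e1, e2, add_zero]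
      positivity
    · simp only [Pi.add_apply] at hle ⊢
      have B : BoundedBy N ord δ U V (3 * M * δ) z :=
        ⟨by positivity, hMδ, by nlinarith, hz, fun w hw hwz => by
          have := hle w ⟨hw, hwz⟩
          have := bulkEnergy_nonneg (N := N) (ord := ord) (V := V) hw
          linarith, by
          have := hle z ⟨hz, le_rfl⟩
          have := rayEnergy_nonneg (N := N) (ord := ord) (U := U) hz
          linarith⟩
      have h1 := S.rayEnergy_le hN hK B
      have h2 := S.bulkEnergy_le hN hK B
      have h3 : (3 * M * δ) ^ 2 ≤ δ := by nlinarith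
      have h4 : M = 1 + 2 * (Fintype.card ι * ((N + 1) * closingConst N K (Fintype.card ι) N)) := rfl
      have hc := closingConst_pos N K (Fintype.card ι) N
      have h5 : (0 : ℝ) ≤ Fintype.card ι * ((N + 1) * closingConst N K (Fintype.card ι) N) := by
        positivity
      calc _ ≤ 2 * (Fintype.card ι * ((N + 1) * closingConst N K (Fintype.card ι) N)) *
            (δ + (3 * M * δ) ^ 2) := by linarith
        _ ≤ M * (δ + (3 * M * δ) ^ 2) := mul_le_mul_of_nonneg_right (by linarith) (by positivity)
        _ ≤ M * (δ + δ) := by gcongr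
        _ = _ := by ring
  refine ⟨by positivity, by linarith [mul_pos (lt_of_lt_of_le one_pos hM1) hδ], by nlinarith, hz₀,
    fun z hz _ => ?_, ?_⟩
  · have := key z hz
    have := bulkEnergy_nonneg (N := N) (ord := ord) (V := V) hz
    linarith
  · have := key z₀ hz₀
    have := rayEnergy_nonneg (N := N) (ord := ord) (U := U) hz₀
    linarith

end NullSystem
end Thirring
end

/-! ### Pointwise bounds for `V` and the flux bounds of the hierarchy. -/

noncomputable section
namespace Thirring
open MeasureTheory Set

namespace NullSystem

variable {ι : Type*} {N : ℕ} {ord : ι → ℕ} {p q : ι → ι} {l : ι → List (ι × ι × ι)} {δ : ℝ}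
  {U V F G : ι → ℝ → ℝ → ℂ} [Fintype ι]

variable (S : NullSystem N ord p q l δ U V F G)
include S

/-- Pointwise bound for `V`, by integration along the outgoing rays. -/
lemma norm_V_le (hN : 1 ≤ N) {K : ℕ} (hK : ∀ i, (l i).length ≤ K) {A : ℝ} {y z : ℝ}
    (h : InExt y z) (B : BoundedBy N ord δ U V A z) {i : ι} (hi : ord i ≤ N) :
    ‖V i y z‖ ^ 2 * nullWeight N (ord i) y z ≤
      3 * δ + (N + 2) * (closingConst N K (Fintype.card ι) N * (δ + A ^ 2)) := by
  have hyz : y + 2 ≤ z := by linarith [h.le_sub]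
  have hy1 : -1 ≤ y := by linarith [h.nonneg]
  set C := closingConst N K (Fintype.card ι) N * (δ + A ^ 2) with hC
  have hin : ∀ z' ∈ Icc (y + 2) z, InExt y z' := fun z' hz' =>
    ⟨by linarith [hz'.1], by
      rcases le_total 0 y with h0 | h0
      · have : 0 ≤ y * z' := mul_nonneg h0 (by linarith [hz'.1])
        linarith
      · nlinarith [h.neg_one_le, hz'.2], by linarith [hz'.1]⟩
  -- Truncating the region at `y₀ = y`, with the time cut-off vacuous for `T = z`, makes the
  -- outgoing ray through the point its exit boundary, so the flux of `V` is an integral along this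
  -- ray.
  have hexit : ∀ z' ∈ Icc (y + 2) z, rayExitIn z y z' = y := fun z' hz' =>
    le_antisymm ((rayExitIn_le_iff (hin z' hz').one_le).2
      ⟨le_rfl, (hin z' hz').neg_one_le, by linarith [hz'.2, h.nonneg, h.one_le]⟩) (le_max_left _ _)
  have cs : ∀ i, Continuous fun z' => V i y z' := fun i => (S.contV i).comp
    (continuous_const.prodMk continuous_id)
  have cw : ∀ n j, Continuous fun z' => nullWeight n j y z' := fun n j =>
    continuous_slice_right (continuous_nullWeight n j) y
  have flux : ∀ i', ord i' ≤ ord i + 1 →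
      ∫ z' in (y + 2)..z, ‖V i' y z'‖ ^ 2 * nullWeight N (ord i) y z' ≤ C := by
    intro i' hi'
    refine le_trans (le_of_eq ?_) (S.flux_bounds hN hK B h.one_le hy1 hyz hi hi').2.1
    apply intervalIntegral.integral_congr
    intro z' hz'
    rw [uIcc_of_le hyz] at hz'
    simp only [hexit z' hz']
  -- Integrating outwards, the derivative of the weight has the unfavourable sign. It costs at most
  -- `N |V|² w`, which is why `N + 2` appears: `N + 1` for `V i` and one half for each derivative.
  have hd : ∀ z', HasDerivAt (fun z' => ‖V i y z'‖ ^ 2 * nullWeight N (ord i) y z')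
      (2 * inner ℝ (V i y z') ((V (p i) y z' + V (q i) y z') / 2) * nullWeight N (ord i) y z' +
        ‖V i y z'‖ ^ 2 * ((N - ord i : ℕ) * nullWeight (N - 1) (ord i) y z')) z' := fun z' =>
    ((S.deriv_V_out i hi y z').norm_sq).mul (hasDerivAt_nullWeight_right N (ord i) y z')
  have c1 := cs i
  have c2 := cs (p i)
  have c3 := cs (q i)
  have w1 := cw N (ord i)
  have w2 := cw (N - 1) (ord i)
  have cd : Continuous fun z' =>
      (2 * inner ℝ (V i y z') ((V (p i) y z' + V (q i) y z') / 2) * nullWeight N (ord i) y z' +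
        ‖V i y z'‖ ^ 2 * ((N - ord i : ℕ) * nullWeight (N - 1) (ord i) y z')) :=
    ((continuous_const.mul (c1.inner ((c2.add c3).div_const 2))).mul w1).add
      ((c1.norm.pow 2).mul (continuous_const.mul w2))
  have i1 : Continuous fun z' => (N + 1 : ℝ) * (‖V i y z'‖ ^ 2 * nullWeight N (ord i) y z') :=
    continuous_const.mul ((c1.norm.pow 2).mul w1)
  have i2 : Continuous fun z' => 1 / 2 * (‖V (p i) y z'‖ ^ 2 * nullWeight N (ord i) y z') :=
    continuous_const.mul ((c2.norm.pow 2).mul w1)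
  have i3 : Continuous fun z' => 1 / 2 * (‖V (q i) y z'‖ ^ 2 * nullWeight N (ord i) y z') :=
    continuous_const.mul ((c3.norm.pow 2).mul w1)
  have i12 : Continuous fun z' => (N + 1 : ℝ) * (‖V i y z'‖ ^ 2 * nullWeight N (ord i) y z') +
      1 / 2 * (‖V (p i) y z'‖ ^ 2 * nullWeight N (ord i) y z') := i1.add i2
  have i123 : Continuous fun z' => (N + 1 : ℝ) * (‖V i y z'‖ ^ 2 * nullWeight N (ord i) y z') +
      1 / 2 * (‖V (p i) y z'‖ ^ 2 * nullWeight N (ord i) y z') +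
      1 / 2 * (‖V (q i) y z'‖ ^ 2 * nullWeight N (ord i) y z') := i12.add i3
  have hint := intervalIntegral.integral_eq_sub_of_hasDerivAt (a := y + 2) (b := z)
    (fun x _ => hd x) (cd.intervalIntegrable _ _)
  have hle := intervalIntegral.integral_mono_on (μ := volume) hyz (cd.intervalIntegrable _ _)
    (i123.intervalIntegrable _ _) fun z' hz' => by
      have w0 := (hin z' hz').nullWeight_nonneg N (ord i)
      have w0' := (hin z' hz').nullWeight_nonneg (N - 1) (ord i)
      have a1 : inner ℝ (V i y z') ((V (p i) y z' + V (q i) y z') / 2) ≤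
          ‖V i y z'‖ * ((‖V (p i) y z'‖ + ‖V (q i) y z'‖) / 2) := by
        refine (real_inner_le_norm _ _).trans (mul_le_mul_of_nonneg_left ?_ (norm_nonneg _))
        rw [norm_div, RCLike.norm_ofNat]
        linarith [norm_add_le (V (p i) y z') (V (q i) y z')]
      have a2 : 2 * inner ℝ (V i y z') ((V (p i) y z' + V (q i) y z') / 2) ≤
          ‖V i y z'‖ ^ 2 + 1 / 2 * ‖V (p i) y z'‖ ^ 2 + 1 / 2 * ‖V (q i) y z'‖ ^ 2 := by
        nlinarith [sq_nonneg (‖V i y z'‖ - ‖V (p i) y z'‖), sq_nonneg (‖V i y z'‖ - ‖V (q i) y z'‖)]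
      have a3 := mul_le_mul_of_nonneg_right a2 w0
      have a4 : ((N - ord i : ℕ) : ℝ) * nullWeight (N - 1) (ord i) y z' ≤
          N * nullWeight N (ord i) y z' :=
        mul_le_mul (Nat.cast_le.2 (Nat.sub_le _ _)) (nullWeight_mono_left (hin z' hz')) w0'
          (Nat.cast_nonneg _)
      have a5 := mul_le_mul_of_nonneg_left a4 (sq_nonneg ‖V i y z'‖)
      show _ ≤ (N + 1 : ℝ) * (‖V i y z'‖ ^ 2 * nullWeight N (ord i) y z') +
        1 / 2 * (‖V (p i) y z'‖ ^ 2 * nullWeight N (ord i) y z') +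
        1 / 2 * (‖V (q i) y z'‖ ^ 2 * nullWeight N (ord i) y z')
      linarith
  rw [intervalIntegral.integral_add (i12.intervalIntegrable _ _) (i3.intervalIntegrable _ _),
    intervalIntegral.integral_add (i1.intervalIntegrable _ _) (i2.intervalIntegrable _ _),
    intervalIntegral.integral_const_mul, intervalIntegral.integral_const_mul,
    intervalIntegral.integral_const_mul] at hle
  have b1 := flux i (by omega)
  have b2 := flux (p i) (by rw [S.ord_p i hi])
  have b3 := flux (q i) (by rw [S.ord_q i hi])
  have b4 := S.data_sup_V hi (z := y + 2) (by linarith)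
  simp only [add_sub_cancel_right] at b4
  have b5 := mul_le_mul_of_nonneg_left b1 (show (0 : ℝ) ≤ N + 1 by positivity)
  linarith

/-- Here `ord i ≤ j ≤ N`, so any two of the three factors can be bounded pointwise. One factor `V`
is kept as a density, so that the result is charged to the flux of `V` alone. -/
lemma normSq_cubic_aux {y z D : ℝ} (h : InExt y z)
    (hDU : ∀ i, ord i ≤ N → ‖U i y z‖ ^ 2 * nullWeight N (ord i) y z ≤ D)
    (hDV : ∀ i, ord i ≤ N → ‖V i y z‖ ^ 2 * nullWeight N (ord i) y z ≤ D)
    {K : ℕ} (hK : ∀ i, (l i).length ≤ K) {i : ι} {j : ℕ} (hj : j ≤ N) (hi : ord i ≤ j) :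
    ‖F i y z‖ ^ 2 * nullWeight N j y z ≤ K ^ 2 * D ^ 2 * outDensity N ord V y z ∧
    ‖G i y z‖ ^ 2 * nullWeight N j y z ≤ K ^ 2 * D ^ 2 * outDensity N ord V y z := by
  have hz := h.pos
  have hr0 := h.ratio_nonneg
  have hr1 := h.ratio_le_one
  have w0 := h.nullWeight_nonneg N j
  have hE0 := outDensity_nonneg (N := N) (ord := ord) (U := V) h
  have v_out : ∀ i, ‖V i y z‖ ^ 2 * (z ^ N * ((1 + y) / z) ^ (ord i - 1)) ≤ outDensity N ord V y z :=
    fun i => by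
    have := S.ord_le i
    rw [← nullWeight_eq (by omega) hz]
    exact le_outDensity h (by omega) (by omega)
  have hDU' : ∀ i, ord i ≤ N → ‖U i y z‖ ^ 2 * (z ^ N * ((1 + y) / z) ^ ord i) ≤ D := fun i hi => by
    rw [← nullWeight_eq hi hz]; exact hDU i hi
  have hDV' : ∀ i, ord i ≤ N → ‖V i y z‖ ^ 2 * (z ^ N * ((1 + y) / z) ^ ord i) ≤ D := fun i hi => by
    rw [← nullWeight_eq hi hz]; exact hDV i hi
  constructor
  · have h1 := list_sum_sq_le_of_forall (l i)
      (fun e => ‖V e.1 y z‖ * ‖V e.2.1 y z‖ * ‖U e.2.2 y z‖) (hK i) w0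
      (Q := outDensity N ord V y z * D ^ 2) (by positivity) (fun e => by positivity) (fun e he => by
        have ho := S.ord_l i _ he
        rw [nullWeight_eq hj hz, pow_two D, ← mul_assoc]
        exact weighted_three h.one_le hr0 hr1 (by omega) (by omega) (v_out e.1)
          (hDV' e.2.1 (by omega)) (hDU' e.2.2 (by omega)))
    have h2 := mul_le_mul_of_nonneg_left (pow_le_pow_left₀ (norm_nonneg _) (S.norm_F i y z) 2) w0
    linarith
  · have h1 := list_sum_sq_le_of_forall (l i)
      (fun e => ‖U e.1 y z‖ * ‖U e.2.1 y z‖ * ‖V e.2.2 y z‖) (hK i) w0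
      (Q := outDensity N ord V y z * D ^ 2) (by positivity) (fun e => by positivity) (fun e he => by
        have ho := S.ord_l i _ he
        rw [nullWeight_eq hj hz, pow_two D, ← mul_assoc,
          show ‖U e.1 y z‖ * ‖U e.2.1 y z‖ * ‖V e.2.2 y z‖ =
            ‖V e.2.2 y z‖ * ‖U e.1 y z‖ * ‖U e.2.1 y z‖ by ring]
        exact weighted_three h.one_le hr0 hr1 (by omega) (by omega) (v_out e.2.2)
          (hDU' e.1 (by omega)) (hDU' e.2.1 (by omega)))
    have h2 := mul_le_mul_of_nonneg_left (pow_le_pow_left₀ (norm_nonneg _) (S.norm_G i y z) 2) w0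
    linarith

omit S in
/-- Boundedness of the hierarchy for small data: the fluxes through the exit boundary, and the
quantities that are controlled there pointwise by the flux density of `V`. -/
theorem exists_flux_bound (hN : 1 ≤ N) (ι : Type*) [Fintype ι] (K : ℕ) :
    ∃ C δ₀ : ℝ, 0 < C ∧ 0 < δ₀ ∧ ∀ {ord : ι → ℕ} {p q : ι → ι} {l : ι → List (ι × ι × ι)} {δ : ℝ}
      {U V F G : ι → ℝ → ℝ → ℂ}, NullSystem N ord p q l δ U V F G → (∀ i, (l i).length ≤ K) →
      0 < δ → δ ≤ δ₀ →
      (∀ T z₀, 1 ≤ T → 1 ≤ z₀ → ∀ i j, j ≤ N → ord i ≤ j + 1 →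
        (∫ y in (-1)..(z₀ - 2), ‖U i y (rayExitOut T z₀ y)‖ ^ 2 * nullWeight N j y (rayExitOut T z₀ y)) ≤
          C * δ ∧
        (∫ z in (1 : ℝ)..z₀, ‖V i (rayExitIn T (-1) z) z‖ ^ 2 * nullWeight N j (rayExitIn T (-1) z) z) ≤
          C * δ) ∧
      (∀ y z, InExt y z → y + 2 < z → ∀ i j, j ≤ N → ord i ≤ j →
        (‖U i y z‖ ^ 2 + ‖F i y z‖ ^ 2) * nullWeight N j y z ≤ C * outDensity N ord V y z) := by
  set M := totalConst N K (Fintype.card ι) with hM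
  set c := closingConst N K (Fintype.card ι) N with hc
  have hM1 : 1 ≤ M := one_le_totalConst _ _ _
  have hc1 : 1 ≤ c := one_le_closingConst _ _ _ _
  -- A common pointwise bound: `|U|²` is at most `5A ≤ 10`, and `|V|²` at most `3 + (N + 2) · 2c`.
  set D : ℝ := 13 + (N + 2) * (2 * c) with hD
  have hD0 : 0 < D := by positivity
  -- The summand `2c` serves the fluxes, `6` the two derivatives of `V` that replace `U`, and `4 = 3
  -- + 1` the terms in `G` and `F`.
  refine ⟨2 * c + 6 + 4 * (K ^ 2 * D ^ 2), (9 * M ^ 2)⁻¹, by positivity, by positivity, ?_⟩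
  intro ord p q l δ U V F G S hK hδ hle
  have hsmall : 9 * M ^ 2 * δ ≤ 1 := by
    rwa [← one_div, le_div_iff₀ (by positivity), mul_comm] at hle
  have B : ∀ z₀, 1 ≤ z₀ → BoundedBy N ord δ U V (2 * M * δ) z₀ := fun z₀ hz =>
    S.boundedBy_of_small hN hK hδ hsmall hz
  have hA2 : (2 * M * δ) ^ 2 ≤ δ := by nlinarith
  have hMδ : M * δ ≤ 1 := by nlinarith
  have hδ1 : δ ≤ 1 := by nlinarith
  have hcb : c * (δ + (2 * M * δ) ^ 2) ≤ 2 * c * δ := by nlinarith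
  have hpos : 0 ≤ 4 * ((K : ℝ) ^ 2 * D ^ 2) := by positivity
  constructor
  · intro T z₀ hT hz i j hj hi
    have h1 := S.flux_bounds hN hK (B z₀ hz) hT le_rfl (by linarith) hj hi
    rw [show (-1 : ℝ) + 2 = 1 by norm_num] at h1
    have : 2 * c * δ ≤ (2 * c + 6 + 4 * (K ^ 2 * D ^ 2)) * δ :=
      mul_le_mul_of_nonneg_right (by linarith) hδ.le
    exact ⟨h1.1.trans (hcb.trans this), h1.2.1.trans (hcb.trans this)⟩
  · intro y z h hyz i j hj hi
    have Bz := B z h.one_le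
    have hDU : ∀ i, ord i ≤ N → ‖U i y z‖ ^ 2 * nullWeight N (ord i) y z ≤ D := fun i hi => by
      refine (S.norm_U_le_of_bounded Bz h le_rfl i hi).trans ?_
      have : 0 ≤ ((N : ℝ) + 2) * (2 * c) := by positivity
      linarith
    have hDV : ∀ i, ord i ≤ N → ‖V i y z‖ ^ 2 * nullWeight N (ord i) y z ≤ D := fun i hi => by
      refine (S.norm_V_le hN hK h Bz hi).trans ?_
      have h1 : c * (δ + (2 * M * δ) ^ 2) ≤ 2 * c := hcb.trans (by nlinarith)
      have := mul_le_mul_of_nonneg_left h1 (show (0 : ℝ) ≤ N + 2 by positivity)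
      linarith
    obtain ⟨f1, f2⟩ := S.normSq_cubic_aux h hDU hDV hK hj hi
    have w0 := h.nullWeight_nonneg N j
    have hE0 := outDensity_nonneg (N := N) (ord := ord) (U := V) h
    have g1 := mul_le_mul_of_nonneg_right (S.normSq_U_le (i := i) (by omega) hyz) w0
    have g2 := le_outDensity (N := N) (ord := ord) (U := V) h (i := p i) hj
      (by rw [S.ord_p i (by omega)]; omega)
    have g3 := le_outDensity (N := N) (ord := ord) (U := V) h (i := q i) hj
      (by rw [S.ord_q i (by omega)]; omega)
    have g4 : 0 ≤ 2 * c * outDensity N ord V y z := by positivity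
    linarith

end NullSystem
end Thirring
end

/-! ### Boosts with spin and their commutation with the null derivatives. -/

noncomputable section
namespace Thirring
open MeasureTheory Set ComplexConjugate

/-- The directional derivative along a constant vector. -/
def dirDeriv (e : ℝ × ℝ) (φ : ℝ × ℝ → ℂ) : ℝ × ℝ → ℂ := fun p => fderiv ℝ φ p e

lemma dt_eq : dt = dirDeriv (1, 0) := rfl
lemma dx_eq : dx = dirDeriv (0, 1) := rfl

/-- The boost with a spin correction. -/
def spinBoost (c : ℝ) (φ : ℝ × ℝ → ℂ) : ℝ × ℝ → ℂ := fun p => boost φ p + c * φ p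

/-- `∂_t^a ∂_x^b (Z + c)^k φ` for `i = (a, b, k)`. -/
def jet (c : ℝ) (i : ℕ × ℕ × ℕ) (φ : ℝ × ℝ → ℂ) : ℝ × ℝ → ℂ :=
  dt^[i.1] (dx^[i.2.1] ((spinBoost c)^[i.2.2] φ))

lemma vf_eq_jet (I : ℕ × ℕ) (k : ℕ) (φ : ℝ × ℝ → ℂ) : vf I k φ = jet 0 (I.1, I.2, k) φ := by
  have : boost = spinBoost 0 := by funext φ p; simp [spinBoost]
  simp [vf, jet, this]

section smoothness

lemma ContDiff.dirDeriv {n : ℕ} {φ : ℝ × ℝ → ℂ} (h : ContDiff ℝ (n + 1 : ℕ) φ) (e : ℝ × ℝ) :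
    ContDiff ℝ n (dirDeriv e φ) :=
  (h.fderiv_right (m := n) (by norm_cast)).clm_apply contDiff_const

lemma ContDiff.spinBoost {n : ℕ} {φ : ℝ × ℝ → ℂ} (h : ContDiff ℝ (n + 1 : ℕ) φ) (c : ℝ) :
    ContDiff ℝ n (spinBoost c φ) := by
  have h1 : ContDiff ℝ n (dx φ) := ContDiff.dirDeriv h (0, 1)
  have h2 : ContDiff ℝ n (dt φ) := ContDiff.dirDeriv h (1, 0)
  have h3 : ContDiff ℝ n φ := h.of_le (by exact_mod_cast Nat.le_succ n)
  have e1 : ContDiff ℝ n fun p : ℝ × ℝ => (p.1 : ℂ) := Complex.ofRealCLM.contDiff.comp contDiff_fst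
  have e2 : ContDiff ℝ n fun p : ℝ × ℝ => (p.2 : ℂ) := Complex.ofRealCLM.contDiff.comp contDiff_snd
  exact ((e1.mul h1).add (e2.mul h2)).add (contDiff_const.mul h3)

lemma contDiff_iterate {op : (ℝ × ℝ → ℂ) → ℝ × ℝ → ℂ}
    (hop : ∀ n φ, ContDiff ℝ (n + 1 : ℕ) φ → ContDiff ℝ n (op φ)) {n m k : ℕ} (hk : n + k ≤ m)
    {φ : ℝ × ℝ → ℂ} (h : ContDiff ℝ m φ) : ContDiff ℝ n (op^[k] φ) := by
  induction k generalizing n with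
  | zero => exact h.of_le (by exact_mod_cast hk)
  | succ k ih =>
    rw [Function.iterate_succ_apply']
    exact hop n _ (ih (by omega))

lemma contDiff_jet {n m : ℕ} {φ : ℝ × ℝ → ℂ} (h : ContDiff ℝ m φ) (c : ℝ) (i : ℕ × ℕ × ℕ)
    (hm : n + i.1 + i.2.1 + i.2.2 ≤ m) : ContDiff ℝ n (jet c i φ) :=
  contDiff_iterate (fun _ _ h => ContDiff.dirDeriv h _) (le_refl _)
    (contDiff_iterate (fun _ _ h => ContDiff.dirDeriv h _) (le_refl _)
      (contDiff_iterate (fun _ _ h => ContDiff.spinBoost h c) hm h))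

lemma differentiable_jet {m : ℕ} {φ : ℝ × ℝ → ℂ} (h : ContDiff ℝ m φ) (c : ℝ) (i : ℕ × ℕ × ℕ)
    (hm : 1 + i.1 + i.2.1 + i.2.2 ≤ m) : Differentiable ℝ (jet c i φ) :=
  (contDiff_jet (n := 1) h c i hm).differentiable (by simp)

end smoothness

section algebra

lemma dirDeriv_comm {φ : ℝ × ℝ → ℂ} (h : ContDiff ℝ 2 φ) (e e' : ℝ × ℝ) :
    dirDeriv e (dirDeriv e' φ) = dirDeriv e' (dirDeriv e φ) := by
  funext p
  have hd : DifferentiableAt ℝ (fderiv ℝ φ) p :=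
    ((h.fderiv_right (m := 1) (by norm_num)).differentiable (by simp)) p
  have hsymm : IsSymmSndFDerivAt ℝ φ p := h.contDiffAt.isSymmSndFDerivAt (by simp)
  have key : ∀ a b, dirDeriv a (dirDeriv b φ) p = fderiv ℝ (fderiv ℝ φ) p a b := fun a b => by
    unfold dirDeriv
    rw [fderiv_clm_apply hd (differentiableAt_const b)]
    simp
  rw [key, key]
  exact hsymm e e'

lemma dirDeriv_one_eq (s : ℝ) (φ : ℝ × ℝ → ℂ) (p : ℝ × ℝ) :
    dirDeriv (1, s) φ p = dt φ p + s * dx φ p := by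
  have : ((1 : ℝ), s) = (1, 0) + s • (0, 1) := by ext <;> simp
  rw [this, dt_eq, dx_eq]
  unfold dirDeriv
  rw [map_add, map_smul, Complex.real_smul]

lemma dirDeriv_congr {O : Set (ℝ × ℝ)} (hO : IsOpen O) {φ ψ : ℝ × ℝ → ℂ} (h : EqOn φ ψ O) (e : ℝ × ℝ) :
    EqOn (dirDeriv e φ) (dirDeriv e ψ) O := fun p hp => by
  unfold dirDeriv
  rw [(h.eventuallyEq_of_mem (hO.mem_nhds hp)).fderiv_eq]

lemma spinBoost_congr {O : Set (ℝ × ℝ)} (hO : IsOpen O) {φ ψ : ℝ × ℝ → ℂ} (h : EqOn φ ψ O) (c : ℝ) :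
    EqOn (spinBoost c φ) (spinBoost c ψ) O := fun p hp => by
  unfold spinBoost boost
  rw [dt_eq, dx_eq, dirDeriv_congr hO h (0, 1) hp, dirDeriv_congr hO h (1, 0) hp, h hp]

lemma iterate_congr {O : Set (ℝ × ℝ)} {op : (ℝ × ℝ → ℂ) → ℝ × ℝ → ℂ}
    (hop : ∀ φ ψ, EqOn φ ψ O → EqOn (op φ) (op ψ) O) {φ ψ : ℝ × ℝ → ℂ} (h : EqOn φ ψ O) (k : ℕ) :
    EqOn (op^[k] φ) (op^[k] ψ) O := by
  induction k with
  | zero => exact h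
  | succ k ih => rw [Function.iterate_succ_apply', Function.iterate_succ_apply']; exact hop _ _ ih

lemma jet_congr {O : Set (ℝ × ℝ)} (hO : IsOpen O) {φ ψ : ℝ × ℝ → ℂ} (h : EqOn φ ψ O) (c : ℝ)
    (i : ℕ × ℕ × ℕ) : EqOn (jet c i φ) (jet c i ψ) O :=
  iterate_congr (fun _ _ h => dirDeriv_congr hO h _)
    (iterate_congr (fun _ _ h => dirDeriv_congr hO h _)
      (iterate_congr (fun _ _ h => spinBoost_congr hO h c) h _) _) _

lemma dt_jet (c : ℝ) (i : ℕ × ℕ × ℕ) (φ : ℝ × ℝ → ℂ) :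
    dt (jet c i φ) = jet c (i.1 + 1, i.2.1, i.2.2) φ := by
  unfold jet
  rw [Function.iterate_succ_apply']

lemma dirDeriv_iterate_comm (e e' : ℝ × ℝ) {k : ℕ} {φ : ℝ × ℝ → ℂ} (h : ContDiff ℝ (k + 1 : ℕ) φ) :
    dirDeriv e ((dirDeriv e')^[k] φ) = (dirDeriv e')^[k] (dirDeriv e φ) := by
  induction k with
  | zero => rfl
  | succ k ih =>
    rw [Function.iterate_succ_apply', Function.iterate_succ_apply', dirDeriv_comm, ih]
    · exact h.of_le (by exact_mod_cast Nat.le_succ _)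
    · exact contDiff_iterate (n := 2) (fun _ _ h => ContDiff.dirDeriv h _) (by omega) h

lemma dx_jet {m : ℕ} {φ : ℝ × ℝ → ℂ} (h : ContDiff ℝ m φ) (c : ℝ) (i : ℕ × ℕ × ℕ)
    (hm : i.1 + i.2.1 + i.2.2 + 1 ≤ m) :
    dx (jet c i φ) = jet c (i.1, i.2.1 + 1, i.2.2) φ := by
  unfold jet
  rw [Function.iterate_succ_apply', dx_eq, dt_eq, dirDeriv_iterate_comm]
  exact contDiff_iterate (n := i.1 + 1) (fun _ _ h => ContDiff.dirDeriv h _) (le_refl _)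
    (contDiff_iterate (m := m) (fun _ _ h => ContDiff.spinBoost h c) (by omega) h)

/-- For `s = ±1` one has `[∂_t + s ∂_x, Z] = s (∂_t + s ∂_x)`: null derivatives are eigenvectors of
the bracket with the boost, so commuting them only shifts the spin by `s`. -/
lemma dirDeriv_spinBoost {s : ℝ} (hs : s ^ 2 = 1) {φ : ℝ × ℝ → ℂ} (h : ContDiff ℝ 2 φ) (c : ℝ) :
    dirDeriv (1, s) (spinBoost c φ) = spinBoost (c + s) (dirDeriv (1, s) φ) := by
  funext p
  have h1 : Differentiable ℝ (dx φ) :=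
    (ContDiff.dirDeriv (n := 1) (by exact_mod_cast h) (0, 1)).differentiable (by simp)
  have h2 : Differentiable ℝ (dt φ) :=
    (ContDiff.dirDeriv (n := 1) (by exact_mod_cast h) (1, 0)).differentiable (by simp)
  have h3 : Differentiable ℝ φ := h.differentiable (by simp)
  have d1 : HasFDerivAt (fun p : ℝ × ℝ => (p.1 : ℂ))
      (Complex.ofRealCLM.comp (ContinuousLinearMap.fst ℝ ℝ ℝ)) p :=
    Complex.ofRealCLM.hasFDerivAt.comp p hasFDerivAt_fst
  have d2 : HasFDerivAt (fun p : ℝ × ℝ => (p.2 : ℂ))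
      (Complex.ofRealCLM.comp (ContinuousLinearMap.snd ℝ ℝ ℝ)) p :=
    Complex.ofRealCLM.hasFDerivAt.comp p hasFDerivAt_snd
  have hL : dirDeriv (1, s) (spinBoost c φ) p =
      (dx φ p + p.1 * dirDeriv (1, s) (dx φ) p) + (s * dt φ p + p.2 * dirDeriv (1, s) (dt φ) p) +
        c * dirDeriv (1, s) φ p := by
    have := (((d1.mul (h1 p).hasFDerivAt).add (d2.mul (h2 p).hasFDerivAt)).add
      ((h3 p).hasFDerivAt.const_mul (c : ℂ))).fderiv
    unfold dirDeriv spinBoost boost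
    erw [this]
    simp
    ring
  rw [hL, dx_eq, dt_eq, dirDeriv_comm h, dirDeriv_comm h (1, s) (1, 0)]
  unfold spinBoost boost
  rw [dx_eq, dt_eq]
  rw [dirDeriv_one_eq s φ p, dx_eq, dt_eq]
  have hs' : (s : ℂ) ^ 2 = 1 := by exact_mod_cast hs
  push_cast
  linear_combination (-dirDeriv (0, 1) φ p) * hs'

lemma dirDeriv_spinBoost_iterate {s : ℝ} (hs : s ^ 2 = 1) (c : ℝ) {k : ℕ} {φ : ℝ × ℝ → ℂ}
    (h : ContDiff ℝ (k + 1 : ℕ) φ) :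
    dirDeriv (1, s) ((spinBoost c)^[k] φ) = (spinBoost (c + s))^[k] (dirDeriv (1, s) φ) := by
  induction k with
  | zero => rfl
  | succ k ih =>
    rw [Function.iterate_succ_apply', Function.iterate_succ_apply', dirDeriv_spinBoost hs, ih]
    · exact h.of_le (by exact_mod_cast Nat.le_succ _)
    · exact contDiff_iterate (n := 2) (fun _ _ h => ContDiff.spinBoost h _) (by omega) h

lemma dirDeriv_jet {s : ℝ} (hs : s ^ 2 = 1) {m : ℕ} {φ : ℝ × ℝ → ℂ} (h : ContDiff ℝ m φ) (c : ℝ)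
    (i : ℕ × ℕ × ℕ) (hm : i.1 + i.2.1 + i.2.2 + 1 ≤ m) :
    dirDeriv (1, s) (jet c i φ) = jet (c + s) i (dirDeriv (1, s) φ) := by
  have h1 : ContDiff ℝ (i.1 + i.2.1 + 1 : ℕ) ((spinBoost c)^[i.2.2] φ) :=
    contDiff_iterate (m := m) (fun _ _ h => ContDiff.spinBoost h c) (by omega) h
  unfold jet
  rw [dt_eq, dx_eq, dirDeriv_iterate_comm, dirDeriv_iterate_comm, dirDeriv_spinBoost_iterate hs]
  · exact h.of_le (by exact_mod_cast (by omega))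
  · exact h1.of_le (by exact_mod_cast (by omega))
  · exact contDiff_iterate (n := i.1 + 1) (fun _ _ h => ContDiff.dirDeriv h _) (by omega) h1

/-- First order operators of spin type act as derivations, up to the spin. -/
structure IsSpinDerivation (op : ℝ → (ℝ × ℝ → ℂ) → ℝ × ℝ → ℂ) : Prop where
  add : ∀ c (f g : ℝ × ℝ → ℂ), Differentiable ℝ f → Differentiable ℝ g →
    op c (fun p => f p + g p) = fun p => op c f p + op c g p
  mul : ∀ c c' (f g : ℝ × ℝ → ℂ), Differentiable ℝ f → Differentiable ℝ g →
    op (c + c') (fun p => f p * g p) = fun p => op c f p * g p + f p * op c' g p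
  const_mul : ∀ c (a : ℂ) (f : ℝ × ℝ → ℂ), Differentiable ℝ f →
    op c (fun p => a * f p) = fun p => a * op c f p
  map_conj : ∀ c (f : ℝ × ℝ → ℂ), Differentiable ℝ f →
    op c (fun p => conj (f p)) = fun p => conj (op c f p)

lemma isSpinDerivation_dirDeriv (e : ℝ × ℝ) : IsSpinDerivation fun _ => dirDeriv e where
  add c f g hf hg := by
    funext p
    have := ((hf p).hasFDerivAt.add (hg p).hasFDerivAt).fderiv
    unfold dirDeriv
    erw [this]; simp
  mul c c' f g hf hg := by
    funext p
    have := ((hf p).hasFDerivAt.mul (hg p).hasFDerivAt).fderiv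
    unfold dirDeriv
    erw [this]; simp; ring
  const_mul c a f hf := by
    funext p
    have := ((hf p).hasFDerivAt.const_mul a).fderiv
    unfold dirDeriv
    erw [this]; simp
  map_conj c f hf := by
    funext p
    have := (Complex.conjCLE.hasFDerivAt.comp p (hf p).hasFDerivAt).fderiv
    unfold dirDeriv
    have e : (fun p => conj (f p)) = Complex.conjCLE ∘ f := by ext; simp
    rw [e, this]; simp

lemma isSpinDerivation_spinBoost : IsSpinDerivation spinBoost where
  add c f g hf hg := by
    funext p
    unfold spinBoost boost
    rw [dt_eq, dx_eq, (isSpinDerivation_dirDeriv _).add c f g hf hg,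
      (isSpinDerivation_dirDeriv _).add c f g hf hg]
    ring
  mul c c' f g hf hg := by
    funext p
    unfold spinBoost boost
    rw [dt_eq, dx_eq, (isSpinDerivation_dirDeriv _).mul c c' f g hf hg,
      (isSpinDerivation_dirDeriv _).mul c c' f g hf hg]
    push_cast
    ring
  const_mul c a f hf := by
    funext p
    unfold spinBoost boost
    rw [dt_eq, dx_eq, (isSpinDerivation_dirDeriv _).const_mul c a f hf,
      (isSpinDerivation_dirDeriv _).const_mul c a f hf]
    ring
  map_conj c f hf := by
    funext p
    unfold spinBoost boost
    rw [dt_eq, dx_eq, (isSpinDerivation_dirDeriv _).map_conj c f hf,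
      (isSpinDerivation_dirDeriv _).map_conj c f hf]
    simp

end algebra

end Thirring
end

/-! ### Leibniz rule for triple products and change of spin. -/

noncomputable section
namespace Thirring
open MeasureTheory Set ComplexConjugate

section iterates

variable {op : ℝ → (ℝ × ℝ → ℂ) → ℝ × ℝ → ℂ} (D : IsSpinDerivation op)
  (hop : ∀ c n φ, ContDiff ℝ (n + 1 : ℕ) φ → ContDiff ℝ n (op c φ))
include D hop

omit D in
lemma differentiable_iterate {c : ℝ} {k : ℕ} {f : ℝ × ℝ → ℂ} (hf : ContDiff ℝ (k + 1 : ℕ) f) :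
    Differentiable ℝ ((op c)^[k] f) :=
  (contDiff_iterate (n := 1) (hop c) (by omega) hf).differentiable (by simp)

lemma iterate_lin (c : ℝ) {k : ℕ} {f g : ℝ × ℝ → ℂ} (a : ℂ) (hf : ContDiff ℝ k f)
    (hg : ContDiff ℝ k g) :
    (op c)^[k] (fun p => a * f p + g p) = fun p => a * (op c)^[k] f p + (op c)^[k] g p := by
  induction k with
  | zero => rfl
  | succ k ih =>
    have df := differentiable_iterate hop (c := c) hf
    have dg := differentiable_iterate hop (c := c) hg
    rw [Function.iterate_succ_apply', Function.iterate_succ_apply', Function.iterate_succ_apply',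
      ih (hf.of_le (by exact_mod_cast Nat.le_succ k)) (hg.of_le (by exact_mod_cast Nat.le_succ k)),
      D.add c _ _ (df.const_mul a) dg, D.const_mul c a _ df]

lemma iterate_conj (c : ℝ) {k : ℕ} {f : ℝ × ℝ → ℂ} (hf : ContDiff ℝ k f) :
    (op c)^[k] (fun p => conj (f p)) = fun p => conj ((op c)^[k] f p) := by
  induction k with
  | zero => rfl
  | succ k ih =>
    rw [Function.iterate_succ_apply', Function.iterate_succ_apply',
      ih (hf.of_le (by exact_mod_cast Nat.le_succ k)), D.map_conj c _ (differentiable_iterate hop hf)]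

omit hop in
lemma IsSpinDerivation.list_sum {α : Type*} (c : ℝ) (L : List α) (t : α → ℝ × ℝ → ℂ)
    (ht : ∀ e ∈ L, Differentiable ℝ (t e)) :
    op c (fun p => (L.map fun e => t e p).sum) = fun p => (L.map fun e => op c (t e) p).sum := by
  induction L with
  | nil =>
    have := D.const_mul c 0 (fun _ => 0) (differentiable_const _)
    simpa using this
  | cons a L ih =>
    have hd : Differentiable ℝ fun p => (L.map fun e => t e p).sum := by
      clear ih
      induction L with
      | nil => simp
      | cons b L ih =>
        simp only [List.map_cons, List.sum_cons]
        exact (ht b (by simp)).add (ih fun e he => ht e (by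
          simp only [List.mem_cons] at he ⊢; tauto))
    simp only [List.map_cons, List.sum_cons]
    rw [D.add c _ _ (ht a (by simp)) hd, ih fun e he => ht e (by simp [he])]

end iterates

lemma smooth_dirDeriv (e : ℝ × ℝ) : ∀ (_ : ℝ) (n : ℕ) (φ : ℝ × ℝ → ℂ), ContDiff ℝ (n + 1 : ℕ) φ →
    ContDiff ℝ n (dirDeriv e φ) := fun _ _ _ h => ContDiff.dirDeriv h e

lemma smooth_spinBoost : ∀ (c : ℝ) (n : ℕ) (φ : ℝ × ℝ → ℂ), ContDiff ℝ (n + 1 : ℕ) φ →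
    ContDiff ℝ n (spinBoost c φ) := fun c _ _ h => ContDiff.spinBoost h c

lemma jet_lin (c : ℝ) (i : ℕ × ℕ × ℕ) {m : ℕ} (hm : i.1 + i.2.1 + i.2.2 ≤ m) {f g : ℝ × ℝ → ℂ}
    (a : ℂ) (hf : ContDiff ℝ m f) (hg : ContDiff ℝ m g) :
    jet c i (fun p => a * f p + g p) = fun p => a * jet c i f p + jet c i g p := by
  have s1 : ∀ {f : ℝ × ℝ → ℂ}, ContDiff ℝ m f → ContDiff ℝ (i.1 + i.2.1 : ℕ) ((spinBoost c)^[i.2.2] f) :=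
    fun h => contDiff_iterate (smooth_spinBoost c) (by omega) h
  have s2 : ∀ {f : ℝ × ℝ → ℂ}, ContDiff ℝ m f →
      ContDiff ℝ i.1 (dx^[i.2.1] ((spinBoost c)^[i.2.2] f)) :=
    fun h => contDiff_iterate (smooth_dirDeriv _ 0) (by omega) (s1 h)
  have le1 : ((i.2.2 : ℕ) : WithTop ℕ∞) ≤ m := by exact_mod_cast (by omega)
  have le2 : ((i.2.1 : ℕ) : WithTop ℕ∞) ≤ (i.1 + i.2.1 : ℕ) := by exact_mod_cast (by omega)
  unfold jet
  rw [iterate_lin isSpinDerivation_spinBoost smooth_spinBoost c a (hf.of_le le1) (hg.of_le le1)]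
  rw [dx_eq, iterate_lin (isSpinDerivation_dirDeriv (0, 1)) (smooth_dirDeriv _) 0 a
    ((s1 hf).of_le le2) ((s1 hg).of_le le2)]
  rw [dt_eq]
  exact iterate_lin (isSpinDerivation_dirDeriv (1, 0)) (smooth_dirDeriv _) 0 a (s2 hf) (s2 hg)

lemma jet_conj (c : ℝ) (i : ℕ × ℕ × ℕ) {m : ℕ} (hm : i.1 + i.2.1 + i.2.2 ≤ m) {f : ℝ × ℝ → ℂ}
    (hf : ContDiff ℝ m f) : jet c i (fun p => conj (f p)) = fun p => conj (jet c i f p) := by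
  have s1 : ContDiff ℝ (i.1 + i.2.1 : ℕ) ((spinBoost c)^[i.2.2] f) :=
    contDiff_iterate (smooth_spinBoost c) (by omega) hf
  have s2 : ContDiff ℝ i.1 (dx^[i.2.1] ((spinBoost c)^[i.2.2] f)) :=
    contDiff_iterate (smooth_dirDeriv _ 0) (by omega) s1
  have le1 : ((i.2.2 : ℕ) : WithTop ℕ∞) ≤ m := by exact_mod_cast (by omega)
  have le2 : ((i.2.1 : ℕ) : WithTop ℕ∞) ≤ (i.1 + i.2.1 : ℕ) := by exact_mod_cast (by omega)
  unfold jet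
  rw [iterate_conj isSpinDerivation_spinBoost smooth_spinBoost c (hf.of_le le1)]
  rw [dx_eq, iterate_conj (isSpinDerivation_dirDeriv (0, 1)) (smooth_dirDeriv _) 0 (s1.of_le le2)]
  rw [dt_eq]
  exact iterate_conj (isSpinDerivation_dirDeriv (1, 0)) (smooth_dirDeriv _) 0 s2

/-- The total order of a multi-index `(a, b, k)`. -/
abbrev deg (i : ℕ × ℕ × ℕ) : ℕ := i.1 + i.2.1 + i.2.2

/-- `jet` satisfies the Leibniz rule for triple products with the splittings in `L`. -/
def HasLeibniz (i : ℕ × ℕ × ℕ) (L : List ((ℕ × ℕ × ℕ) × (ℕ × ℕ × ℕ) × (ℕ × ℕ × ℕ))) : Prop :=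
  (∀ e ∈ L, e.1 + e.2.1 + e.2.2 = i) ∧ ∀ (c₁ c₂ c₃ : ℝ) (f g h : ℝ × ℝ → ℂ) (m : ℕ),
    ContDiff ℝ m f → ContDiff ℝ m g → ContDiff ℝ m h → deg i ≤ m →
    jet (c₁ + c₂ + c₃) i (fun p => f p * g p * h p) = fun p =>
      (L.map fun e => jet c₁ e.1 f p * jet c₂ e.2.1 g p * jet c₃ e.2.2 h p).sum

/-- One more operator falls on one of the three factors. That it raises the multi-index by `d` is
only asked for parts `j` of `i`: a boost does so only when no `∂_t` or `∂_x` stands in front of it.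
-/
lemma hasLeibniz_step {op : ℝ → (ℝ × ℝ → ℂ) → ℝ × ℝ → ℂ} (D : IsSpinDerivation op)
    {i d : ℕ × ℕ × ℕ} (hd : deg (i + d) = deg i + 1)
    (hbump : ∀ j r, j + r = i → ∀ (c : ℝ) (m : ℕ) (φ : ℝ × ℝ → ℂ), ContDiff ℝ m φ → deg j + 1 ≤ m →
      op c (jet c j φ) = jet c (j + d) φ) {L} (hL : HasLeibniz i L) :
    ∃ L', HasLeibniz (i + d) L' := by
  refine ⟨L.flatMap fun e => [(e.1 + d, e.2.1, e.2.2), (e.1, e.2.1 + d, e.2.2), (e.1, e.2.1, e.2.2 + d)],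
    ?_, ?_⟩
  · intro e he
    rw [List.mem_flatMap] at he
    obtain ⟨e', he', hmem⟩ := he
    rw [← hL.1 e' he']
    simp only [List.mem_cons, List.not_mem_nil, or_false] at hmem
    rcases hmem with rfl | rfl | rfl <;> simp only <;> abel
  · intro c₁ c₂ c₃ f g h m hf hg hh hm
    have prod_smooth : ContDiff ℝ m fun p => f p * g p * h p := (hf.mul hg).mul hh
    rw [← hbump i 0 (by simp) _ m _ prod_smooth (by omega), hL.2 c₁ c₂ c₃ f g h m hf hg hh (by omega)]
    have split : ∀ e ∈ L, (∃ r, e.1 + r = i) ∧ (∃ r, e.2.1 + r = i) ∧ (∃ r, e.2.2 + r = i) ∧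
        deg e.1 ≤ deg i ∧ deg e.2.1 ≤ deg i ∧ deg e.2.2 ≤ deg i := by
      intro e he
      have h1 := hL.1 e he
      refine ⟨⟨e.2.1 + e.2.2, by rw [← h1]; abel⟩, ⟨e.1 + e.2.2, by rw [← h1]; abel⟩,
        ⟨e.1 + e.2.1, by rw [← h1]; abel⟩, ?_, ?_, ?_⟩ <;> rw [← h1] <;> simp [deg] <;> omega
    have dj : ∀ (c : ℝ) j (φ : ℝ × ℝ → ℂ), ContDiff ℝ m φ → deg j ≤ deg i →
        Differentiable ℝ (jet c j φ) := fun c j φ hφ hj =>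
      differentiable_jet hφ c j (by simp only [deg] at *; omega)
    rw [D.list_sum _ L fun e => fun p => jet c₁ e.1 f p * jet c₂ e.2.1 g p * jet c₃ e.2.2 h p]
    · funext p
      have : ∀ e ∈ L, op (c₁ + c₂ + c₃)
          (fun p => jet c₁ e.1 f p * jet c₂ e.2.1 g p * jet c₃ e.2.2 h p) p =
          (jet c₁ (e.1 + d) f p * jet c₂ e.2.1 g p * jet c₃ e.2.2 h p +
          (jet c₁ e.1 f p * jet c₂ (e.2.1 + d) g p * jet c₃ e.2.2 h p +
          jet c₁ e.1 f p * jet c₂ e.2.1 g p * jet c₃ (e.2.2 + d) h p)) := by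
        intro e he
        obtain ⟨⟨r1, h1⟩, ⟨r2, h2⟩, ⟨r3, h3⟩, o1, o2, o3⟩ := split e he
        have d1 := dj c₁ e.1 f hf o1
        have d2 := dj c₂ e.2.1 g hg o2
        have d3 := dj c₃ e.2.2 h hh o3
        rw [D.mul (c₁ + c₂) c₃ (fun p => jet c₁ e.1 f p * jet c₂ e.2.1 g p) _ (d1.mul d2) d3,
          D.mul c₁ c₂ _ _ d1 d2, hbump _ _ h1 c₁ m f hf (by omega), hbump _ _ h2 c₂ m g hg (by omega),
          hbump _ _ h3 c₃ m h hh (by omega)]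
        ring
      rw [List.map_congr_left this]
      clear this split hL
      induction L with
      | nil => simp
      | cons a L ih =>
        simp only [List.map_cons, List.sum_cons, List.flatMap_cons, List.map_append, List.sum_append,
          List.map_nil, List.sum_nil, add_zero] at ih ⊢
        rw [ih]
    · intro e he
      obtain ⟨-, -, -, o1, o2, o3⟩ := split e he
      exact ((dj c₁ e.1 f hf o1).mul (dj c₂ e.2.1 g hg o2)).mul (dj c₃ e.2.2 h hh o3)

lemma exists_hasLeibniz (i : ℕ × ℕ × ℕ) : ∃ L, HasLeibniz i L := by
  obtain ⟨a, b, k⟩ := i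
  induction a with
  | zero =>
    induction b with
    | zero =>
      induction k with
      | zero => exact ⟨[((0, 0, 0), (0, 0, 0), (0, 0, 0))], by simp, fun _ _ _ _ _ _ _ _ _ _ _ => by
          simp [jet]⟩
      | succ k ih =>
        obtain ⟨L, hL⟩ := ih
        refine hasLeibniz_step isSpinDerivation_spinBoost (i := (0, 0, k)) (d := (0, 0, 1)) (by simp [deg])
          (fun j r hj c m φ _ _ => ?_) hL
        obtain ⟨j1, j2, j3⟩ := j
        obtain ⟨r1, r2, r3⟩ := r
        simp only [Prod.mk_add_mk, Prod.mk.injEq] at hj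
        obtain rfl : j1 = 0 := by omega
        obtain rfl : j2 = 0 := by omega
        simp only [jet, Prod.mk_add_mk, Function.iterate_succ_apply', add_zero, Function.iterate_zero, id]
    | succ b ih =>
      obtain ⟨L, hL⟩ := ih
      refine hasLeibniz_step (isSpinDerivation_dirDeriv (0, 1)) (i := (0, b, k)) (d := (0, 1, 0))
        (by simp [deg]; omega) (fun j r _ c m φ hφ hm => ?_) hL
      rw [← dx_eq, dx_jet hφ c j hm]
      rfl
  | succ a ih =>
    obtain ⟨L, hL⟩ := ih
    refine hasLeibniz_step (isSpinDerivation_dirDeriv (1, 0)) (i := (a, b, k)) (d := (1, 0, 0))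
      (by simp [deg]; omega) (fun j r _ c m φ hφ hm => ?_) hL
    rw [← dt_eq, dt_jet c j]
    rfl

/-- `jet c i` is the combination of the `jet c'` given by `L`, which lowers only the number of
boosts. -/
def HasExpansion (c c' : ℝ) (i : ℕ × ℕ × ℕ) (L : List (ℂ × ℕ)) : Prop :=
  (∀ e ∈ L, e.2 ≤ i.2.2) ∧ ∀ (φ : ℝ × ℝ → ℂ) (m : ℕ), ContDiff ℝ m φ → deg i ≤ m →
    jet c i φ = fun p => (L.map fun e => e.1 * jet c' (i.1, i.2.1, e.2) φ p).sum

/-- Expand the powers of `Z + c = (Z + c') + (c - c')`; the outer constant-coefficient derivatives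
act termwise. -/
lemma exists_hasExpansion (c c' : ℝ) (i : ℕ × ℕ × ℕ) : ∃ L, HasExpansion c c' i L := by
  obtain ⟨a, b, k⟩ := i
  induction a with
  | zero =>
    induction b with
    | zero =>
      induction k with
      | zero => exact ⟨[(1, 0)], by simp, fun _ _ _ _ => by simp [jet]⟩
      | succ k ih =>
        obtain ⟨L, hL⟩ := ih
        refine ⟨L.flatMap fun e => [(e.1, e.2 + 1), (((c - c' : ℝ) : ℂ) * e.1, e.2)], ?_, ?_⟩
        · intro e he
          rw [List.mem_flatMap] at he
          obtain ⟨e', he', hmem⟩ := he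
          have := hL.1 e' he'
          simp only [List.mem_cons, List.not_mem_nil, or_false] at hmem this
          rcases hmem with rfl | rfl <;> simp only <;> omega
        · intro φ m hφ hm
          simp only [deg] at hm
          have e1 : jet c (0, 0, k + 1) φ = spinBoost c (jet c (0, 0, k) φ) := by
            simp only [jet, Function.iterate_succ_apply', Function.iterate_zero, id]
          have dj : ∀ e ∈ L, Differentiable ℝ fun p => e.1 * jet c' (0, 0, e.2) φ p := fun e he =>
            (differentiable_jet hφ c' (0, 0, e.2) (by have := hL.1 e he; simp only at *; omega)).const_mul _
          rw [e1, hL.2 φ m hφ (by simp only [deg]; omega), isSpinDerivation_spinBoost.list_sum c L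
            (fun e => fun p => e.1 * jet c' (0, 0, e.2) φ p) dj]
          funext p
          have : ∀ e ∈ L, spinBoost c (fun p => e.1 * jet c' (0, 0, e.2) φ p) p =
              e.1 * jet c' (0, 0, e.2 + 1) φ p + ((c - c' : ℝ) : ℂ) * e.1 * jet c' (0, 0, e.2) φ p := by
            intro e he
            rw [isSpinDerivation_spinBoost.const_mul c e.1 _
              (differentiable_jet hφ c' (0, 0, e.2) (by have := hL.1 e he; simp only at *; omega))]
            have e2 : jet c' (0, 0, e.2 + 1) φ = spinBoost c' (jet c' (0, 0, e.2) φ) := by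
              simp only [jet, Function.iterate_succ_apply', Function.iterate_zero, id]
            rw [e2]
            unfold spinBoost
            push_cast
            ring
          rw [List.map_congr_left this]
          clear this hL dj
          induction L with
          | nil => simp
          | cons a L ih =>
            simp only [List.map_cons, List.sum_cons, List.flatMap_cons, List.map_append, List.sum_append,
              List.map_nil, List.sum_nil, add_zero] at ih ⊢
            rw [ih]
    | succ b ih =>
      obtain ⟨L, hL⟩ := ih
      refine ⟨L, hL.1, fun φ m hφ hm => ?_⟩
      simp only [deg] at hm
      have := dx_jet hφ c (0, b, k) (by simp only; omega)
      rw [← this, hL.2 φ m hφ (by simp only [deg]; omega), dx_eq]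
      rw [(isSpinDerivation_dirDeriv (0, 1)).list_sum 0 L
        (fun e => fun p => e.1 * jet c' (0, b, e.2) φ p) fun e he =>
          (differentiable_jet hφ c' (0, b, e.2) (by have := hL.1 e he; simp only at *; omega)).const_mul _]
      funext p
      refine congrArg List.sum (List.map_congr_left fun e he => ?_)
      have hk := hL.1 e he
      simp only at hk
      rw [(isSpinDerivation_dirDeriv (0, 1)).const_mul 0 e.1 _
        (differentiable_jet hφ c' (0, b, e.2) (by simp only at *; omega)), ← dx_eq,
        dx_jet hφ c' (0, b, e.2) (by simp only at *; omega)]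
  | succ a ih =>
    obtain ⟨L, hL⟩ := ih
    refine ⟨L, hL.1, fun φ m hφ hm => ?_⟩
    simp only [deg] at hm
    have := dt_jet c (a, b, k) φ
    rw [← this, hL.2 φ m hφ (by simp only [deg]; omega), dt_eq]
    rw [(isSpinDerivation_dirDeriv (1, 0)).list_sum 0 L
      (fun e => fun p => e.1 * jet c' (a, b, e.2) φ p) fun e he =>
        (differentiable_jet hφ c' (a, b, e.2) (by have := hL.1 e he; simp only at *; omega)).const_mul _]
    funext p
    refine congrArg List.sum (List.map_congr_left fun e he => ?_)
    have hk := hL.1 e he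
    simp only at hk
    rw [(isSpinDerivation_dirDeriv (1, 0)).const_mul 0 e.1 _
      (differentiable_jet hφ c' (a, b, e.2) (by simp only at *; omega)), ← dt_eq,
      dt_jet c' (a, b, e.2)]

end Thirring
end

/-! ### The differentiated Dirac equation up to the top order. -/

noncomputable section
namespace Thirring
open MeasureTheory Set ComplexConjugate Filter Topology

lemma hasDerivAt_comp_line {φ : ℝ × ℝ → ℂ} {p : ℝ × ℝ} (ξ : ℝ × ℝ) (τ : ℝ)
    (h : DifferentiableAt ℝ φ (p + τ • ξ)) :
    HasDerivAt (fun τ : ℝ => φ (p + τ • ξ)) (dirDeriv ξ φ (p + τ • ξ)) τ := by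
  have h1 : HasDerivAt (fun τ : ℝ => p + τ • ξ) ξ τ := by
    simpa using ((hasDerivAt_id τ).smul_const ξ).const_add p
  exact h.hasFDerivAt.comp_hasDerivAt τ h1

/-- Equality of mixed derivatives when only one of the two iterated derivatives is known to exist. -/
lemma hasDerivAt_dirDeriv_line {O : Set (ℝ × ℝ)} (hO : IsOpen O) {φ H : ℝ × ℝ → ℂ} {e ξ : ℝ × ℝ}
    (hφ : Differentiable ℝ φ) (hH : ContDiff ℝ 1 H) (h : EqOn (dirDeriv ξ φ) H O) {p : ℝ × ℝ}
    (hp : p ∈ O) :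
    HasDerivAt (fun τ : ℝ => dirDeriv e φ (p + τ • ξ)) (dirDeriv e H p) 0 := by
  have c1 : Tendsto (fun n : ℝ × ℝ => p + n.2 • ξ + n.1 • e) (𝓝[≠] 0 ×ˢ 𝓝 0) (𝓝 p) := by
    have : Continuous fun n : ℝ × ℝ => p + n.2 • ξ + n.1 • e := by fun_prop
    have h0 := this.tendsto (0, 0)
    simp only [zero_smul, add_zero, nhds_prod_eq] at h0
    exact h0.mono_left (prod_mono nhdsWithin_le_nhds le_rfl)
  have c2 : Tendsto (fun n : ℝ × ℝ => p + n.2 • ξ) (𝓝[≠] 0 ×ˢ 𝓝 0) (𝓝 p) := by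
    have : Continuous fun n : ℝ × ℝ => p + n.2 • ξ := by fun_prop
    have h0 := this.tendsto (0, 0)
    simp only [zero_smul, add_zero, nhds_prod_eq] at h0
    exact h0.mono_left (prod_mono nhdsWithin_le_nhds le_rfl)
  have hne : ∀ᶠ n : ℝ × ℝ in 𝓝[≠] 0 ×ˢ 𝓝 0, n.1 ≠ 0 :=
    tendsto_fst.eventually (eventually_mem_nhdsWithin (a := (0 : ℝ)) (s := {0}ᶜ))
  -- The derivative along `e` is a limit of difference quotients, whose derivatives along `ξ` are
  -- difference quotients of `H`. These converge uniformly near `τ = 0` because `H` is strictly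
  -- differentiable, so limit and derivative may be exchanged.
  refine hasDerivAt_of_tendstoUniformlyOnFilter (l := 𝓝[≠] (0 : ℝ))
    (f := fun σ τ => (σ : ℝ)⁻¹ • (φ (p + τ • ξ + σ • e) - φ (p + τ • ξ)))
    (f' := fun σ τ => (σ : ℝ)⁻¹ • (H (p + τ • ξ + σ • e) - H (p + τ • ξ)))
    (g' := fun _ => dirDeriv e H p) ?_ ?_ ?_
  · rw [← tendsto_prod_filter_iff]
    have hs : HasStrictFDerivAt H (fderiv ℝ H p) p := hH.contDiffAt.hasStrictFDerivAt (by simp)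
    have h1 := hs.isLittleO.comp_tendsto (c1.prodMk_nhds c2)
    have h2 : (fun n : ℝ × ℝ => H (p + n.2 • ξ + n.1 • e) - H (p + n.2 • ξ) - n.1 • dirDeriv e H p)
        =o[𝓝[≠] 0 ×ˢ 𝓝 0] fun n => n.1 := by
      refine Asymptotics.IsLittleO.trans_isBigO (g := fun n : ℝ × ℝ => n.1 • e) ?_
        (Asymptotics.IsBigO.of_bound ‖e‖ (Eventually.of_forall fun n => by
          rw [norm_smul, mul_comm]))
      refine h1.congr' (Eventually.of_forall fun n => ?_) (Eventually.of_forall fun n => ?_)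
      · simp [dirDeriv]
      · simp
    have h3 := h2.tendsto_inv_smul_nhds_zero
    have h4 := h3.add_const (dirDeriv e H p)
    rw [zero_add] at h4
    refine h4.congr' ?_
    filter_upwards [hne] with n hn
    simp only [Function.HasUncurry.uncurry, id]
    rw [smul_sub _ _ (n.1 • _), smul_smul, inv_mul_cancel₀ hn, one_smul, sub_add_cancel]
  · filter_upwards [c1.eventually (hO.mem_nhds hp), c2.eventually (hO.mem_nhds hp)] with n h1 h2
    have e1 := hasDerivAt_comp_line (φ := φ) (p := p + n.1 • e) ξ n.2 (hφ _)
    have e2 := hasDerivAt_comp_line (φ := φ) (p := p) ξ n.2 (hφ _)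
    have hc : ∀ τ : ℝ, p + n.1 • e + τ • ξ = p + τ • ξ + n.1 • e := fun τ => by abel
    simp only [hc] at e1
    rw [h h1] at e1
    rw [h h2] at e2
    exact (e1.sub e2).const_smul n.1⁻¹
  · refine Eventually.of_forall fun τ => ?_
    have e1 := hasDerivAt_comp_line (φ := φ) (p := p + τ • ξ) e 0 (hφ _)
    have := e1.tendsto_slope_zero
    simpa using this

variable {N : ℕ} {s : ℝ} {f g cub : ℝ × ℝ → ℂ}

/-- The null derivative raises the spin `-s/2` of `f` to `s/2`, and for `g`, with `-s` in place of
`s`, it does the reverse. With these spins the pair of equations is preserved without commutator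
terms. -/
lemma dirDeriv_jet_dirac {m : ℕ} (hs : s ^ 2 = 1) (hf : ContDiff ℝ m f) (hg : ContDiff ℝ m g)
    (hcub : ContDiff ℝ m cub) {O : Set (ℝ × ℝ)} (hO : IsOpen O)
    (h : EqOn (dirDeriv (1, s) f) (fun p => Complex.I * g p + cub p) O) {i : ℕ × ℕ × ℕ}
    (hi : deg i + 1 ≤ m) :
    EqOn (dirDeriv (1, s) (jet (-s / 2) i f))
      (fun p => Complex.I * jet (s / 2) i g p + jet (s / 2) i cub p) O := by
  rw [dirDeriv_jet hs hf _ i hi, show -s / 2 + s = s / 2 by ring,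
    ← jet_lin (s / 2) i (m := m) (by simp only [deg] at hi; omega) Complex.I hg hcub]
  exact jet_congr hO h _ i

/-- When `deg i = m` the jet is merely continuous, so one `∂_t` or `∂_x` is peeled off and
`hasDerivAt_dirDeriv_line` is applied to the rest. If there is none, `i.2.2 < m` leaves a derivative
to spare. -/
lemma hasDerivAt_jet_dirac {m : ℕ} (hs : s ^ 2 = 1) (hf : ContDiff ℝ m f) (hg : ContDiff ℝ m g)
    (hcub : ContDiff ℝ m cub) {O : Set (ℝ × ℝ)} (hO : IsOpen O)
    (h : EqOn (dirDeriv (1, s) f) (fun p => Complex.I * g p + cub p) O) {i : ℕ × ℕ × ℕ}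
    (hi : deg i ≤ m) (hk : i.2.2 < m) {p : ℝ × ℝ} (hp : p ∈ O) :
    HasDerivAt (fun τ : ℝ => jet (-s / 2) i f (p + τ • ((1 : ℝ), s)))
      (Complex.I * jet (s / 2) i g p + jet (s / 2) i cub p) 0 := by
  have lin : ∀ {j e}, deg j + 1 ≤ m → (∀ c (φ : ℝ × ℝ → ℂ), ContDiff ℝ m φ →
      dirDeriv e (jet c j φ) = jet c i φ) → 
      HasDerivAt (fun τ : ℝ => jet (-s / 2) i f (p + τ • ((1 : ℝ), s)))
      (Complex.I * jet (s / 2) i g p + jet (s / 2) i cub p) 0 := by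
    intro j e hj hje
    have sm : ∀ c (φ : ℝ × ℝ → ℂ), ContDiff ℝ m φ → ContDiff ℝ 1 (jet c j φ) := fun c φ h =>
      contDiff_jet (n := 1) h c j (by simp only [deg] at hj; omega)
    have e1 := dirDeriv_jet_dirac hs hf hg hcub hO h hj
    have := hasDerivAt_dirDeriv_line (e := e) hO ((sm _ f hf).differentiable (by simp))
      ((contDiff_const.mul (sm _ g hg)).add (sm _ cub hcub)) e1 hp
    have d : ∀ φ : ℝ × ℝ → ℂ, ContDiff ℝ m φ → Differentiable ℝ (jet (s / 2) j φ) := fun φ h =>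
      (sm _ φ h).differentiable (by simp)
    rw [(isSpinDerivation_dirDeriv e).add 0 _ _ ((d g hg).const_mul _) (d cub hcub),
      (isSpinDerivation_dirDeriv e).const_mul 0 _ _ (d g hg)] at this
    simp only [hje _ f hf, hje _ g hg, hje _ cub hcub] at this
    exact this
  obtain ⟨a, b, k⟩ := i
  simp only [deg] at hi hk lin
  rcases Nat.eq_zero_or_pos a with rfl | ha
  · rcases Nat.eq_zero_or_pos b with rfl | hb
    · have h1 := hasDerivAt_comp_line (φ := jet (-s / 2) (0, 0, k) f) (p := p) (1, s) 0
        (differentiable_jet hf _ (0, 0, k) (by simp only; omega) _)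
      have h2 := dirDeriv_jet_dirac hs hf hg hcub hO h (i := (0, 0, k)) (by simp only [deg]; omega) hp
      rw [zero_smul, add_zero, h2] at h1
      exact h1
    · obtain ⟨b, rfl⟩ := Nat.exists_eq_add_of_lt hb
      refine lin (j := (0, b, k)) (e := (0, 1)) (by simp only; omega) fun c φ hφ => ?_
      rw [← dx_eq, dx_jet hφ c (0, b, k) (by simp only; omega), Nat.zero_add]
  · obtain ⟨a, rfl⟩ := Nat.exists_eq_add_of_lt ha
    refine lin (j := (a, b, k)) (e := (1, 0)) (by simp only; omega) fun c φ hφ => ?_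
    rw [← dt_eq, dt_jet c (a, b, k), Nat.zero_add]

end Thirring
end

/-! ### The Klein-Gordon energy density and the initial data. -/

noncomputable section
namespace Thirring
open MeasureTheory Set ComplexConjugate

lemma norm_list_sum_le {α : Type*} (L : List α) (t : α → ℂ) :
    ‖(L.map t).sum‖ ≤ (L.map fun e => ‖t e‖).sum := by
  induction L with
  | nil => simp
  | cons a L ih =>
    simp only [List.map_cons, List.sum_cons]
    exact (norm_add_le _ _).trans (by gcongr)

lemma exists_list_bound (n : ℕ) (L : List (ℂ × ℕ)) (hL : ∀ e ∈ L, e.2 ≤ n) :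
    ∃ C : ℝ, 0 ≤ C ∧ ∀ ψ : ℕ → ℂ,
      ‖(L.map fun e => e.1 * ψ e.2).sum‖ ^ 2 ≤ C * ∑ k ∈ Finset.range (n + 1), ‖ψ k‖ ^ 2 := by
  refine ⟨(L.map fun e => ‖e.1‖).sum ^ 2, sq_nonneg _, fun ψ => ?_⟩
  set S := ∑ k ∈ Finset.range (n + 1), ‖ψ k‖ ^ 2
  have hS : 0 ≤ S := by positivity
  have hk : ∀ k ≤ n, ‖ψ k‖ ≤ √S := fun k hk => Real.le_sqrt_of_sq_le
    (Finset.single_le_sum (f := fun k => ‖ψ k‖ ^ 2) (fun _ _ => by positivity)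
      (Finset.mem_range.2 (by omega)))
  have h1 : ‖(L.map fun e => e.1 * ψ e.2).sum‖ ≤ (L.map fun e => ‖e.1‖).sum * √S := by
    refine (norm_list_sum_le L _).trans ?_
    clear hS
    induction L with
    | nil => simp
    | cons a L ih =>
      simp only [List.map_cons, List.sum_cons, add_mul]
      refine add_le_add ?_ (ih fun e he => hL e (by simp [he]))
      rw [norm_mul]
      exact mul_le_mul_of_nonneg_left (hk _ (hL a (by simp))) (norm_nonneg _)
  calc _ ≤ ((L.map fun e => ‖e.1‖).sum * √S) ^ 2 := by gcongr
    _ = _ := by rw [mul_pow, Real.sq_sqrt hS]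

/-- Changing the spin costs only terms with fewer boosts. -/
lemma exists_jet_bound (c c' : ℝ) (i : ℕ × ℕ × ℕ) : ∃ C : ℝ, 0 ≤ C ∧
    ∀ (φ : ℝ × ℝ → ℂ) (m : ℕ), ContDiff ℝ m φ →
      (deg i ≤ m → ∀ p, ‖jet c i φ p‖ ^ 2 ≤
        C * ∑ k ∈ Finset.range (i.2.2 + 1), ‖jet c' (i.1, i.2.1, k) φ p‖ ^ 2) ∧
      (deg i + 1 ≤ m → ∀ e p, ‖dirDeriv e (jet c i φ) p‖ ^ 2 ≤
        C * ∑ k ∈ Finset.range (i.2.2 + 1), ‖dirDeriv e (jet c' (i.1, i.2.1, k) φ) p‖ ^ 2) := by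
  obtain ⟨L, hL⟩ := exists_hasExpansion c c' i
  obtain ⟨C, hC, hb⟩ := exists_list_bound i.2.2 L hL.1
  refine ⟨C, hC, fun φ m hφ => ⟨fun hm p => ?_, fun hm e p => ?_⟩⟩
  · rw [hL.2 φ m hφ hm]
    exact hb fun k => jet c' (i.1, i.2.1, k) φ p
  · have dj : ∀ f ∈ L, Differentiable ℝ (jet c' (i.1, i.2.1, f.2) φ) := fun f hf =>
      differentiable_jet hφ c' _ (by have := hL.1 f hf; simp only [deg] at *; omega)
    rw [hL.2 φ m hφ (by omega), (isSpinDerivation_dirDeriv e).list_sum 0 L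
      (fun f => fun p => f.1 * jet c' (i.1, i.2.1, f.2) φ p) fun f hf => (dj f hf).const_mul _]
    have : ∀ f ∈ L, dirDeriv e (fun p => f.1 * jet c' (i.1, i.2.1, f.2) φ p) p =
        f.1 * dirDeriv e (jet c' (i.1, i.2.1, f.2) φ) p := fun f hf => by
      rw [(isSpinDerivation_dirDeriv e).const_mul 0 f.1 _ (dj f hf)]
    simp only
    rw [List.map_congr_left this]
    exact hb fun k => dirDeriv e (jet c' (i.1, i.2.1, k) φ) p

/-- The space component of the vector `n` on the exterior boundary. -/
def slope (T x : ℝ) : ℝ := if T ≤ bracket x then 0 else x / bracket x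

/-- The Klein-Gordon energy density with respect to the vector `∂_t + τ ∂_x`. -/
def energyDensity (τ : ℝ) (φ : ℝ × ℝ → ℂ) (p : ℝ × ℝ) : ℝ :=
  (‖dt φ p‖ ^ 2 + ‖dx φ p‖ ^ 2 + ‖φ p‖ ^ 2) / 2 + τ * (conj (dx φ p) * dt φ p).re

lemma sum_normal_emTensor (T x : ℝ) (φ : ℝ × ℝ → ℂ) (p : ℝ × ℝ) :
    ∑ α, normal T x α * emTensor φ α 0 p = energyDensity (slope T x) φ p := by
  have h0 : emTensor φ 0 0 p = (‖dt φ p‖ ^ 2 + ‖dx φ p‖ ^ 2 + ‖φ p‖ ^ 2) / 2 := by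
    have e1 : ∀ w : ℂ, conj w * w = ((‖w‖ ^ 2 : ℝ) : ℂ) := fun w => by
      rw [Complex.conj_mul']; norm_cast
    simp only [emTensor, metric, pd, Fin.sum_univ_two, Complex.star_def, Matrix.diagonal_apply]
    simp only [Fin.isValue, Matrix.cons_val_zero, Matrix.cons_val_one, zero_ne_one, one_ne_zero,
      if_true, if_false, e1, mul_assoc]
    have : ((‖φ p‖ : ℂ)) ^ 2 = ((‖φ p‖ ^ 2 : ℝ) : ℂ) := by norm_cast
    rw [this]
    have h2 : (1 / 2 : ℂ) = ((1 / 2 : ℝ) : ℂ) := by norm_num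
    rw [h2]
    refine (congrArg Complex.re (a₂ := (((‖dt φ p‖ ^ 2 + ‖dx φ p‖ ^ 2 + ‖φ p‖ ^ 2) / 2 : ℝ) : ℂ))
      ?_).trans (Complex.ofReal_re _)
    push_cast
    ring
  have h1 : emTensor φ 1 0 p = (conj (dx φ p) * dt φ p).re := by
    simp [emTensor, metric, pd, Matrix.diagonal_apply]
  rw [Fin.sum_univ_two, h0, h1]
  unfold normal slope energyDensity
  split_ifs <;> simp

lemma extEnergy_eq (T : ℝ) (φ : ℝ × ℝ → ℂ) (f : ℝ × ℝ → ℝ) :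
    extEnergy T φ f =
      (∫⁻ x, ENNReal.ofReal (energyDensity (slope T x) φ (surf T x) * f (surf T x))) ^ (1 / 2 : ℝ) := by
  simp only [extEnergy, sum_normal_emTensor]

lemma bracket_pos (x : ℝ) : 0 < bracket x := Real.sqrt_pos.2 (by positivity)

lemma one_le_bracket (x : ℝ) : 1 ≤ bracket x := by
  unfold bracket; rw [Real.one_le_sqrt]; nlinarith [sq_nonneg x]

lemma bracket_sq (x : ℝ) : bracket x ^ 2 = 1 + x ^ 2 := Real.sq_sqrt (by positivity)

lemma surf_one (x : ℝ) : surf 1 x = (1, x) := by rw [surf, min_eq_left (one_le_bracket x)]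

lemma slope_one (x : ℝ) : slope 1 x = 0 := if_pos (one_le_bracket x)

lemma rpow_half_le {a : ℝ≥0∞} {η : ℝ} (hη : 0 ≤ η) :
    a ^ (1 / 2 : ℝ) ≤ ENNReal.ofReal η ↔ a ≤ ENNReal.ofReal (η ^ 2) := by
  have : (ENNReal.ofReal η) = (ENNReal.ofReal (η ^ 2)) ^ (1 / 2 : ℝ) := by
    rw [ENNReal.ofReal_rpow_of_nonneg (by positivity) (by norm_num), ← Real.sqrt_eq_rpow,
      Real.sqrt_sq hη]
  rw [this, ENNReal.rpow_le_rpow_iff (by norm_num)]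

lemma extEnergy_le_total {N : ℕ} (u v : ℝ × ℝ → ℂ) (T : ℝ) {I : ℕ × ℕ} {k : ℕ} (hI : I.1 + I.2 ≤ N)
    (hk : k ≤ 3) :
    extEnergy T (vf I k u) (weight N (I.1 + I.2)) + extEnergy T (vf I k v) (weight N (I.1 + I.2)) ≤
      totalExtEnergy N u v T := by
  unfold totalExtEnergy
  refine le_trans ?_ (Finset.single_le_sum (fun _ _ => zero_le)
    (Finset.mem_range.2 (show I.1 + I.2 < N + 1 by omega)))
  refine le_trans ?_ (Finset.single_le_sum (fun _ _ => zero_le)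
    (Finset.HasAntidiagonal.mem_antidiagonal.2 (show I.1 + I.2 = I.1 + I.2 from rfl)))
  exact Finset.single_le_sum (f := fun k => extEnergy T (vf I k u) (weight N (I.1 + I.2)) +
    extEnergy T (vf I k v) (weight N (I.1 + I.2))) (fun _ _ => zero_le)
    (Finset.mem_range.2 (show k < 4 by omega))

lemma integral_le_of_lintegral_le {g h : ℝ → ℝ} (hg : Continuous g) {R A : ℝ} (hR : 0 ≤ R)
    (hA : 0 ≤ A) (hgh : ∀ x, 0 ≤ x → 0 ≤ g x ∧ g x ≤ h x)
    (hh : ∫⁻ x, ENNReal.ofReal (h x) ≤ ENNReal.ofReal A) : ∫ x in (0 : ℝ)..R, g x ≤ A := by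
  rw [intervalIntegral.integral_of_le hR]
  have hi : IntegrableOn g (Ioc 0 R) := (hg.intervalIntegrable 0 R).1
  have hnn : 0 ≤ᵐ[volume.restrict (Ioc 0 R)] g :=
    (ae_restrict_mem measurableSet_Ioc).mono fun x hx => (hgh x hx.1.le).1
  rw [← ENNReal.ofReal_le_ofReal_iff hA, ofReal_integral_eq_lintegral_ofReal hi hnn]
  refine le_trans (le_trans (lintegral_mono_ae ((ae_restrict_mem measurableSet_Ioc).mono
    fun x hx => ENNReal.ofReal_le_ofReal (hgh x hx.1.le).2)) (setLIntegral_le_lintegral _ _)) hh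

/-- On `t = 1` the weight is `(1 + x)^(N-j) x^j`, which decreases in `j`; data of low order are
therefore bounded with every higher index too. -/
lemma weight_data_anti {N j j' : ℕ} (hj : j' ≤ j) (hjN : j ≤ N) {x : ℝ} (hx : 0 ≤ x) :
    0 ≤ nullWeight N j (x - 1) (x + 1) ∧ nullWeight N j (x - 1) (x + 1) ≤ weight N j' (1, x) := by
  unfold nullWeight weight
  simp only [abs_of_nonneg hx, add_sub_cancel, sub_add_cancel]
  refine ⟨by positivity, ?_⟩
  obtain ⟨d, rfl⟩ := Nat.exists_eq_add_of_le hj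
  have e : N - j' = (N - (j' + d)) + d := by omega
  rw [e, pow_add, pow_add, mul_assoc, add_comm 1 x, mul_comm (x ^ j')]
  gcongr
  linarith

lemma dirDeriv_le_energy {φ : ℝ × ℝ → ℂ} {p : ℝ × ℝ} :
    ‖φ p‖ ^ 2 ≤ 2 * energyDensity 0 φ p ∧ ‖dt φ p‖ ^ 2 ≤ 2 * energyDensity 0 φ p ∧
      ‖dx φ p‖ ^ 2 ≤ 2 * energyDensity 0 φ p := by
  unfold energyDensity
  refine ⟨?_, ?_, ?_⟩ <;> nlinarith [sq_nonneg ‖φ p‖, sq_nonneg ‖dt φ p‖, sq_nonneg ‖dx φ p‖]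

/-- The initial energy controls the initial data of all vector field derivatives. -/
lemma data_jet_zero_le {N m : ℕ} {φ : ℝ × ℝ → ℂ} (hφ : ContDiff ℝ m φ) (hm : N + 4 ≤ m) {η : ℝ}
    (hη : 0 ≤ η) (hE : ∀ I : ℕ × ℕ, ∀ k, I.1 + I.2 ≤ N → k ≤ 3 →
      extEnergy 1 (vf I k φ) (weight N (I.1 + I.2)) ≤ ENNReal.ofReal η)
    {i : ℕ × ℕ × ℕ} (hi : i.1 + i.2.1 ≤ N + 1) (hk : i.2.2 ≤ 3) {j : ℕ} (hj : j ≤ N)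
    (hij : i.1 + i.2.1 ≤ j + 1) {R : ℝ} (hR : 0 ≤ R) :
    ∫ x in (0 : ℝ)..R, ‖jet 0 i φ (1, x)‖ ^ 2 * nullWeight N j (x - 1) (x + 1) ≤ 2 * η ^ 2 := by
  have hc : Continuous (jet 0 i φ) := (contDiff_jet (n := 0) hφ 0 i (by omega)).continuous
  have hg : Continuous fun x : ℝ => ‖jet 0 i φ (1, x)‖ ^ 2 * nullWeight N j (x - 1) (x + 1) := by
    unfold nullWeight; fun_prop
  -- The outermost derivative, if any, is stripped off: the jet is then a first derivative inside
  -- the energy density of a multi-index of order at most `j`.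
  have key : ∃ I : ℕ × ℕ, I.1 + I.2 ≤ j ∧
      ∀ p, ‖jet 0 i φ p‖ ^ 2 ≤ 2 * energyDensity 0 (vf I i.2.2 φ) p := by
    obtain ⟨a, b, k⟩ := i
    simp only at hi hk hij ⊢
    rcases Nat.eq_zero_or_pos a with rfl | ha
    · rcases Nat.eq_zero_or_pos b with rfl | hb
      · exact ⟨(0, 0), by simp, fun p => by rw [vf_eq_jet]; exact dirDeriv_le_energy.1⟩
      · obtain ⟨b, rfl⟩ := Nat.exists_eq_add_of_lt hb
        refine ⟨(0, b), by simp only; omega, fun p => ?_⟩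
        have := dx_jet hφ 0 (0, b, k) (by simp only; omega)
        rw [vf_eq_jet, Nat.zero_add b, ← this]
        exact dirDeriv_le_energy.2.2
    · obtain ⟨a, rfl⟩ := Nat.exists_eq_add_of_lt ha
      refine ⟨(a, b), by simp only; omega, fun p => ?_⟩
      rw [vf_eq_jet, Nat.zero_add a, ← dt_jet 0 (a, b, k)]
      exact dirDeriv_le_energy.2.1
  obtain ⟨I, hI, hp⟩ := key
  have hE' := hE I i.2.2 (by omega) hk
  rw [extEnergy_eq, rpow_half_le hη] at hE'
  simp only [surf_one, slope_one] at hE'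
  have := integral_le_of_lintegral_le (g := fun x =>
    ‖jet 0 i φ (1, x)‖ ^ 2 * nullWeight N j (x - 1) (x + 1) / 2) (hg.div_const 2) hR (sq_nonneg η)
    (fun x hx => ?_) hE'
  · rw [intervalIntegral.integral_div] at this
    linarith
  · obtain ⟨h1, h2⟩ := weight_data_anti hI hj hx
    have h3 := hp (1, x)
    refine ⟨by positivity, ?_⟩
    have h4 : 0 ≤ energyDensity 0 (vf I i.2.2 φ) (1, x) := by
      linarith [sq_nonneg ‖jet 0 i φ (1, x)‖]
    calc _ ≤ 2 * energyDensity 0 (vf I i.2.2 φ) (1, x) * weight N (I.1 + I.2) (1, x) / 2 := by gcongr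
      _ = _ := by ring

lemma exists_data_jet_le (N : ℕ) (c : ℝ) (i : ℕ × ℕ × ℕ) : ∃ C : ℝ, 0 ≤ C ∧
    ∀ {φ : ℝ × ℝ → ℂ} {m : ℕ}, ContDiff ℝ m φ → N + 4 ≤ m → ∀ {η : ℝ}, 0 ≤ η →
    (∀ I : ℕ × ℕ, ∀ k, I.1 + I.2 ≤ N → k ≤ 3 →
      extEnergy 1 (vf I k φ) (weight N (I.1 + I.2)) ≤ ENNReal.ofReal η) →
    i.1 + i.2.1 ≤ N + 1 → i.2.2 ≤ 3 → ∀ j ≤ N, i.1 + i.2.1 ≤ j + 1 → ∀ R, 0 ≤ R →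
    ∫ x in (0 : ℝ)..R, ‖jet c i φ (1, x)‖ ^ 2 * nullWeight N j (x - 1) (x + 1) ≤ C * η ^ 2 := by
  obtain ⟨C, hC, hb⟩ := exists_jet_bound c 0 i
  refine ⟨C * ((i.2.2 + 1 : ℕ) * 2), by positivity, fun {φ m} hφ hm η hη hE hi hk j hj hij R hR => ?_⟩
  have hc : ∀ c k, k ≤ 3 → Continuous (jet c (i.1, i.2.1, k) φ) := fun c k hk =>
    (contDiff_jet (n := 0) hφ c (i.1, i.2.1, k) (by simp only; omega)).continuous
  have hg : ∀ c k, k ≤ 3 → Continuous fun x : ℝ =>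
      ‖jet c (i.1, i.2.1, k) φ (1, x)‖ ^ 2 * nullWeight N j (x - 1) (x + 1) := fun c k hk => by
    have := hc c k hk
    unfold nullWeight; fun_prop
  have hk' : ∀ k ∈ Finset.range (i.2.2 + 1), k ≤ 3 := fun k hk => by
    rw [Finset.mem_range] at hk; omega
  calc _ ≤ ∫ x in (0 : ℝ)..R, C * ∑ k ∈ Finset.range (i.2.2 + 1),
        ‖jet 0 (i.1, i.2.1, k) φ (1, x)‖ ^ 2 * nullWeight N j (x - 1) (x + 1) := by
        refine intervalIntegral.integral_mono_on hR ((hg c i.2.2 hk).intervalIntegrable _ _)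
          ((continuous_const.mul (continuous_finsetSum _ fun k h => hg 0 k (hk' k h))).intervalIntegrable
            _ _) fun x hx => ?_
        have h1 := (hb φ m hφ).1 (by simp only [deg]; omega) (1, x)
        have h2 := (weight_data_anti le_rfl hj hx.1).1
        rw [← Finset.sum_mul, ← mul_assoc]
        gcongr
    _ = C * ∑ k ∈ Finset.range (i.2.2 + 1), ∫ x in (0 : ℝ)..R,
        ‖jet 0 (i.1, i.2.1, k) φ (1, x)‖ ^ 2 * nullWeight N j (x - 1) (x + 1) := by
        rw [intervalIntegral.integral_const_mul, intervalIntegral.integral_finsetSum]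
        exact fun k h => (hg 0 k (hk' k h)).intervalIntegrable _ _
    _ ≤ C * ∑ k ∈ Finset.range (i.2.2 + 1), 2 * η ^ 2 := by
        gcongr with k h
        exact data_jet_zero_le hφ hm hη hE (i := (i.1, i.2.1, k)) hi (hk' k h) hj hij hR
    _ = _ := by
        rw [Finset.sum_const, Finset.card_range, nsmul_eq_mul]
        ring

end Thirring
end

/-! ### Solutions of the Thirring model as instances of the hierarchy. -/

noncomputable section
namespace Thirring
open MeasureTheory Set ComplexConjugate

/-- The point with null coordinates `x - t = y` and `x + t = z`. -/
def pt (y z : ℝ) : ℝ × ℝ := ((z - y) / 2, (z + y) / 2)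

lemma continuous_pt : Continuous (Function.uncurry pt) := by
  unfold pt Function.uncurry; fun_prop

lemma hasDerivAt_pt_left {g : ℝ × ℝ → ℂ} {D : ℂ} {y z : ℝ}
    (h : HasDerivAt (fun τ : ℝ => g (pt y z + τ • ((1 : ℝ), (-1 : ℝ)))) D 0) :
    HasDerivAt (fun y => g (pt y z)) (-D / 2) y := by
  have h1 : HasDerivAt (fun y' : ℝ => -(y' - y) / 2) (-1 / 2) y :=
    (((hasDerivAt_id y).sub_const y).neg).div_const 2
  have h0 : -(y - y) / 2 = 0 := by ring
  rw [← h0] at h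
  have := h.scomp y h1
  refine (this.congr_deriv ?_).congr_of_eventuallyEq (Filter.Eventually.of_forall fun y' => ?_)
  · rw [Complex.real_smul]; push_cast; ring
  · simp only [Function.comp, pt]
    congr 1
    ext <;> simp <;> ring

lemma hasDerivAt_pt_right {g : ℝ × ℝ → ℂ} {D : ℂ} {y z : ℝ}
    (h : HasDerivAt (fun τ : ℝ => g (pt y z + τ • ((1 : ℝ), (1 : ℝ)))) D 0) :
    HasDerivAt (fun z => g (pt y z)) (D / 2) z := by
  have h1 : HasDerivAt (fun z' : ℝ => (z' - z) / 2) (1 / 2) z :=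
    ((hasDerivAt_id z).sub_const z).div_const 2
  have h0 : (z - z) / 2 = 0 := by ring
  rw [← h0] at h
  have := h.scomp z h1
  refine (this.congr_deriv ?_).congr_of_eventuallyEq (Filter.Eventually.of_forall fun z' => ?_)
  · rw [Complex.real_smul]; push_cast; ring
  · simp only [Function.comp, pt]
    congr 1
    ext <;> simp <;> ring

lemma hasDerivAt_pt_data {g : ℝ × ℝ → ℂ} {z : ℝ} (h : Differentiable ℝ g) :
    HasDerivAt (fun z => g (pt (z - 2) z)) (dx g (pt (z - 2) z)) z := by
  have h1 := hasDerivAt_comp_line (φ := g) (p := pt (z - 2) z) (0, 1) (z - z) (h _)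
  have h2 : HasDerivAt (fun z' : ℝ => z' - z) 1 z := (hasDerivAt_id z).sub_const z
  have := HasDerivAt.scomp (h := fun z' : ℝ => z' - z) z h1 h2
  simp only [sub_self, zero_smul, add_zero, one_smul] at this
  refine this.congr_of_eventuallyEq (Filter.Eventually.of_forall fun z' => ?_)
  simp only [Function.comp, pt]
  congr 1
  ext <;> simp
  ring

/-- The multi-indices of the derivatives which enter the energies. -/
def idxSet (N : ℕ) : Finset (ℕ × ℕ × ℕ) :=
  (Finset.range (N + 2) ×ˢ Finset.range (N + 2) ×ˢ Finset.range 4).filter fun i => i.1 + i.2.1 ≤ N + 1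

lemma mem_idxSet {N : ℕ} {i : ℕ × ℕ × ℕ} : i ∈ idxSet N ↔ i.1 + i.2.1 ≤ N + 1 ∧ i.2.2 ≤ 3 := by
  simp only [idxSet, Finset.mem_filter, Finset.mem_product, Finset.mem_range]
  omega

/-- The index type of the derivatives which enter the energies. -/
abbrev JetIdx (N : ℕ) := {i // i ∈ idxSet N}

/-- A multi-index as an element of `JetIdx N`, with a default value out of range. -/
def toIdx (N : ℕ) (i : ℕ × ℕ × ℕ) : JetIdx N :=
  if h : i ∈ idxSet N then ⟨i, h⟩ else ⟨0, mem_idxSet.2 (by simp)⟩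

lemma toIdx_val {N : ℕ} {i : ℕ × ℕ × ℕ} (h1 : i.1 + i.2.1 ≤ N + 1) (h2 : i.2.2 ≤ 3) :
    (toIdx N i).1 = i := by
  unfold toIdx
  rw [dif_pos (mem_idxSet.2 ⟨h1, h2⟩)]

/-- The splittings in the Leibniz rule for triple products. -/
def leibnizList (i : ℕ × ℕ × ℕ) : List ((ℕ × ℕ × ℕ) × (ℕ × ℕ × ℕ) × (ℕ × ℕ × ℕ)) :=
  (exists_hasLeibniz i).choose

lemma hasLeibniz_leibnizList (i : ℕ × ℕ × ℕ) : HasLeibniz i (leibnizList i) :=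
  (exists_hasLeibniz i).choose_spec

/-- The cubic nonlinearity `i |f|² g`. -/
def cubic (f g : ℝ × ℝ → ℂ) : ℝ × ℝ → ℂ := fun p => Complex.I * (f p * conj (f p) * g p)

lemma contDiff_conj {m : ℕ} {f : ℝ × ℝ → ℂ} (hf : ContDiff ℝ m f) :
    ContDiff ℝ m fun p => conj (f p) := Complex.conjCLE.contDiff.comp hf

lemma contDiff_cubic {m : ℕ} {f g : ℝ × ℝ → ℂ} (hf : ContDiff ℝ m f) (hg : ContDiff ℝ m g) :
    ContDiff ℝ m (cubic f g) :=
  contDiff_const.mul ((hf.mul (contDiff_conj hf)).mul hg)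

lemma jet_const_mul (c : ℝ) (i : ℕ × ℕ × ℕ) {m : ℕ} (hm : deg i ≤ m) {f : ℝ × ℝ → ℂ} (a : ℂ)
    (hf : ContDiff ℝ m f) : jet c i (fun p => a * f p) = fun p => a * jet c i f p := by
  -- Linearity is applied to `a f = (a - 1) f + f`.
  have := jet_lin c i hm (a - 1) hf hf
  simpa [sub_mul] using this

lemma norm_jet_cubic_le {c₁ c₂ : ℝ} {i : ℕ × ℕ × ℕ} {m : ℕ} (hm : deg i ≤ m) {f g : ℝ × ℝ → ℂ}
    (hf : ContDiff ℝ m f) (hg : ContDiff ℝ m g) (p : ℝ × ℝ) :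
    ‖jet (c₁ + c₁ + c₂) i (cubic f g) p‖ ≤ ((leibnizList i).map fun e =>
      ‖jet c₁ e.1 f p‖ * ‖jet c₁ e.2.1 f p‖ * ‖jet c₂ e.2.2 g p‖).sum := by
  have hL := hasLeibniz_leibnizList i
  unfold cubic
  rw [jet_const_mul _ i hm Complex.I ((hf.mul (contDiff_conj hf)).mul hg),
    hL.2 c₁ c₁ c₂ _ _ _ m hf (contDiff_conj hf) hg hm, norm_mul, Complex.norm_I, one_mul]
  refine (norm_list_sum_le _ _).trans (le_of_eq ?_)
  refine congrArg List.sum (List.map_congr_left fun e he => ?_)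
  have := hL.1 e he
  rw [jet_conj c₁ e.2.1 (m := m) (by rw [← this] at hm; simp [deg] at *; omega) hf, norm_mul, norm_mul,
    RCLike.norm_conj]

/-- The Leibniz splittings, in terms of the index type. -/
def idxList (N : ℕ) (i : JetIdx N) : List (JetIdx N × JetIdx N × JetIdx N) :=
  (leibnizList i.1).map fun e => (toIdx N e.1, toIdx N e.2.1, toIdx N e.2.2)

/-- The order of differentiation, not counting the boosts. -/
def jetOrd {N : ℕ} (i : JetIdx N) : ℕ := i.1.1 + i.1.2.1

lemma leibniz_split {N : ℕ} {i : JetIdx N} {e} (he : e ∈ leibnizList i.1) :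
    (toIdx N e.1).1 = e.1 ∧ (toIdx N e.2.1).1 = e.2.1 ∧ (toIdx N e.2.2).1 = e.2.2 := by
  have h1 := (hasLeibniz_leibnizList i.1).1 e he
  have h2 := mem_idxSet.1 i.2
  rw [← h1] at h2
  simp only [Prod.fst_add, Prod.snd_add] at h2
  exact ⟨toIdx_val (by omega) (by omega), toIdx_val (by omega) (by omega),
    toIdx_val (by omega) (by omega)⟩

/-- The time derivative, on indices. -/
def idxT {N : ℕ} (i : JetIdx N) : JetIdx N := toIdx N (i.1.1 + 1, i.1.2.1, i.1.2.2)

/-- The space derivative, on indices. -/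
def idxX {N : ℕ} (i : JetIdx N) : JetIdx N := toIdx N (i.1.1, i.1.2.1 + 1, i.1.2.2)

lemma idxT_val {N : ℕ} {i : JetIdx N} (h : jetOrd i ≤ N) :
    (idxT i).1 = (i.1.1 + 1, i.1.2.1, i.1.2.2) :=
  toIdx_val (by simp only [jetOrd] at *; omega) (mem_idxSet.1 i.2).2

lemma idxX_val {N : ℕ} {i : JetIdx N} (h : jetOrd i ≤ N) :
    (idxX i).1 = (i.1.1, i.1.2.1 + 1, i.1.2.2) :=
  toIdx_val (by simp only [jetOrd] at *; omega) (mem_idxSet.1 i.2).2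

/-- The derivatives of `φ` with spin `c`, in null coordinates. -/
def jetField {N : ℕ} (c : ℝ) (φ : ℝ × ℝ → ℂ) (i : JetIdx N) (y z : ℝ) : ℂ := jet c i.1 φ (pt y z)

section field

variable {N : ℕ} {φ : ℝ × ℝ → ℂ} (hφ : ContDiff ℝ (N + 4 : ℕ) φ) (c : ℝ) (i : JetIdx N)
include hφ

lemma continuous_jetField : Continuous (Function.uncurry (jetField c φ i)) := by
  have h := mem_idxSet.1 i.2
  exact (contDiff_jet (n := 0) hφ c i.1 (by omega)).continuous.comp continuous_pt

lemma dirDeriv_one_jet {s : ℝ} (h : jetOrd i ≤ N) (y z : ℝ) :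
    dirDeriv (1, s) (jet c i.1 φ) (pt y z) =
      jetField c φ (idxT i) y z + s * jetField c φ (idxX i) y z := by
  have h' := mem_idxSet.1 i.2
  simp only [jetOrd] at h
  rw [dirDeriv_one_eq, dt_jet, dx_jet hφ c i.1 (by omega), jetField, jetField, idxT_val h, idxX_val h]

lemma hasDerivAt_jetField_left (h : jetOrd i ≤ N) (y z : ℝ) :
    HasDerivAt (fun y => jetField c φ i y z)
      (-(jetField c φ (idxT i) y z - jetField c φ (idxX i) y z) / 2) y := by
  have h' := mem_idxSet.1 i.2
  have hd : Differentiable ℝ (jet c i.1 φ) :=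
    differentiable_jet hφ c i.1 (by simp only [jetOrd] at h; omega)
  have h1 := hasDerivAt_comp_line (φ := jet c i.1 φ) (p := pt y z) (1, -1) 0 (hd _)
  rw [zero_smul, add_zero, dirDeriv_one_jet hφ c i h] at h1
  refine (hasDerivAt_pt_left h1).congr_deriv ?_
  push_cast
  ring

lemma hasDerivAt_jetField_right (h : jetOrd i ≤ N) (y z : ℝ) :
    HasDerivAt (fun z => jetField c φ i y z)
      ((jetField c φ (idxT i) y z + jetField c φ (idxX i) y z) / 2) z := by
  have h' := mem_idxSet.1 i.2
  have hd : Differentiable ℝ (jet c i.1 φ) :=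
    differentiable_jet hφ c i.1 (by simp only [jetOrd] at h; omega)
  have h1 := hasDerivAt_comp_line (φ := jet c i.1 φ) (p := pt y z) (1, 1) 0 (hd _)
  rw [zero_smul, add_zero, dirDeriv_one_jet hφ c i h] at h1
  refine (hasDerivAt_pt_right h1).congr_deriv ?_
  push_cast
  ring

lemma hasDerivAt_jetField_data (h : jetOrd i ≤ N) (z : ℝ) :
    HasDerivAt (fun z => jetField c φ i (z - 2) z) (jetField c φ (idxX i) (z - 2) z) z := by
  have h' := mem_idxSet.1 i.2
  simp only [jetOrd] at h
  have hd : Differentiable ℝ (jet c i.1 φ) := differentiable_jet hφ c i.1 (by omega)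
  have := hasDerivAt_pt_data (z := z) hd
  rw [dx_jet hφ c i.1 (by omega)] at this
  rw [jetField, idxX_val h]
  exact this

end field

lemma exists_data_field_le (N : ℕ) : ∃ C : ℝ, 0 < C ∧
    ∀ {φ : ℝ × ℝ → ℂ}, ContDiff ℝ (N + 4 : ℕ) φ → ∀ {η : ℝ}, 0 ≤ η →
    (∀ I : ℕ × ℕ, ∀ k, I.1 + I.2 ≤ N → k ≤ 3 →
      extEnergy 1 (vf I k φ) (weight N (I.1 + I.2)) ≤ ENNReal.ofReal η) →
    ∀ c ∈ ({1 / 2, -1 / 2} : Set ℝ), ∀ i : JetIdx N, ∀ j ≤ N, jetOrd i ≤ j + 1 → ∀ X, 1 ≤ X →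
    ∫ z in (1 : ℝ)..X, ‖jetField c φ i (z - 2) z‖ ^ 2 * nullWeight N j (z - 2) z ≤ C * η ^ 2 := by
  choose C hC hb using exists_data_jet_le N
  have hle : ∀ i : JetIdx N, C (1 / 2) i.1 + C (-1 / 2) i.1 ≤
      (∑ i : JetIdx N, (C (1 / 2) i.1 + C (-1 / 2) i.1)) + 1 := fun i => by
    have := Finset.single_le_sum (f := fun i : JetIdx N => C (1 / 2) i.1 + C (-1 / 2) i.1)
      (fun i _ => add_nonneg (hC _ _) (hC _ _)) (Finset.mem_univ i)
    linarith
  refine ⟨(∑ i : JetIdx N, (C (1 / 2) i.1 + C (-1 / 2) i.1)) + 1,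
    add_pos_of_nonneg_of_pos (Finset.sum_nonneg fun i _ => add_nonneg (hC _ _) (hC _ _)) one_pos, ?_⟩
  intro φ hφ η hη hE c hc i j hj hij X hX
  have h' := mem_idxSet.1 i.2
  have h1 := hb c i.1 hφ le_rfl hη hE h'.1 h'.2 j hj hij (X - 1) (by linarith)
  have e : (∫ z in (1 : ℝ)..X, ‖jetField c φ i (z - 2) z‖ ^ 2 * nullWeight N j (z - 2) z) =
      ∫ x in (0 : ℝ)..(X - 1), ‖jet c i.1 φ (1, x)‖ ^ 2 * nullWeight N j (x - 1) (x + 1) := by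
    have := intervalIntegral.integral_comp_sub_right (a := 1) (b := X)
      (fun x => ‖jet c i.1 φ (1, x)‖ ^ 2 * nullWeight N j (x - 1) (x + 1)) 1
    rw [sub_self] at this
    rw [← this]
    refine intervalIntegral.integral_congr fun z _ => ?_
    simp only [jetField, pt]
    rw [show (z - (z - 2)) / 2 = 1 by ring, show (z + (z - 2)) / 2 = z - 1 by ring,
      show z - 1 - 1 = z - 2 by ring, sub_add_cancel]
  rw [e]
  refine h1.trans (mul_le_mul_of_nonneg_right (le_trans ?_ (hle i)) (sq_nonneg η))
  have e1 := hC (1 / 2) i.1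
  have e2 := hC (-1 / 2) i.1
  simp only [mem_insert_iff, mem_singleton_iff] at hc
  rcases hc with rfl | rfl <;> linarith

lemma IsSolution.dirac_u {u v : ℝ × ℝ → ℂ} (h : IsSolution u v) :
    EqOn (dirDeriv (1, 1) u) (fun p => Complex.I * v p + cubic v u p) {p | 1 < p.1} := fun p hp => by
  have := (h p.1 p.2 (le_of_lt hp)).1
  rw [dirDeriv_one_eq]
  simp only [cubic, Complex.mul_conj']
  push_cast
  rw [one_mul, this]
  ring

lemma IsSolution.dirac_v {u v : ℝ × ℝ → ℂ} (h : IsSolution u v) :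
    EqOn (dirDeriv (1, -1) v) (fun p => Complex.I * u p + cubic u v p) {p | 1 < p.1} := fun p hp => by
  have := (h p.1 p.2 (le_of_lt hp)).2
  rw [dirDeriv_one_eq]
  simp only [cubic, Complex.mul_conj']
  push_cast
  rw [neg_one_mul, ← sub_eq_add_neg, this]
  ring

lemma isOpen_after : IsOpen {p : ℝ × ℝ | 1 < p.1} := isOpen_lt continuous_const continuous_fst

lemma jetOrd_toIdx {N : ℕ} {i : ℕ × ℕ × ℕ} (h : (toIdx N i).1 = i) : jetOrd (toIdx N i) = i.1 + i.2.1 := by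
  rw [jetOrd, h]

/-- The derivatives of a solution with small initial energy form a `NullSystem`. -/
lemma exists_nullSystem (N : ℕ) : ∃ C : ℝ, 0 < C ∧ ∀ {u v : ℝ × ℝ → ℂ},
    ContDiff ℝ (N + 4 : ℕ) u → ContDiff ℝ (N + 4 : ℕ) v → IsSolution u v → ∀ {η : ℝ}, 0 ≤ η →
    totalExtEnergy N u v 1 ≤ ENNReal.ofReal η →
    NullSystem N (jetOrd (N := N)) idxT idxX (idxList N) (C * η ^ 2) (jetField (-1 / 2) u)
      (jetField (1 / 2) v) (jetField (1 / 2) (cubic v u)) (jetField (-1 / 2) (cubic u v)) := by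
  obtain ⟨C, hC, hd⟩ := exists_data_field_le N
  refine ⟨2 * C, by positivity, fun {u v} hu hv hsol η hη hE => ?_⟩
  have hcu := contDiff_cubic hv hu
  have hcv := contDiff_cubic hu hv
  have hEu : ∀ I : ℕ × ℕ, ∀ k, I.1 + I.2 ≤ N → k ≤ 3 →
      extEnergy 1 (vf I k u) (weight N (I.1 + I.2)) ≤ ENNReal.ofReal η := fun I k hI hk =>
    (le_self_add.trans (extEnergy_le_total u v 1 hI hk)).trans hE
  have hEv : ∀ I : ℕ × ℕ, ∀ k, I.1 + I.2 ≤ N → k ≤ 3 →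
      extEnergy 1 (vf I k v) (weight N (I.1 + I.2)) ≤ ENNReal.ofReal η := fun I k hI hk =>
    (le_add_self.trans (extEnergy_le_total u v 1 hI hk)).trans hE
  have after : ∀ {y z : ℝ}, y + 2 < z → pt y z ∈ {p : ℝ × ℝ | 1 < p.1} := fun {y z} h => by
    simp only [pt, mem_ofPred_eq]; linarith
  have sumBound : ∀ (c₁ c₂ : ℝ) (f g : ℝ × ℝ → ℂ), ContDiff ℝ (N + 4 : ℕ) f →
      ContDiff ℝ (N + 4 : ℕ) g → ∀ (i : JetIdx N) y z, ‖jetField (c₁ + c₁ + c₂) (cubic f g) i y z‖ ≤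
      ((idxList N i).map fun e => ‖jetField c₁ f e.1 y z‖ * ‖jetField c₁ f e.2.1 y z‖ *
        ‖jetField c₂ g e.2.2 y z‖).sum := by
    intro c₁ c₂ f g hf hg i y z
    have h' := mem_idxSet.1 i.2
    refine (norm_jet_cubic_le (i := i.1) (m := N + 4) (by simp only [deg]; omega) hf hg _).trans
      (le_of_eq ?_)
    rw [idxList, List.map_map]
    refine congrArg List.sum (List.map_congr_left fun e he => ?_)
    obtain ⟨h1, h2, h3⟩ := leibniz_split he
    simp only [Function.comp, jetField, h1, h2, h3]
  constructor
  · exact fun i => (mem_idxSet.1 i.2).1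
  · intro i hi
    rw [jetOrd, idxT_val hi, jetOrd]; simp only; omega
  · intro i hi
    rw [jetOrd, idxX_val hi, jetOrd]; simp only; omega
  · intro i e he
    simp only [idxList, List.mem_map] at he
    obtain ⟨e, he, rfl⟩ := he
    obtain ⟨h1, h2, h3⟩ := leibniz_split he
    rw [jetOrd_toIdx h1, jetOrd_toIdx h2, jetOrd_toIdx h3, jetOrd,
      ← (hasLeibniz_leibnizList i.1).1 e he]
    simp only [Prod.fst_add, Prod.snd_add]
    omega
  · exact continuous_jetField hu _
  · exact continuous_jetField hv _
  · exact continuous_jetField hcu _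
  · exact continuous_jetField hcv _
  · intro i y z hyz
    have h' := mem_idxSet.1 i.2
    exact hasDerivAt_pt_right (hasDerivAt_jet_dirac (s := 1) (by norm_num) hu hv hcu isOpen_after
      hsol.dirac_u (i := i.1) (by simp only [deg]; omega) (by omega) (after hyz))
  · intro i y z hyz
    have h' := mem_idxSet.1 i.2
    have := hasDerivAt_pt_left (hasDerivAt_jet_dirac (s := -1) (by norm_num) hv hu hcv isOpen_after
      hsol.dirac_v (i := i.1) (by simp only [deg]; omega) (by omega) (after hyz))
    rw [neg_neg] at this
    exact this
  · exact fun i hi y z => hasDerivAt_jetField_left hu _ i hi y z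
  · exact fun i hi y z => hasDerivAt_jetField_left hv _ i hi y z
  · exact fun i hi y z => hasDerivAt_jetField_right hv _ i hi y z
  · exact fun i hi z => hasDerivAt_jetField_data hu _ i hi z
  · exact fun i hi z => hasDerivAt_jetField_data hv _ i hi z
  -- Conjugation preserves real spins, so `|v|² u` has spin `1/2 + 1/2 - 1/2 = 1/2`, as the equation
  -- for `u` requires; the equation for `v` has the opposite signs.
  · intro i y z
    have := sumBound (1 / 2) (-1 / 2) v u hv hu i y z
    rwa [show (1 / 2 + 1 / 2 + -1 / 2 : ℝ) = 1 / 2 by norm_num] at this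
  · intro i y z
    have := sumBound (-1 / 2) (1 / 2) u v hu hv i y z
    rwa [show (-1 / 2 + -1 / 2 + 1 / 2 : ℝ) = -1 / 2 by norm_num] at this
  · intro i j hj hij X hX
    have h1 := hd hu hη hEu (-1 / 2) (by simp) i j hj hij X hX
    have h2 := hd hv hη hEv (1 / 2) (by simp) i j hj hij X hX
    have cont : ∀ (c : ℝ) φ, ContDiff ℝ (N + 4 : ℕ) φ →
        Continuous fun z : ℝ => ‖jetField c φ i (z - 2) z‖ ^ 2 * nullWeight N j (z - 2) z := by
      intro c φ hφ
      have h3 : Continuous fun z : ℝ => jetField c φ i (z - 2) z :=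
        (continuous_jetField hφ c i).comp ((continuous_id.sub continuous_const).prodMk continuous_id)
      unfold nullWeight
      fun_prop
    simp only [add_mul]
    rw [intervalIntegral.integral_add ((cont _ u hu).intervalIntegrable _ _)
      ((cont _ v hv).intervalIntegrable _ _)]
    linarith

end Thirring
end

/-! ### The surface `S_T` in null coordinates and fluxes as integrals over it. -/

noncomputable section
namespace Thirring
open MeasureTheory Set ComplexConjugate

lemma self_lt_bracket (x : ℝ) : x < bracket x := by
  unfold bracket
  refine lt_of_le_of_lt (le_abs_self x) ?_
  rw [← Real.sqrt_sq_eq_abs]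
  exact Real.sqrt_lt_sqrt (sq_nonneg x) (by linarith)

lemma bracket_le {x : ℝ} (hx : 0 ≤ x) : bracket x ≤ 1 + x := by
  unfold bracket
  rw [Real.sqrt_le_left (by linarith)]
  nlinarith

lemma slope_nonneg (T : ℝ) {x : ℝ} (hx : 0 ≤ x) : 0 ≤ slope T x := by
  unfold slope
  split_ifs
  · exact le_rfl
  · exact div_nonneg hx (bracket_pos x).le

lemma slope_lt_one (T x : ℝ) : slope T x < 1 := by
  unfold slope
  split_ifs
  · exact one_pos
  · rw [div_lt_one (bracket_pos x)]; exact self_lt_bracket x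

lemma hasDerivAt_bracket (x : ℝ) : HasDerivAt bracket (x / bracket x) x := by
  have h : HasDerivAt (fun x : ℝ => 1 + x ^ 2) (2 * x) x := by
    simpa using ((hasDerivAt_id x).pow 2).const_add 1
  have := h.sqrt (by positivity)
  refine this.congr_deriv ?_
  unfold bracket
  rw [mul_div_mul_left _ _ two_ne_zero]

lemma continuous_bracket : Continuous bracket := by unfold bracket; fun_prop

lemma hasDerivAt_surf {T x : ℝ} (hx : bracket x ≠ T) :
    HasDerivAt (fun x => min T (bracket x)) (slope T x) x := by
  rcases lt_or_gt_of_ne hx with h | h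
  · rw [slope, if_neg (not_le.2 h)]
    refine (hasDerivAt_bracket x).congr_of_eventuallyEq ?_
    filter_upwards [(isOpen_lt continuous_bracket continuous_const).mem_nhds h] with y hy
    exact min_eq_right (le_of_lt hy)
  · rw [slope, if_pos h.le]
    refine (hasDerivAt_const x T).congr_of_eventuallyEq ?_
    filter_upwards [(isOpen_lt continuous_const continuous_bracket).mem_nhds h] with y hy
    exact min_eq_left (le_of_lt hy)

/-- Slopes of the hyperboloid lie strictly below one: it is spacelike. Hence both null coordinates
increase strictly along `S_T` and can serve as parameters. -/
lemma bracket_sub_lt {a b : ℝ} (ha : 0 ≤ a) (hab : a < b) :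
    bracket a ≤ bracket b ∧ bracket b - bracket a < b - a := by
  have h1 := bracket_sq a
  have h2 := bracket_sq b
  have h3 := self_lt_bracket a
  have h4 := self_lt_bracket b
  have h5 := bracket_pos a
  have h6 := bracket_pos b
  constructor
  · nlinarith
  · by_contra! h
    nlinarith

lemma min_bracket_sub {T a b : ℝ} (ha : 0 ≤ a) (hab : a < b) :
    min T (bracket a) ≤ min T (bracket b) ∧ min T (bracket b) - min T (bracket a) < b - a := by
  obtain ⟨h1, h2⟩ := bracket_sub_lt ha hab
  refine ⟨min_le_min_left _ h1, ?_⟩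
  rcases le_total T (bracket a) with h | h
  · rw [min_eq_left h, min_eq_left (h.trans h1)]; linarith
  · rw [min_eq_right h]
    linarith [min_le_right T (bracket b)]

/-- The null coordinate `x - t` on the exterior boundary. -/
def surfIn (T x : ℝ) : ℝ := x - min T (bracket x)

/-- The null coordinate `x + t` on the exterior boundary. -/
def surfOut (T x : ℝ) : ℝ := x + min T (bracket x)

lemma pt_surf (T x : ℝ) : pt (surfIn T x) (surfOut T x) = surf T x := by
  unfold pt surfIn surfOut surf
  ext <;> simp

section surface

variable {T x : ℝ} (hT : 1 ≤ T) (hx : 0 ≤ x)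
include hT hx

lemma inExt_surf : InExt (surfIn T x) (surfOut T x) := by
  have h1 : 1 ≤ min T (bracket x) := le_min hT (one_le_bracket x)
  have h2 := min_le_right T (bracket x)
  have h3 := bracket_sq x
  unfold surfIn surfOut
  refine ⟨by linarith, by nlinarith, by linarith⟩

/-- The right half of `S_T` is the exit boundary: one of the constraints `z - y ≤ 2T` and `-1 ≤ y z`
is saturated, according to which piece of the surface the point lies on. -/
lemma rayExitIn_surf : rayExitIn T (-1) (surfOut T x) = surfIn T x := by
  have h := inExt_surf hT hx
  have h2 := min_le_right T (bracket x)
  have h2' := min_le_left T (bracket x)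
  have h3 := bracket_le hx
  have h4 : -1 ≤ surfIn T x := by unfold surfIn; linarith
  have h5 : surfOut T x - surfIn T x ≤ 2 * T := by unfold surfIn surfOut; linarith
  refine le_antisymm ((rayExitIn_le_iff h.one_le).2 ⟨h4, h.neg_one_le, by linarith⟩) ?_
  obtain ⟨-, g1, g2⟩ := (rayExitIn_le_iff h.one_le).1 (le_refl (rayExitIn T (-1) (surfOut T x)))
  rcases le_total T (bracket x) with hb | hb
  · unfold surfIn surfOut at *
    rw [min_eq_left hb] at *
    linarith
  · have e : surfIn T x * surfOut T x = -1 := by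
      unfold surfIn surfOut
      rw [min_eq_right hb]
      linarith [bracket_sq x, sq_nonneg x]
    exact le_of_mul_le_mul_right (e.trans_le g1) (by linarith [h.one_le])

lemma rayExitOut_surf {z₀ : ℝ} (hz : surfOut T x ≤ z₀) : rayExitOut T z₀ (surfIn T x) = surfOut T x := by
  have h := inExt_surf hT hx
  have h2' := min_le_left T (bracket x)
  have h5 : surfOut T x - surfIn T x ≤ 2 * T := by unfold surfIn surfOut; linarith
  have hpos : 0 < surfOut T x := by linarith [h.one_le]
  have hle := (le_rayExitOut_iff (T := T) hpos).2 ⟨hz, h.neg_one_le, by linarith⟩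
  refine le_antisymm ?_ hle
  obtain ⟨-, g1, g2⟩ := (le_rayExitOut_iff (lt_of_lt_of_le hpos hle)).1 (le_refl (rayExitOut T z₀ (surfIn T x)))
  rcases le_total T (bracket x) with hb | hb
  · unfold surfIn surfOut at *
    rw [min_eq_left hb] at *
    linarith
  · have e : surfIn T x * surfOut T x = -1 := by
      unfold surfIn surfOut
      rw [min_eq_right hb]
      linarith [bracket_sq x, sq_nonneg x]
    by_contra! hlt
    have hneg : surfIn T x < 0 := by
      by_contra! h0
      linarith [mul_nonneg h0 hpos.le]
    linarith [mul_lt_mul_of_neg_left hlt hneg]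

omit hT in
lemma weight_surf (N j : ℕ) : weight N j (surf T x) = nullWeight N j (surfIn T x) (surfOut T x) := by
  unfold weight nullWeight surf surfIn surfOut
  simp only [abs_of_nonneg hx]
  rw [add_comm _ x, add_comm (x - _)]

end surface

/-- The corners of `S_T`, where it has no tangent, are at most two points. -/
lemma ae_bracket_ne (T : ℝ) : ∀ᵐ x : ℝ, bracket x ≠ T := by
  have hfin : ({x : ℝ | bracket x = T}).Finite := by
    refine Finite.subset (({√(T ^ 2 - 1), -√(T ^ 2 - 1)} : Set ℝ).toFinite) fun x hx => ?_
    simp only [mem_ofPred_eq] at hx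
    have h1 : T ^ 2 - 1 = x ^ 2 := by rw [← hx, bracket_sq]; ring
    rw [h1, Real.sqrt_sq_eq_abs]
    rcases abs_choice x with h | h <;> simp [h]
  exact ae_iff.2 (by simpa using hfin.measure_zero volume)

/-- Integrals over the exterior boundary are limits of integrals over bounded pieces. -/
lemma lintegral_Ioi_le {T : ℝ} {g : ℝ → ℝ≥0∞} {A : ℝ≥0∞}
    (h : ∀ R : ℝ, ∫⁻ x in {x | (0 < x ∧ x < R) ∧ bracket x ≠ T}, g x ≤ A) :
    ∫⁻ x in Ioi 0, g x ≤ A := by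
  have e : ⋃ n : ℕ, Ioo (0 : ℝ) n = Ioi 0 := by
    ext x
    simp only [mem_iUnion, mem_Ioo, mem_Ioi]
    exact ⟨fun ⟨_, h, _⟩ => h, fun h => (exists_nat_gt x).imp fun _ hn => ⟨h, hn⟩⟩
  rw [← e, setLIntegral_iUnion_of_directed]
  · refine iSup_le fun n => ?_
    refine le_trans (le_of_eq ?_) (h n)
    refine setLIntegral_congr ?_
    filter_upwards [ae_bracket_ne T] with x hx
    exact propext ⟨fun hm => ⟨hm, hx⟩, fun hm => hm.1⟩
  · exact (monotone_nat_of_le_succ fun n => Ioo_subset_Ioo_right (by push_cast; linarith)).directed_le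

lemma measurableSet_piece (T R : ℝ) : MeasurableSet {x | (0 < x ∧ x < R) ∧ bracket x ≠ T} :=
  (measurableSet_Ioo (a := (0 : ℝ)) (b := R)).inter
    ((continuous_bracket.measurable (measurableSet_singleton T)).compl)

/-- Change of variables by a null coordinate `f` along the surface, away from the corners; the image
need only be contained in the interval of integration. -/
lemma lintegral_image_le {T R c d A : ℝ} {f f' : ℝ → ℝ} {h k : ℝ → ℝ}
    (hf : ∀ x, 0 < x → bracket x ≠ T → HasDerivAt f (f' x) x)
    (hinj : StrictMonoOn f (Ioi 0)) (hmaps : ∀ x, 0 < x → x < R → f x ∈ Ioc c d)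
    (hf' : ∀ x, 0 < x → 0 ≤ f' x) (hhk : ∀ x, 0 < x → x < R → h (f x) = k x)
    (hint : IntervalIntegrable h volume c d) (hnn : ∀ y, y ∈ Ioc c d → 0 ≤ h y)
    (hA : ∫ y in c..d, h y ≤ A) :
    ∫⁻ x in {x | (0 < x ∧ x < R) ∧ bracket x ≠ T}, ENNReal.ofReal (f' x * k x) ≤ ENNReal.ofReal A := by
  set s := {x | (0 < x ∧ x < R) ∧ bracket x ≠ T}
  have hs : MeasurableSet s := measurableSet_piece T R
  have e1 := lintegral_image_eq_lintegral_abs_deriv_mul hs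
    (fun x hx => (hf x hx.1.1 hx.2).hasDerivWithinAt)
    (hinj.injOn.mono fun x hx => hx.1.1) fun y => ENNReal.ofReal (h y)
  have e2 : ∫⁻ x in s, ENNReal.ofReal (f' x * k x) =
      ∫⁻ x in s, ENNReal.ofReal |f' x| * ENNReal.ofReal (h (f x)) := by
    refine setLIntegral_congr_fun hs fun x hx => ?_
    rw [hhk x hx.1.1 hx.1.2, abs_of_nonneg (hf' x hx.1.1), ENNReal.ofReal_mul (hf' x hx.1.1)]
  rw [e2, ← e1]
  rcases lt_or_ge d c with hdc | hcd
  · have : f '' s = ∅ := by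
      rw [image_eq_empty, eq_empty_iff_forall_notMem]
      intro x hx
      have := hmaps x hx.1.1 hx.1.2
      linarith [this.1, this.2]
    simp [this]
  · have hsub : f '' s ⊆ Ioc c d := by
      rintro _ ⟨x, hx, rfl⟩
      exact hmaps x hx.1.1 hx.1.2
    refine (lintegral_mono_set hsub).trans ?_
    rw [intervalIntegral.integral_of_le hcd] at hA
    rw [← ofReal_integral_eq_lintegral_ofReal hint.1
      ((ae_restrict_mem measurableSet_Ioc).mono fun y hy => hnn y hy)]
    exact ENNReal.ofReal_le_ofReal hA

section flux

variable {T : ℝ} (hT : 1 ≤ T) (N j : ℕ) {A : ℝ} {W : ℝ → ℝ → ℂ} (hW : Continuous (Function.uncurry W))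
include hT hW

/-- The flux of the incoming component, as an integral over the exterior boundary. -/
lemma lintegral_surf_out_le (h : ∀ z₀, 1 ≤ z₀ → ∫ z in (1 : ℝ)..z₀, ‖W (rayExitIn T (-1) z) z‖ ^ 2 *
      nullWeight N j (rayExitIn T (-1) z) z ≤ A) :
    ∫⁻ x in Ioi 0, ENNReal.ofReal ((1 + slope T x) * (‖W (surfIn T x) (surfOut T x)‖ ^ 2 *
      nullWeight N j (surfIn T x) (surfOut T x))) ≤ ENNReal.ofReal A := by
  refine lintegral_Ioi_le (T := T) fun R => ?_
  have hmaps : ∀ x, 0 < x → x < R → surfOut T x ∈ Ioc 1 (R + T) := fun x hx hR => by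
    have h1 : 1 ≤ min T (bracket x) := le_min hT (one_le_bracket x)
    have h2 := min_le_left T (bracket x)
    unfold surfOut
    constructor <;> linarith
  rcases le_or_gt 1 (R + T) with hR | hR
  · have hc : Continuous fun z : ℝ => ‖W (rayExitIn T (-1) z) z‖ ^ 2 *
        nullWeight N j (rayExitIn T (-1) z) z := by
      have e := (continuous_rayExitIn T (-1)).prodMk continuous_id
      exact ((hW.comp e).norm.pow 2).mul ((continuous_nullWeight N j).comp e)
    -- The Jacobian of `x ↦ z` is `1 + slope T x`; for `y` it is `1 - slope T x`.
    refine lintegral_image_le (fun x hx hb => (hasDerivAt_id x).add (hasDerivAt_surf hb))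
      (fun a ha b _ hab => ?_) hmaps (fun x hx => by linarith [slope_nonneg T hx.le])
      (fun x hx _ => ?_) (hc.intervalIntegrable _ _) (fun z hz => ?_) (h _ hR)
    · exact add_lt_add_of_lt_of_le hab (min_bracket_sub (T := T) (le_of_lt ha) hab).1
    · change ‖W (rayExitIn T (-1) (surfOut T x)) (surfOut T x)‖ ^ 2 *
        nullWeight N j (rayExitIn T (-1) (surfOut T x)) (surfOut T x) = _
      rw [rayExitIn_surf hT hx.le]
    · have := inExt_of_rayExitIn_le hz.1.le le_rfl (rayExitIn_le hT le_rfl (by linarith [hz.1]))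
      exact mul_nonneg (sq_nonneg _) (this.nullWeight_nonneg N j)
  · have : {x | (0 < x ∧ x < R) ∧ bracket x ≠ T} = ∅ := by
      rw [eq_empty_iff_forall_notMem]
      rintro x ⟨⟨h1, h2⟩, -⟩
      linarith
    simp [this]

/-- The flux of the outgoing component, as an integral over the exterior boundary. -/
lemma lintegral_surf_in_le (h : ∀ z₀, 1 ≤ z₀ → ∫ y in (-1 : ℝ)..(z₀ - 2),
      ‖W y (rayExitOut T z₀ y)‖ ^ 2 * nullWeight N j y (rayExitOut T z₀ y) ≤ A) :
    ∫⁻ x in Ioi 0, ENNReal.ofReal ((1 - slope T x) * (‖W (surfIn T x) (surfOut T x)‖ ^ 2 *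
      nullWeight N j (surfIn T x) (surfOut T x))) ≤ ENNReal.ofReal A := by
  refine lintegral_Ioi_le (T := T) fun R => ?_
  rcases le_or_gt 1 (R + T) with hR | hR
  · have hmaps : ∀ x, 0 < x → x < R → surfIn T x ∈ Ioc (-1) (R + T - 2) := fun x hx hR => by
      have h1 : 1 ≤ min T (bracket x) := le_min hT (one_le_bracket x)
      have h2 : min T (bracket x) < 1 + x := by
        refine (min_le_right _ _).trans_lt ?_
        unfold bracket
        rw [Real.sqrt_lt (by positivity) (by positivity)]
        nlinarith
      unfold surfIn
      constructor <;> linarith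
    have hi : IntervalIntegrable (fun y => ‖W y (rayExitOut T (R + T) y)‖ ^ 2 *
        nullWeight N j y (rayExitOut T (R + T) y)) volume (-1) (R + T - 2) :=
      intervalIntegrable_rayExitOut (f := fun y z => ‖W y z‖ ^ 2 * nullWeight N j y z) hT (by linarith)
        ((hW.norm.pow 2).mul (continuous_nullWeight N j))
    refine lintegral_image_le (fun x hx hb => (hasDerivAt_id x).sub (hasDerivAt_surf hb))
      (fun a ha b _ hab => ?_) hmaps (fun x hx => by linarith [slope_lt_one T x])
      (fun x hx hxR => ?_) hi (fun y hy => ?_) (h _ hR)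
    · have := (min_bracket_sub (T := T) (le_of_lt ha) hab).2
      simp only [Pi.sub_apply, id]
      linarith
    · change ‖W (surfIn T x) (rayExitOut T (R + T) (surfIn T x))‖ ^ 2 *
        nullWeight N j (surfIn T x) (rayExitOut T (R + T) (surfIn T x)) = _
      rw [rayExitOut_surf hT hx.le (by unfold surfOut; linarith [min_le_left T (bracket x)])]
    · have h1 : y + 2 ≤ rayExitOut T (R + T) y := le_rayExitOut hT (by linarith [hy.2])
      unfold nullWeight
      have h2 : 0 ≤ 1 + y := by linarith [hy.1]
      have h3 : 0 ≤ rayExitOut T (R + T) y := by linarith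
      positivity
  · have : {x | (0 < x ∧ x < R) ∧ bracket x ≠ T} = ∅ := by
      rw [eq_empty_iff_forall_notMem]
      rintro x ⟨⟨h1, h2⟩, -⟩
      linarith
    simp [this]

end flux

end Thirring
end

/-! ### Klein-Gordon energies on the right half, from the Dirac fluxes. -/

noncomputable section
namespace Thirring
open MeasureTheory Set ComplexConjugate

open NullSystem

/-- The flux bounds for the derivatives of small solutions, in null coordinates. -/
lemma exists_jet_flux_bound {N : ℕ} (hN : 1 ≤ N) : ∃ C ε : ℝ, 0 < C ∧ 0 < ε ∧ ∀ {u v : ℝ × ℝ → ℂ},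
    ContDiff ℝ (N + 4 : ℕ) u → ContDiff ℝ (N + 4 : ℕ) v → IsSolution u v → ∀ {η : ℝ}, 0 < η → η ≤ ε →
    totalExtEnergy N u v 1 ≤ ENNReal.ofReal η →
    (∀ T z₀, 1 ≤ T → 1 ≤ z₀ → ∀ (i : JetIdx N) (j : ℕ), j ≤ N → jetOrd i ≤ j + 1 →
      (∫ y in (-1)..(z₀ - 2), ‖jetField (-1 / 2) u i y (rayExitOut T z₀ y)‖ ^ 2 *
        nullWeight N j y (rayExitOut T z₀ y)) ≤ C * η ^ 2 ∧
      (∫ z in (1 : ℝ)..z₀, ‖jetField (1 / 2) v i (rayExitIn T (-1) z) z‖ ^ 2 *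
        nullWeight N j (rayExitIn T (-1) z) z) ≤ C * η ^ 2) ∧
    (∀ y z, InExt y z → y + 2 < z → ∀ (i : JetIdx N) (j : ℕ), j ≤ N → jetOrd i ≤ j →
      (‖jetField (-1 / 2) u i y z‖ ^ 2 + ‖jetField (1 / 2) (cubic v u) i y z‖ ^ 2) *
        nullWeight N j y z ≤ C * outDensity N jetOrd (jetField (N := N) (1 / 2) v) y z) := by
  obtain ⟨C₁, hC₁, hS⟩ := exists_nullSystem N
  obtain ⟨C₂, δ₀, hC₂, hδ₀, hflux⟩ := exists_flux_bound hN (JetIdx N)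
    (∑ i : JetIdx N, (idxList N i).length)
  refine ⟨C₂ * C₁ + C₂, √(δ₀ / C₁), by positivity, Real.sqrt_pos.2 (by positivity), ?_⟩
  intro u v hu hv hsol η hη hηε hE
  have hδ : C₁ * η ^ 2 ≤ δ₀ := by
    rw [Real.le_sqrt hη.le (by positivity), le_div_iff₀ hC₁] at hηε
    linarith
  obtain ⟨h1, h2⟩ := hflux (hS hu hv hsol hη.le hE)
    (fun i => Finset.single_le_sum (f := fun i => (idxList N i).length) (fun _ _ => Nat.zero_le _)
      (Finset.mem_univ i)) (by positivity) hδ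
  have hle : C₂ * (C₁ * η ^ 2) ≤ (C₂ * C₁ + C₂) * η ^ 2 := by nlinarith [mul_pos hC₂ (pow_pos hη 2)]
  refine ⟨fun T z₀ hT hz i j hj hij => ?_, fun y z h hyz i j hj hij => ?_⟩
  · obtain ⟨a, b⟩ := h1 T z₀ hT hz i j hj hij
    exact ⟨a.trans hle, b.trans hle⟩
  · refine (h2 y z h hyz i j hj hij).trans ?_
    have := outDensity_nonneg (N := N) (ord := jetOrd) (U := jetField (N := N) (1 / 2) v) h
    refine mul_le_mul_of_nonneg_right ?_ this
    nlinarith [mul_pos hC₂ hC₁]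

/-- The null decomposition: the factors `1 ± τ` are those with which the fluxes of `V` and `U` pass
through the surface. -/
lemma energyDensity_eq (τ : ℝ) (φ : ℝ × ℝ → ℂ) (p : ℝ × ℝ) :
    energyDensity τ φ p = ((1 + τ) * ‖dirDeriv (1, 1) φ p‖ ^ 2 +
      (1 - τ) * ‖dirDeriv (1, -1) φ p‖ ^ 2) / 4 + ‖φ p‖ ^ 2 / 2 := by
  rw [dirDeriv_one_eq, dirDeriv_one_eq, energyDensity]
  simp only [← Complex.normSq_eq_norm_sq, Complex.normSq_apply, Complex.add_re, Complex.add_im,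
    Complex.mul_re, Complex.mul_im, Complex.ofReal_re, Complex.ofReal_im, Complex.conj_re, Complex.conj_im]
  ring

lemma sum_range_mul_le {n : ℕ} (hn : n ≤ 3) {x : ℕ → ℝ} {w B : ℝ} (hB : 0 ≤ B)
    (h : ∀ k ≤ n, x k * w ≤ B) : (∑ k ∈ Finset.range (n + 1), x k) * w ≤ 4 * B := by
  rw [Finset.sum_mul]
  refine (Finset.sum_le_card_nsmul _ _ B fun k hk => h k (by rw [Finset.mem_range] at hk; omega)).trans ?_
  rw [Finset.card_range, nsmul_eq_mul]
  have : ((n + 1 : ℕ) : ℝ) ≤ 4 := by exact_mod_cast (by omega)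
  gcongr

lemma normSq_add_le (a b : ℂ) : ‖a + b‖ ^ 2 ≤ 2 * ‖a‖ ^ 2 + 2 * ‖b‖ ^ 2 := by
  have h : ‖a + b‖ ^ 2 ≤ (‖a‖ + ‖b‖) ^ 2 := by gcongr; exact norm_add_le a b
  nlinarith [sq_nonneg (‖a‖ - ‖b‖)]

/-- The index of `∂^I Z^k`. -/
def jetIdx (N : ℕ) (I : ℕ × ℕ) (k : ℕ) : JetIdx N := toIdx N (I.1, I.2, k)

lemma jetIdx_val {N : ℕ} {I : ℕ × ℕ} {k : ℕ} (hI : I.1 + I.2 ≤ N) (hk : k ≤ 3) :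
    (jetIdx N I k).1 = (I.1, I.2, k) := toIdx_val (by simp only; omega) hk

lemma dirDeriv_field_le {N : ℕ} {φ : ℝ × ℝ → ℂ} (hφ : ContDiff ℝ (N + 4 : ℕ) φ) (c : ℝ) {s : ℝ}
    (hs : s ^ 2 = 1) {I : ℕ × ℕ} (hI : I.1 + I.2 ≤ N) {k : ℕ} (hk : k ≤ 3) {y z : ℝ} (h : InExt y z) :
    ‖dirDeriv (1, s) (jet c (I.1, I.2, k) φ) (pt y z)‖ ^ 2 * nullWeight N (I.1 + I.2) y z ≤
      4 * outDensity N jetOrd (jetField (N := N) c φ) y z := by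
  have e := jetIdx_val hI hk
  have ho : jetOrd (jetIdx N I k) = I.1 + I.2 := by rw [jetOrd, e]
  have hw := h.nullWeight_nonneg N (I.1 + I.2)
  rw [← e, dirDeriv_one_jet hφ c _ (by omega)]
  have hT : jetOrd (idxT (jetIdx N I k)) = I.1 + I.2 + 1 := by
    rw [jetOrd, idxT_val (by omega), e]; simp only; omega
  have hX : jetOrd (idxX (jetIdx N I k)) = I.1 + I.2 + 1 := by
    rw [jetOrd, idxX_val (by omega), e]; simp only; omega
  have h1 := le_outDensity (U := jetField (N := N) c φ) h hI hT.le
  have h2 := le_outDensity (U := jetField (N := N) c φ) h hI hX.le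
  have h3 := normSq_add_le (jetField c φ (idxT (jetIdx N I k)) y z)
    (s * jetField c φ (idxX (jetIdx N I k)) y z)
  have hs' : ‖(s : ℂ)‖ ^ 2 = 1 := by rw [Complex.norm_real, Real.norm_eq_abs, sq_abs, hs]
  rw [norm_mul, mul_pow, hs', one_mul] at h3
  nlinarith [mul_le_mul_of_nonneg_right h3 hw]

lemma field_le {N : ℕ} (φ : ℝ × ℝ → ℂ) (c : ℝ) {I : ℕ × ℕ} (hI : I.1 + I.2 ≤ N) {k : ℕ} (hk : k ≤ 3)
    {y z : ℝ} (h : InExt y z) :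
    ‖jet c (I.1, I.2, k) φ (pt y z)‖ ^ 2 * nullWeight N (I.1 + I.2) y z ≤
      outDensity N jetOrd (jetField (N := N) c φ) y z := by
  have e := jetIdx_val hI hk
  have ho : jetOrd (jetIdx N I k) = I.1 + I.2 := by rw [jetOrd, e]
  have := le_outDensity (ord := jetOrd) (U := jetField (N := N) c φ) h hI (i := jetIdx N I k) (by omega)
  rwa [jetField, e] at this

/-- The flux of `U` carries `1 - τ`, which tends to zero along the hyperboloid, so only `(∂_t - ∂_x)
u` may be charged to it. All other terms are charged to the density of `V`, whose factor `1 + τ` is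
at least one. -/
lemma exists_energyDensity_le {N : ℕ} (hN : 1 ≤ N) : ∃ C ε : ℝ, 0 < C ∧ 0 < ε ∧ ∀ {u v : ℝ × ℝ → ℂ},
    ContDiff ℝ (N + 4 : ℕ) u → ContDiff ℝ (N + 4 : ℕ) v → IsSolution u v → ∀ {η : ℝ}, 0 < η → η ≤ ε →
    totalExtEnergy N u v 1 ≤ ENNReal.ofReal η →
    (∀ T z₀, 1 ≤ T → 1 ≤ z₀ → ∀ (i : JetIdx N) (j : ℕ), j ≤ N → jetOrd i ≤ j + 1 →
      (∫ y in (-1)..(z₀ - 2), ‖jetField (-1 / 2) u i y (rayExitOut T z₀ y)‖ ^ 2 *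
        nullWeight N j y (rayExitOut T z₀ y)) ≤ C * η ^ 2 ∧
      (∫ z in (1 : ℝ)..z₀, ‖jetField (1 / 2) v i (rayExitIn T (-1) z) z‖ ^ 2 *
        nullWeight N j (rayExitIn T (-1) z) z) ≤ C * η ^ 2) ∧
    (∀ y z, InExt y z → y + 2 < z → ∀ τ, 0 ≤ τ → τ < 1 → ∀ I : ℕ × ℕ, ∀ k, I.1 + I.2 ≤ N → k ≤ 3 →
      ∀ φ ∈ ({u, v} : Set (ℝ × ℝ → ℂ)),
      energyDensity τ (vf I k φ) (pt y z) * nullWeight N (I.1 + I.2) y z ≤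
        C * ((1 + τ) * outDensity N jetOrd (jetField (N := N) (1 / 2) v) y z) +
        C * ((1 - τ) * outDensity N jetOrd (jetField (N := N) (-1 / 2) u) y z)) := by
  obtain ⟨B, ε, hB, hε, hflux⟩ := exists_jet_flux_bound hN
  -- The energies use `Z` itself, of spin zero, whereas the estimates hold for spins `±1/2`; `D` is
  -- the price of the conversion, made uniform by summing over the finite index set.
  choose D hD hjet using fun c i => exists_jet_bound 0 c i
  set A : ℝ := ∑ i : JetIdx N, (D (-1 / 2) i.1 + D (1 / 2) i.1) with hAdef
  have hA0 : 0 ≤ A := Finset.sum_nonneg fun i _ => add_nonneg (hD _ _) (hD _ _)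
  have hA : ∀ i : JetIdx N, D (-1 / 2) i.1 + D (1 / 2) i.1 ≤ A := fun i =>
    Finset.single_le_sum (f := fun i : JetIdx N => D (-1 / 2) i.1 + D (1 / 2) i.1)
      (fun i _ => add_nonneg (hD _ _) (hD _ _)) (Finset.mem_univ i)
  refine ⟨B + 16 * A * (1 + B), ε, by positivity, hε, ?_⟩
  intro u v hu hv hsol η hη hηε hE
  obtain ⟨h1, h2⟩ := hflux hu hv hsol hη hηε hE
  refine ⟨fun T z₀ hT hz i j hj hij => ?_, ?_⟩
  · obtain ⟨a, b⟩ := h1 T z₀ hT hz i j hj hij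
    have hle : B * η ^ 2 ≤ (B + 16 * A * (1 + B)) * η ^ 2 := by
      gcongr
      have : 0 ≤ 16 * A * (1 + B) := by positivity
      linarith
    exact ⟨a.trans hle, b.trans hle⟩
  intro y z h hyz τ hτ0 hτ1 I k hI hk φ hφ
  have e := jetIdx_val hI hk
  have hAI := hA (jetIdx N I k)
  rw [e] at hAI
  have d1 := hD (-1 / 2) (I.1, I.2, k)
  have d2 := hD (1 / 2) (I.1, I.2, k)
  set w := nullWeight N (I.1 + I.2) y z
  have hw : 0 ≤ w := h.nullWeight_nonneg N _
  set P := outDensity N jetOrd (jetField (N := N) (1 / 2) v) y z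
  set Q := outDensity N jetOrd (jetField (N := N) (-1 / 2) u) y z
  have hP : 0 ≤ P := outDensity_nonneg h
  have hQ : 0 ≤ Q := outDensity_nonneg h
  have key : ∀ {c : ℝ} {f : ℝ × ℝ → ℂ} {a₁ a₂ a₃ : ℝ}, ContDiff ℝ (N + 4 : ℕ) f →
      D c (I.1, I.2, k) ≤ A → 0 ≤ a₁ → 0 ≤ a₂ → 0 ≤ a₃ →
      (∀ k ≤ 3, ‖dirDeriv (1, 1) (jet c (I.1, I.2, k) f) (pt y z)‖ ^ 2 * w ≤ a₁) →
      (∀ k ≤ 3, ‖dirDeriv (1, -1) (jet c (I.1, I.2, k) f) (pt y z)‖ ^ 2 * w ≤ a₂) →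
      (∀ k ≤ 3, ‖jet c (I.1, I.2, k) f (pt y z)‖ ^ 2 * w ≤ a₃) →
      energyDensity τ (vf I k f) (pt y z) * w ≤ A * ((1 + τ) * a₁ + (1 - τ) * a₂ + 2 * a₃) := by
    intro c f a₁ a₂ a₃ hf hDA p1 p2 p3 b1 b2 b3
    obtain ⟨j1, j2⟩ := hjet c (I.1, I.2, k) f (N + 4) hf
    have x3 := j1 (by simp only [deg]; omega) (pt y z)
    have x1 := j2 (by simp only [deg]; omega) (1, 1) (pt y z)
    have x2 := j2 (by simp only [deg]; omega) (1, -1) (pt y z)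
    have conv : ∀ {X S a : ℝ}, X ≤ D c (I.1, I.2, k) * S → 0 ≤ S → S * w ≤ 4 * a → X * w ≤ A * (4 * a) := by
      intro X S a hX hS hSa
      calc X * w ≤ (A * S) * w := by
            refine mul_le_mul_of_nonneg_right (hX.trans ?_) hw
            exact mul_le_mul_of_nonneg_right hDA hS
        _ = A * (S * w) := by ring
        _ ≤ _ := mul_le_mul_of_nonneg_left hSa hA0
    have y1 := conv x1 (Finset.sum_nonneg fun _ _ => sq_nonneg _)
      (sum_range_mul_le hk p1 fun k' hk' => b1 k' (hk'.trans hk))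
    have y2 := conv x2 (Finset.sum_nonneg fun _ _ => sq_nonneg _)
      (sum_range_mul_le hk p2 fun k' hk' => b2 k' (hk'.trans hk))
    have y3 := conv x3 (Finset.sum_nonneg fun _ _ => sq_nonneg _)
      (sum_range_mul_le hk p3 fun k' hk' => b3 k' (hk'.trans hk))
    rw [vf_eq_jet, energyDensity_eq]
    have z1 := mul_le_mul_of_nonneg_left y1 (show 0 ≤ 1 + τ by linarith)
    have z2 := mul_le_mul_of_nonneg_left y2 (show 0 ≤ 1 - τ by linarith)
    linarith
  simp only [mem_insert_iff, mem_singleton_iff] at hφ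
  rcases hφ with rfl | rfl
  · have ptw : ∀ k ≤ 3, ‖jet (-1 / 2) (I.1, I.2, k) φ (pt y z)‖ ^ 2 * w ≤ B * P ∧
        ‖jet (1 / 2) (I.1, I.2, k) (cubic v φ) (pt y z)‖ ^ 2 * w ≤ B * P := by
      intro k hk
      have e := jetIdx_val hI hk
      have := h2 y z h hyz (jetIdx N I k) (I.1 + I.2) hI (by rw [jetOrd, e])
      rw [jetField, jetField, e, add_mul] at this
      constructor <;> nlinarith [mul_nonneg (sq_nonneg ‖jet (-1 / 2) (I.1, I.2, k) φ (pt y z)‖) hw,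
        mul_nonneg (sq_nonneg ‖jet (1 / 2) (I.1, I.2, k) (cubic v φ) (pt y z)‖) hw]
    have := key (c := -1 / 2) (a₁ := 2 * P + 2 * (B * P)) (a₂ := 4 * Q) (a₃ := B * P) hu (by linarith)
      (by positivity) (by positivity) (by positivity) (fun k hk => ?_)
      (fun k hk => dirDeriv_field_le hu _ (by norm_num) hI hk h) (fun k hk => (ptw k hk).1)
    · have p1 := mul_nonneg hB.le hP
      have p2 := mul_nonneg hA0 hP
      have p3 := mul_nonneg hA0 hQ
      have p4 := mul_nonneg hA0 p1
      have p5 := mul_nonneg hB.le hQ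
      have p6 := mul_nonneg hA0 p5
      have q1 : 0 ≤ (1 - τ) := by linarith
      have r1 := mul_nonneg hτ0 p1
      have r2 := mul_nonneg hτ0 p2
      have r4 := mul_nonneg hτ0 p4
      have s3 := mul_nonneg q1 p3
      have s5 := mul_nonneg q1 p5
      have s6 := mul_nonneg q1 p6
      refine this.trans ?_
      nlinarith only [p1, p2, p4, r1, r2, r4, s3, s5, s6]
    -- The derivative `(∂_t + ∂_x) u` is not bounded as a derivative but replaced, by the equation,
    -- with `iv` plus a cubic term; both are controlled by the density of `V`.
    · have hdir := dirDeriv_jet_dirac (s := 1) (by norm_num) hu hv (contDiff_cubic hv hu) isOpen_after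
        hsol.dirac_u (i := (I.1, I.2, k)) (by simp only [deg]; omega)
        (show pt y z ∈ {p : ℝ × ℝ | 1 < p.1} by simp only [pt, mem_ofPred_eq]; linarith)
      simp only at hdir
      rw [hdir]
      have n1 := normSq_add_le (Complex.I * jet (1 / 2) (I.1, I.2, k) v (pt y z))
        (jet (1 / 2) (I.1, I.2, k) (cubic v φ) (pt y z))
      rw [norm_mul, Complex.norm_I, one_mul] at n1
      have n2 := field_le v (1 / 2) hI hk h
      have n3 := (ptw k hk).2
      have n4 := mul_le_mul_of_nonneg_right n1 hw
      linarith
  -- For `v` both null derivatives belong to the density of `V`, as `1 - τ ≤ 1 + τ`.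
  · have := key (c := 1 / 2) (a₁ := 4 * P) (a₂ := 4 * P) (a₃ := P) hv (by linarith)
      (by positivity) (by positivity) (by positivity)
      (fun k hk => dirDeriv_field_le hv _ (by norm_num) hI hk h)
      (fun k hk => dirDeriv_field_le hv _ (by norm_num) hI hk h) (fun k hk => field_le φ _ hI hk h)
    have p1 := mul_nonneg hB.le hP
    have p2 := mul_nonneg hA0 hP
    have p3 := mul_nonneg hA0 hQ
    have p4 := mul_nonneg hA0 p1
    have p5 := mul_nonneg hB.le hQ
    have p6 := mul_nonneg hA0 p5
    have q1 : 0 ≤ (1 - τ) := by linarith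
    have r1 := mul_nonneg hτ0 p1
    have r2 := mul_nonneg hτ0 p2
    have r4 := mul_nonneg hτ0 p4
    have s3 := mul_nonneg q1 p3
    have s5 := mul_nonneg q1 p5
    have s6 := mul_nonneg q1 p6
    refine this.trans ?_
    nlinarith only [p1, p2, p4, r1, r2, r4, s3, s5, s6]

lemma measurable_slope (T : ℝ) : Measurable (slope T) := by
  unfold slope
  exact Measurable.ite (measurableSet_le measurable_const continuous_bracket.measurable) measurable_const
    (measurable_id.div continuous_bracket.measurable)

lemma continuous_surfIn (T : ℝ) : Continuous (surfIn T) := by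
  have := continuous_bracket
  unfold surfIn; fun_prop

lemma continuous_surfOut (T : ℝ) : Continuous (surfOut T) := by
  have := continuous_bracket
  unfold surfOut; fun_prop

lemma lintegral_sum_le {α : Type*} (s : Finset α) {g : α → ℝ → ℝ} {A : ℝ}
    (hm : ∀ e ∈ s, Measurable (g e)) (hnn : ∀ e ∈ s, ∀ x, 0 < x → 0 ≤ g e x)
    (h : ∀ e ∈ s, ∫⁻ x in Ioi 0, ENNReal.ofReal (g e x) ≤ ENNReal.ofReal A) :
    ∫⁻ x in Ioi 0, ENNReal.ofReal (∑ e ∈ s, g e x) ≤ s.card * ENNReal.ofReal A := by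
  calc _ = ∫⁻ x in Ioi 0, ∑ e ∈ s, ENNReal.ofReal (g e x) := setLIntegral_congr_fun measurableSet_Ioi
        fun x hx => ENNReal.ofReal_sum_of_nonneg fun e he => hnn e he x hx
    _ = ∑ e ∈ s, ∫⁻ x in Ioi 0, ENNReal.ofReal (g e x) :=
        lintegral_finsetSum' _ fun e he => (hm e he).ennreal_ofReal.aemeasurable
    _ ≤ _ := by
        refine (Finset.sum_le_card_nsmul _ _ _ h).trans_eq (nsmul_eq_mul _ _)

lemma lintegral_outDensity_le {N : ℕ} {W : JetIdx N → ℝ → ℝ → ℂ}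
    (hW : ∀ i, Continuous (Function.uncurry (W i))) {T A : ℝ} (hT : 1 ≤ T) {κ : ℝ → ℝ}
    (hκ : Measurable κ) (hκ0 : ∀ x, 0 < x → 0 ≤ κ x)
    (h : ∀ i j, j ≤ N → jetOrd i ≤ j + 1 → ∫⁻ x in Ioi 0, ENNReal.ofReal (κ x *
      (‖W i (surfIn T x) (surfOut T x)‖ ^ 2 * nullWeight N j (surfIn T x) (surfOut T x))) ≤
        ENNReal.ofReal A) :
    ∫⁻ x in Ioi 0, ENNReal.ofReal (κ x * outDensity N jetOrd W (surfIn T x) (surfOut T x)) ≤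
      (Fintype.card (JetIdx N) * (N + 1) : ℕ) * ENNReal.ofReal A := by
  set s : Finset ((_ : JetIdx N) × ℕ) := Finset.univ.sigma fun i : JetIdx N =>
    (Finset.range (N + 1)).filter fun j => jetOrd i ≤ j + 1 with hs
  have hmem : ∀ e ∈ s, e.2 ≤ N ∧ jetOrd e.1 ≤ e.2 + 1 := fun e he => by
    simp only [hs, Finset.mem_sigma, Finset.mem_univ, Finset.mem_filter, Finset.mem_range, true_and] at he
    omega
  have hcard : s.card ≤ Fintype.card (JetIdx N) * (N + 1) := by
    rw [hs, Finset.card_sigma]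
    refine (Finset.sum_le_card_nsmul _ _ (N + 1) fun i _ => ?_).trans_eq (by simp)
    exact (Finset.card_filter_le _ _).trans (by simp)
  have e : ∀ x, κ x * outDensity N jetOrd W (surfIn T x) (surfOut T x) = ∑ e ∈ s, κ x *
      (‖W e.1 (surfIn T x) (surfOut T x)‖ ^ 2 * nullWeight N e.2 (surfIn T x) (surfOut T x)) := fun x => by
    rw [hs, Finset.sum_sigma, outDensity]
    simp only [Finset.mul_sum]
  simp only [e]
  refine (lintegral_sum_le s (fun e _ => ?_) (fun e _ x hx => ?_) fun e he =>
    h e.1 e.2 (hmem e he).1 (hmem e he).2).trans ?_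
  · have c1 := (hW e.1).comp ((continuous_surfIn T).prodMk (continuous_surfOut T))
    have c2 := (continuous_nullWeight N e.2).comp ((continuous_surfIn T).prodMk (continuous_surfOut T))
    exact hκ.mul ((c1.norm.pow 2).mul c2).measurable
  · exact mul_nonneg (hκ0 x hx) (mul_nonneg (sq_nonneg _) ((inExt_surf hT hx.le).nullWeight_nonneg N _))
  · gcongr

/-- The energy on the right half of the exterior boundary. -/
lemma exists_half_energy_le {N : ℕ} (hN : 1 ≤ N) : ∃ C ε : ℝ, 0 < C ∧ 0 < ε ∧ ∀ {u v : ℝ × ℝ → ℂ},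
    ContDiff ℝ (N + 4 : ℕ) u → ContDiff ℝ (N + 4 : ℕ) v → IsSolution u v → ∀ {η : ℝ}, 0 < η → η ≤ ε →
    totalExtEnergy N u v 1 ≤ ENNReal.ofReal η → ∀ T, 1 < T → ∀ I : ℕ × ℕ, ∀ k, I.1 + I.2 ≤ N → k ≤ 3 →
      ∀ φ ∈ ({u, v} : Set (ℝ × ℝ → ℂ)), ∫⁻ x in Ioi 0, ENNReal.ofReal
        (energyDensity (slope T x) (vf I k φ) (surf T x) * weight N (I.1 + I.2) (surf T x)) ≤
          ENNReal.ofReal (C * η ^ 2) := by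
  obtain ⟨B, ε, hB, hε, hb⟩ := exists_energyDensity_le hN
  set n : ℕ := Fintype.card (JetIdx N) * (N + 1) with hn
  refine ⟨2 * (B * (n * B)) + 1, ε, by positivity, hε, ?_⟩
  intro u v hu hv hsol η hη hηε hE T hT I k hI hk φ hφ
  obtain ⟨h1, h2⟩ := hb hu hv hsol hη hηε hE
  have m1 : Measurable fun x => 1 + slope T x := (measurable_slope T).const_add 1
  have m2 : Measurable fun x => 1 - slope T x := (measurable_slope T).const_sub 1
  have i1 := lintegral_outDensity_le (A := B * η ^ 2) (continuous_jetField hv (1 / 2)) hT.le m1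
    (fun x hx => by linarith [slope_nonneg T hx.le]) fun i j hj hij =>
      lintegral_surf_out_le hT.le N j (continuous_jetField hv (1 / 2) i)
        fun z₀ hz => (h1 T z₀ hT.le hz i j hj hij).2
  have i2 := lintegral_outDensity_le (A := B * η ^ 2) (continuous_jetField hu (-1 / 2)) hT.le m2
    (fun x hx => by linarith [slope_lt_one T x]) fun i j hj hij =>
      lintegral_surf_in_le hT.le N j (continuous_jetField hu (-1 / 2) i)
        fun z₀ hz => (h1 T z₀ hT.le hz i j hj hij).1
  have cdens : ∀ {c : ℝ} {f : ℝ × ℝ → ℂ}, ContDiff ℝ (N + 4 : ℕ) f → Measurable fun x =>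
      outDensity N jetOrd (jetField (N := N) c f) (surfIn T x) (surfOut T x) := by
    intro c f hf
    refine Continuous.measurable ?_
    have c0 := (continuous_surfIn T).prodMk (continuous_surfOut T)
    unfold outDensity
    refine continuous_finsetSum _ fun i _ => continuous_finsetSum _ fun j _ => ?_
    exact (((continuous_jetField hf c i).comp c0).norm.pow 2).mul ((continuous_nullWeight N j).comp c0)
  have M1 : Measurable fun x => (1 + slope T x) *
      outDensity N jetOrd (jetField (N := N) (1 / 2) v) (surfIn T x) (surfOut T x) := m1.mul (cdens hv)
  have M2 : Measurable fun x => (1 - slope T x) *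
      outDensity N jetOrd (jetField (N := N) (-1 / 2) u) (surfIn T x) (surfOut T x) := m2.mul (cdens hu)
  calc _ ≤ ∫⁻ x in Ioi 0, (ENNReal.ofReal B * ENNReal.ofReal ((1 + slope T x) *
          outDensity N jetOrd (jetField (N := N) (1 / 2) v) (surfIn T x) (surfOut T x)) +
        ENNReal.ofReal B * ENNReal.ofReal ((1 - slope T x) *
          outDensity N jetOrd (jetField (N := N) (-1 / 2) u) (surfIn T x) (surfOut T x))) := by
        refine setLIntegral_mono_ae' measurableSet_Ioi (Filter.Eventually.of_forall fun x (hx : 0 < x) => ?_)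
        have hext := inExt_surf hT.le hx.le
        have hlt : 1 < bracket x := by
          unfold bracket
          rw [Real.lt_sqrt zero_le_one]
          nlinarith
        -- For `T > 1` and `x > 0` the point of `S_T` lies strictly after `t = 1`, where the
        -- differentiated equations are available.
        have hmin : 1 < min T (bracket x) := lt_min hT hlt
        have := h2 _ _ hext (by unfold surfIn surfOut; linarith) (slope T x) (slope_nonneg T hx.le)
          (slope_lt_one T x) I k hI hk φ hφ
        rw [pt_surf] at this
        rw [weight_surf hx.le]
        refine (ENNReal.ofReal_le_ofReal this).trans (ENNReal.ofReal_add_le.trans ?_)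
        rw [ENNReal.ofReal_mul hB.le, ENNReal.ofReal_mul hB.le]
    _ = ENNReal.ofReal B * _ + ENNReal.ofReal B * _ := by
        rw [lintegral_add_left (M1.ennreal_ofReal.const_mul _), lintegral_const_mul _ M1.ennreal_ofReal,
          lintegral_const_mul _ M2.ennreal_ofReal]
    _ ≤ ENNReal.ofReal B * (n * ENNReal.ofReal (B * η ^ 2)) +
        ENNReal.ofReal B * (n * ENNReal.ofReal (B * η ^ 2)) := by gcongr
    _ = ENNReal.ofReal (2 * (B * (n * B)) * η ^ 2) := by
        rw [← ENNReal.ofReal_natCast n, ← ENNReal.ofReal_mul (by positivity), ← ENNReal.ofReal_mul hB.le,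
          ← ENNReal.ofReal_add (by positivity) (by positivity)]
        congr 1
        ring
    _ ≤ _ := by
        refine ENNReal.ofReal_le_ofReal ?_
        gcongr
        linarith

end Thirring
end

/-! ### Reflection to the left half, and conclusion. -/

noncomputable section
namespace Thirring
open MeasureTheory Set ComplexConjugate

/-- The spatial reflection. -/
def reflection : (ℝ × ℝ) ≃L[ℝ] (ℝ × ℝ) :=
  (ContinuousLinearEquiv.refl ℝ ℝ).prodCongr (ContinuousLinearEquiv.neg ℝ)

lemma reflection_apply (p : ℝ × ℝ) : reflection p = (p.1, -p.2) := rfl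

/-- `ψ` is the reflection of `φ`, up to the sign `s`. -/
def IsReflected (s : ℝ) (φ ψ : ℝ × ℝ → ℂ) : Prop := ψ = fun p => s • φ (reflection p)

namespace IsReflected

variable {s : ℝ} {φ ψ : ℝ × ℝ → ℂ}

lemma fderiv_apply (h : IsReflected s φ ψ) (p e : ℝ × ℝ) :
    fderiv ℝ ψ p e = s • fderiv ℝ φ (reflection p) (reflection e) := by
  have e1 : ψ = s • (φ ∘ reflection) := h
  rw [e1, fderiv_const_smul_field, Pi.smul_apply, reflection.comp_right_fderiv]
  rfl

lemma dt (h : IsReflected s φ ψ) : IsReflected s (dt φ) (dt ψ) := by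
  funext p
  rw [Thirring.dt, h.fderiv_apply, Thirring.dt, reflection_apply (1, 0), neg_zero]

lemma dx (h : IsReflected s φ ψ) : IsReflected (-s) (dx φ) (dx ψ) := by
  funext p
  have : (reflection (0, 1)) = -((0, 1) : ℝ × ℝ) := by ext <;> simp [reflection_apply]
  rw [Thirring.dx, h.fderiv_apply, Thirring.dx, this, map_neg, smul_neg, neg_smul]

lemma boost (h : IsReflected s φ ψ) : IsReflected (-s) (boost φ) (boost ψ) := by
  funext p
  rw [Thirring.boost, h.dt, h.dx, Thirring.boost]
  simp only [reflection_apply, Complex.real_smul]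
  push_cast
  ring

lemma iterate {op : (ℝ × ℝ → ℂ) → ℝ × ℝ → ℂ} {ε : ℝ}
    (hop : ∀ {s φ ψ}, IsReflected s φ ψ → IsReflected (ε * s) (op φ) (op ψ)) (h : IsReflected s φ ψ)
    (n : ℕ) : IsReflected (ε ^ n * s) (op^[n] φ) (op^[n] ψ) := by
  induction n with
  | zero => simpa using h
  | succ n ih =>
    rw [Function.iterate_succ_apply', Function.iterate_succ_apply', pow_succ', mul_assoc]
    exact hop ih

lemma vf (h : IsReflected s φ ψ) (I : ℕ × ℕ) (k : ℕ) :
    IsReflected ((-1) ^ I.2 * ((-1) ^ k * s)) (vf I k φ) (vf I k ψ) := by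
  have h1 := h.iterate (ε := -1) (op := Thirring.boost) (fun h => by simpa using h.boost) k
  have h2 := h1.iterate (ε := -1) (op := Thirring.dx) (fun h => by simpa using h.dx) I.2
  have h3 := h2.iterate (ε := 1) (op := Thirring.dt) (fun h => by simpa using h.dt) I.1
  simpa [Thirring.vf] using h3

lemma energyDensity (h : IsReflected s φ ψ) (hs : s ^ 2 = 1) (τ : ℝ) (p : ℝ × ℝ) :
    energyDensity τ ψ p = energyDensity (-τ) φ (reflection p) := by
  have hn : ‖s‖ ^ 2 = 1 := by rw [Real.norm_eq_abs, sq_abs, hs]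
  unfold Thirring.energyDensity
  rw [h.dt, h.dx, h]
  simp only [norm_smul, mul_pow, norm_neg, hn, one_mul]
  simp only [Complex.real_smul, map_mul, Complex.conj_ofReal]
  have : ((-s : ℝ) : ℂ) * conj (Thirring.dx φ (reflection p)) * (s * Thirring.dt φ (reflection p)) =
      (-(s ^ 2) : ℝ) * (conj (Thirring.dx φ (reflection p)) * Thirring.dt φ (reflection p)) := by
    push_cast; ring
  rw [this, Complex.re_ofReal_mul, hs]
  ring

end IsReflected

lemma bracket_neg (x : ℝ) : bracket (-x) = bracket x := by rw [bracket, neg_sq, bracket]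

lemma slope_neg (T x : ℝ) : slope T (-x) = -slope T x := by
  unfold slope
  rw [bracket_neg]
  split_ifs
  · simp
  · rw [neg_div]

lemma surf_neg (T x : ℝ) : surf T (-x) = reflection (surf T x) := by
  rw [reflection_apply, surf, bracket_neg, surf]

lemma weight_reflection (N j : ℕ) (p : ℝ × ℝ) : weight N j (reflection p) = weight N j p := by
  simp [weight, reflection_apply]

lemma isReflected_comp (φ : ℝ × ℝ → ℂ) : IsReflected 1 φ (φ ∘ reflection) := by
  funext p
  simp

lemma energy_comp_reflection (φ : ℝ × ℝ → ℂ) (N j : ℕ) (T : ℝ) (I : ℕ × ℕ) (k : ℕ) (x : ℝ) :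
    energyDensity (slope T x) (vf I k (φ ∘ reflection)) (surf T x) * weight N j (surf T x) =
      energyDensity (slope T (-x)) (vf I k φ) (surf T (-x)) * weight N j (surf T (-x)) := by
  rw [((isReflected_comp φ).vf I k).energyDensity (by
    rw [mul_pow, mul_pow, ← pow_mul, ← pow_mul, mul_comm I.2, mul_comm k, pow_mul, pow_mul]; simp),
    slope_neg, surf_neg, weight_reflection]

lemma extEnergy_comp_reflection (φ : ℝ × ℝ → ℂ) (N j : ℕ) (T : ℝ) (I : ℕ × ℕ) (k : ℕ) :
    extEnergy T (vf I k (φ ∘ reflection)) (weight N j) = extEnergy T (vf I k φ) (weight N j) := by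
  rw [extEnergy_eq, extEnergy_eq]
  simp only [energy_comp_reflection]
  rw [lintegral_neg_eq_self (fun x => ENNReal.ofReal
    (energyDensity (slope T x) (vf I k φ) (surf T x) * weight N j (surf T x)))]

lemma totalExtEnergy_reflection (N : ℕ) (u v : ℝ × ℝ → ℂ) (T : ℝ) :
    totalExtEnergy N (v ∘ reflection) (u ∘ reflection) T = totalExtEnergy N u v T := by
  unfold totalExtEnergy
  simp only [extEnergy_comp_reflection]
  refine Finset.sum_congr rfl fun j _ => Finset.sum_congr rfl fun I _ => Finset.sum_congr rfl fun k _ =>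
    add_comm _ _

/-- The reflection exchanges the two null directions, hence the roles of the components. -/
lemma IsSolution.reflection {u v : ℝ × ℝ → ℂ} (h : IsSolution u v) :
    IsSolution (v ∘ reflection) (u ∘ reflection) := by
  intro t x ht
  obtain ⟨h1, h2⟩ := h t (-x) ht
  have e1 := fun φ : ℝ × ℝ → ℂ => congrFun (isReflected_comp φ).dt (t, x)
  have e2 := fun φ : ℝ × ℝ → ℂ => congrFun (isReflected_comp φ).dx (t, x)
  simp only [e1, e2, one_smul, neg_smul, Function.comp, reflection_apply]
  exact ⟨by rw [← sub_eq_add_neg]; exact h2, by rw [sub_neg_eq_add]; exact h1⟩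

lemma lintegral_le_half_add (g : ℝ → ℝ≥0∞) :
    ∫⁻ x, g x ≤ (∫⁻ x in Ioi 0, g x) + ∫⁻ x in Ioi 0, g (-x) := by
  have e : ∫⁻ x in Iio 0, g x = ∫⁻ x in Ioi 0, g (-x) := by
    rw [← lintegral_indicator measurableSet_Iio, ← lintegral_indicator measurableSet_Ioi,
      ← lintegral_neg_eq_self (indicator _ _)]
    refine lintegral_congr fun x => ?_
    simp [indicator]
  rw [← e, ← lintegral_add_compl g measurableSet_Ioi (μ := volume) (A := Ioi (0 : ℝ)), compl_Ioi,
    setLIntegral_congr Iio_ae_eq_Iic]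

/-- The energy on the left half is the energy on the right half for the reflected solution, which
has the same initial energy. -/
lemma exists_extEnergy_le {N : ℕ} (hN : 1 ≤ N) : ∃ C ε : ℝ, 0 < C ∧ 0 < ε ∧ ∀ {u v : ℝ × ℝ → ℂ},
    ContDiff ℝ (N + 4 : ℕ) u → ContDiff ℝ (N + 4 : ℕ) v → IsSolution u v → ∀ {η : ℝ}, 0 < η → η ≤ ε →
    totalExtEnergy N u v 1 ≤ ENNReal.ofReal η → ∀ T, 1 < T → ∀ I : ℕ × ℕ, ∀ k, I.1 + I.2 ≤ N → k ≤ 3 →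
      ∀ φ ∈ ({u, v} : Set (ℝ × ℝ → ℂ)),
        extEnergy T (vf I k φ) (weight N (I.1 + I.2)) ≤ ENNReal.ofReal (C * η) := by
  obtain ⟨C, ε, hC, hε, hb⟩ := exists_half_energy_le hN
  refine ⟨√(2 * C), ε, Real.sqrt_pos.2 (by positivity), hε, ?_⟩
  intro u v hu hv hsol η hη hηε hE T hT I k hI hk φ hφ
  rw [extEnergy_eq, rpow_half_le (by positivity), mul_pow, Real.sq_sqrt (by positivity)]
  have h1 := hb hu hv hsol hη hηε hE T hT I k hI hk φ hφ
  have h2 := hb (hv.comp reflection.contDiff) (hu.comp reflection.contDiff) hsol.reflection hη hηε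
    (by rwa [totalExtEnergy_reflection]) T hT I k hI hk (φ ∘ reflection) (by
      simp only [mem_insert_iff, mem_singleton_iff] at hφ ⊢
      rcases hφ with rfl | rfl
      · exact Or.inr rfl
      · exact Or.inl rfl)
  simp only [energy_comp_reflection] at h2
  refine (lintegral_le_half_add _).trans ((add_le_add h1 h2).trans_eq ?_)
  rw [← ENNReal.ofReal_add (by positivity) (by positivity)]
  congr 1
  ring

/-- The number of summands in the total energy. -/
def energyCount (N : ℕ) : ℕ :=
  ∑ j ∈ Finset.range (N + 1), ∑ _I ∈ Finset.HasAntidiagonal.antidiagonal j, ∑ _k ∈ Finset.range 4, 2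

lemma totalExtEnergy_le {N : ℕ} {u v : ℝ × ℝ → ℂ} {T : ℝ} {B : ℝ≥0∞}
    (h : ∀ I : ℕ × ℕ, ∀ k, I.1 + I.2 ≤ N → k ≤ 3 → ∀ φ ∈ ({u, v} : Set (ℝ × ℝ → ℂ)),
      extEnergy T (vf I k φ) (weight N (I.1 + I.2)) ≤ B) :
    totalExtEnergy N u v T ≤ energyCount N * B := by
  unfold totalExtEnergy energyCount
  push_cast
  simp only [Finset.sum_mul]
  refine Finset.sum_le_sum fun j hj => Finset.sum_le_sum fun I hI => Finset.sum_le_sum fun k hk => ?_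
  rw [Finset.mem_range] at hj hk
  rw [Finset.HasAntidiagonal.mem_antidiagonal] at hI
  rw [two_mul, ← hI]
  exact add_le_add (h I k (by omega) (by omega) u (by simp)) (h I k (by omega) (by omega) v (by simp))

/-- Small exterior energies stay comparable to their initial value. -/
theorem exists_totalExtEnergy_le {N : ℕ} (hN : 1 ≤ N) :
    ∃ ε : ℝ, 0 < ε ∧ ∃ C : ℝ, 0 < C ∧
      ∀ u v : ℝ × ℝ → ℂ,
        ContDiff ℝ ((N + 4 : ℕ) : WithTop ℕ∞) u →
        ContDiff ℝ ((N + 4 : ℕ) : WithTop ℕ∞) v →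
        IsSolution u v →
        totalExtEnergy N u v 1 ≤ ENNReal.ofReal ε →
        ∀ T : ℝ, 1 ≤ T →
          totalExtEnergy N u v T
            ≤ ENNReal.ofReal C * totalExtEnergy N u v 1 := by
  obtain ⟨C, ε, hC, hε, hb⟩ := exists_extEnergy_le hN
  set D : ℝ := energyCount N * C + 1 with hD
  have hcount : 0 ≤ energyCount N * C := by positivity
  -- Half of the smallness threshold is reserved for the perturbation `r` below; the summand one in
  -- `D` makes `D ≥ 1`, which settles `T = 1`.
  refine ⟨ε / 2, by positivity, D, by positivity, fun u v hu hv hsol hE T hT => ?_⟩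
  rcases hT.eq_or_lt with rfl | hT
  · exact le_mul_of_one_le_left zero_le (by rw [ENNReal.one_le_ofReal]; linarith)
  have hfin : totalExtEnergy N u v 1 ≠ ⊤ := (hE.trans_lt ENNReal.ofReal_lt_top).ne
  set a := (totalExtEnergy N u v 1).toReal with ha
  have ha0 : 0 ≤ a := ENNReal.toReal_nonneg
  have hE1 : totalExtEnergy N u v 1 = ENNReal.ofReal a := (ENNReal.ofReal_toReal hfin).symm
  have haε : a ≤ ε / 2 := ENNReal.toReal_le_of_le_ofReal (by positivity) hE
  -- The estimates need a positive size `η`, but the initial energy `a` may vanish; they are used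
  -- with `η = a + r`, and then `r` tends to zero.
  have step : ∀ r : ℝ, 0 < r → r ≤ ε / 2 → totalExtEnergy N u v T ≤ ENNReal.ofReal (D * (a + r)) := by
    intro r hr hrε
    refine (totalExtEnergy_le (hb hu hv hsol (η := a + r) (by linarith) (by linarith)
      (hE1.trans_le (ENNReal.ofReal_le_ofReal (by linarith))) T hT)).trans ?_
    rw [← ENNReal.ofReal_natCast, ← ENNReal.ofReal_mul (by positivity)]
    refine ENNReal.ofReal_le_ofReal ?_
    nlinarith
  have hlim : Filter.Tendsto (fun r : ℝ => ENNReal.ofReal (D * (a + r))) (nhdsWithin 0 (Set.Ioi 0))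
      (nhds (ENNReal.ofReal (D * (a + 0)))) := by
    refine Filter.Tendsto.mono_left (Continuous.tendsto ?_ 0) nhdsWithin_le_nhds
    exact ENNReal.continuous_ofReal.comp (by fun_prop)
  have := ge_of_tendsto hlim (by
    filter_upwards [Ioc_mem_nhdsGT (show (0 : ℝ) < ε / 2 by positivity)] with r hr
    exact step r hr.1 hr.2)
  rwa [add_zero, ENNReal.ofReal_mul (by positivity), ← hE1] at this

end Thirring
end

theorem theorem2 (N : ℕ) (hN : 1 ≤ N) :
    ∃ ε : ℝ, 0 < ε ∧ ∃ C : ℝ, 0 < C ∧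
      ∀ u v : ℝ × ℝ → ℂ,
        ContDiff ℝ ((N + 4 : ℕ) : WithTop ℕ∞) u →
        ContDiff ℝ ((N + 4 : ℕ) : WithTop ℕ∞) v →
        Thirring.IsSolution u v →
        Thirring.totalExtEnergy N u v 1 ≤ ENNReal.ofReal ε →
        ∀ T : ℝ, 1 ≤ T →
          Thirring.totalExtEnergy N u v T
            ≤ ENNReal.ofReal C * Thirring.totalExtEnergy N u v 1 :=
  Thirring.exists_totalExtEnergy_le hN
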